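/- **Setting.** Let $n\ge 2$, $Q=[-1,1]^{n-1}\subset\mathbf R^{n-1}$. For $A>0$, $N\in\mathbf N$, $\varepsilon>0$, a function $\Phi\in C^N(Q;\mathbf R)$ is called an *elliptic phase with parameters $(A,N,\varepsilon)$* if $\sup_Q|\partial^\alpha\Phi|\le A$ for all $|\alpha|\le N$, $\Phi(0)=0$, $\nabla\Phi(0)=0$, and for every $x\in Q$ all eigenvalues of the Hessian of $\Phi$ at $x$ lie in $[1-\varepsilon,1+\varepsilon]$. Put $$\Re^*f(\underline x,x_n)=\int_Q e^{-2\pi i(\underline x\cdot y+x_n\Phi(y))}f(y)\,dy,\qquad (\underline x,x_n)\in\mathbf R^{n-1}\times\mathbf R .$$ - $R^*_A(p\to q)$ denotes the statement: there is a constant $C$ such that for every elliptic phase $\Phi$ with parameters $(A,N,\varepsilon)$ and every test function $f$ (a $C^\infty$ complex-valued function on $\mathbf R^{n-1}$ supported in $Q$), $\|\Re^*f\|_{L^q(\mathbf R^n)}\le C\|f\|_{L^p}$. - $R^*_A(p_1\times p_2\to q)$ denotes the statement: for every $\kappa>0$ there is a constant $C$ such that for every elliptic phase $\Phi$ with parameters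 $(A,N,\varepsilon)$, all closed axis-parallel subcubes $Q_1,Q_2\subset Q$ whose side lengths and whose mutual distance are at least $\kappa$, and all test functions $f,g$ supported in $Q_1,Q_2$ respectively, $\|\Re^*f\,\Re^*g\|_{L^q(\mathbf R^n)}\le C\|f\|_{L^{p_1}}\|g\|_{L^{p_2}}$. **Theorem.** For every $n\ge2$ there are $N_0\in\mathbf N$, $\varepsilon_1>0$ and $A_0>0$, depending only on $n$, such that the following holds for all $N\ge N_0$, $0<\varepsilon\le\varepsilon_1$, $A>0$. Let $1<p,q<\infty$ satisfy $$2q>\frac{2n}{n-1}\qquad\text{and}\qquad p'\le\frac{n-1}{n+1}\,2q ,$$ where $p'=p/(p-1)$. Then: 1. $R^*_A(p\to 2q)$ implies $R^*_A(p\times p\to q)$. 2. If there is a neighbourhood $U$ of $(\frac1p,\frac1q)$ in $\mathbf R^2$ such that $R^*_{\max(A,A_0)}(\tilde p\times\tilde p\to\tilde q)$ holds for all $\tilde p,\tilde q>0$ with $(\frac1{\tilde p},\frac1{\tilde q})\in U$, then $R^*_A(p\to2q)$ holds. In particular, for fixed $A\ge A_0$ both implications hold with the same $A$. -/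

import Mathlib

open scoped NNReal ENNReal Topology ContDiff

noncomputable section

/-- The closed axis-parallel cube in `ℝᵐ` with centre `c` and side length `2 * r`. -/
def cube {m : ℕ} (c : EuclideanSpace ℝ (Fin m)) (r : ℝ) : Set (EuclideanSpace ℝ (Fin m)) :=
  {x | ∀ i, |x i - c i| ≤ r}

/-- The cube `Q = [-1,1]^m`. -/
def unitCube (m : ℕ) : Set (EuclideanSpace ℝ (Fin m)) := cube 0 1

/-- The partial derivative `∂_{i 0} ⋯ ∂_{i (k-1)} Φ (x)` of order `k` of a function on `Q`
(one-sided on the boundary of `Q`). -/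
def partialDeriv {m : ℕ} (Φ : EuclideanSpace ℝ (Fin m) → ℝ) {k : ℕ} (i : Fin k → Fin m)
    (x : EuclideanSpace ℝ (Fin m)) : ℝ :=
  iteratedFDerivWithin ℝ k Φ (unitCube m) x (fun j => EuclideanSpace.single (i j) (1 : ℝ))

/-- The Hessian matrix of a function on `Q`. -/
def hessianMatrix {m : ℕ} (Φ : EuclideanSpace ℝ (Fin m) → ℝ) (x : EuclideanSpace ℝ (Fin m)) :
    Matrix (Fin m) (Fin m) ℝ :=
  Matrix.of fun a b => partialDeriv Φ ![a, b] x

/-- Elliptic phase functions `Φ : Q → ℝ`, `Q = [-1,1]^m`, with parameters `A`, `N`, `ε`.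
Only the restriction of `Φ` to `Q` matters. -/
structure IsEllipticPhase {m : ℕ} (A : ℝ) (N : ℕ) (ε : ℝ)
    (Φ : EuclideanSpace ℝ (Fin m) → ℝ) : Prop where
  contDiffOn : ContDiffOn ℝ N Φ (unitCube m)
  abs_partialDeriv_le : ∀ k ≤ N, ∀ i : Fin k → Fin m, ∀ x ∈ unitCube m, |partialDeriv Φ i x| ≤ A
  map_zero : Φ 0 = 0
  grad_zero : ∀ i : Fin m, partialDeriv Φ ![i] 0 = 0
  hessian_eigenvalue : ∀ x ∈ unitCube m, ∀ μ : ℝ,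
    Module.End.HasEigenvalue (Matrix.toLin' (hessianMatrix Φ x)) μ → μ ∈ Set.Icc (1 - ε) (1 + ε)

/-- The adjoint restriction (extension) operator
`ℜ* f (x, t) = ∫_Q exp (-2πi (x ⬝ y + t Φ(y))) f(y) dy` on `ℝᵐ × ℝ`. -/
def adjointRestriction {m : ℕ} (Φ : EuclideanSpace ℝ (Fin m) → ℝ)
    (f : EuclideanSpace ℝ (Fin m) → ℂ) (z : EuclideanSpace ℝ (Fin m) × ℝ) : ℂ :=
  ∫ y in unitCube m,
    Complex.exp (-(2 * Real.pi * Complex.I * ((inner ℝ z.1 y + z.2 * Φ y : ℝ) : ℂ))) * f y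

/-- Test functions supported on a set `S`. -/
structure IsTestFunctionOn {m : ℕ} (S : Set (EuclideanSpace ℝ (Fin m)))
    (f : EuclideanSpace ℝ (Fin m) → ℂ) : Prop where
  contDiff : ContDiff ℝ ∞ f
  support_subset : Function.support f ⊆ S

/-- The estimate `R*(p → q)` in `ℝⁿ`: `‖ℜ* f‖_q ≤ C ‖f‖_p` for all test functions `f` on `Q`, with
one constant for all elliptic phases with the given parameters. -/
def LinearRestrictionEstimate (n : ℕ) (A : ℝ) (N : ℕ) (ε : ℝ) (p q : ℝ≥0∞) : Prop :=
  ∃ C : ℝ≥0, ∀ Φ : EuclideanSpace ℝ (Fin (n - 1)) → ℝ, IsEllipticPhase A N ε Φ →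
    ∀ f, IsTestFunctionOn (unitCube (n - 1)) f →
      MeasureTheory.eLpNorm (adjointRestriction Φ f) q MeasureTheory.volume ≤
        C * MeasureTheory.eLpNorm f p MeasureTheory.volume

/-- Two subcubes of `Q`, given by centres and half side lengths, whose side lengths and separation
are at least `κ`. (They are automatically bounded above, because the cubes lie in `Q`.) -/
structure SeparatedSubcubes {m : ℕ} (κ : ℝ) (c₁ : EuclideanSpace ℝ (Fin m)) (r₁ : ℝ)
    (c₂ : EuclideanSpace ℝ (Fin m)) (r₂ : ℝ) : Prop where
  subset_left : cube c₁ r₁ ⊆ unitCube m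
  subset_right : cube c₂ r₂ ⊆ unitCube m
  le_side_left : κ ≤ 2 * r₁
  le_side_right : κ ≤ 2 * r₂
  le_dist : ∀ x ∈ cube c₁ r₁, ∀ y ∈ cube c₂ r₂, κ ≤ dist x y

/-- The estimate `R*(p₁ × p₂ → q)` in `ℝⁿ`: `‖ℜ* f ℜ* g‖_q ≤ C ‖f‖_{p₁} ‖g‖_{p₂}` for all test
functions `f`, `g` supported on subcubes `Q₁`, `Q₂` of `Q` whose size and separation are comparable
to `1`. For each comparability constant `κ` there is one constant `C` for all such cubes and all
elliptic phases with the given parameters. -/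
def BilinearRestrictionEstimate (n : ℕ) (A : ℝ) (N : ℕ) (ε : ℝ) (p₁ p₂ q : ℝ≥0∞) : Prop :=
  ∀ κ : ℝ, 0 < κ → ∃ C : ℝ≥0,
    ∀ Φ : EuclideanSpace ℝ (Fin (n - 1)) → ℝ, IsEllipticPhase A N ε Φ →
    ∀ (c₁ c₂ : EuclideanSpace ℝ (Fin (n - 1))) (r₁ r₂ : ℝ), SeparatedSubcubes κ c₁ r₁ c₂ r₂ →
    ∀ f g, IsTestFunctionOn (cube c₁ r₁) f → IsTestFunctionOn (cube c₂ r₂) g →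
      MeasureTheory.eLpNorm (fun z => adjointRestriction Φ f z * adjointRestriction Φ g z) q
          MeasureTheory.volume ≤
        C * MeasureTheory.eLpNorm f p₁ MeasureTheory.volume *
          MeasureTheory.eLpNorm g p₂ MeasureTheory.volume

end

/-!
A linear estimate implies the bilinear one by Hölder's inequality
(`LinearRestrictionEstimate.bilinear`). For the converse write `a = 1 / p`, `b = 1 / q` and
`m = n - 1`. Since `‖ℜ* f‖_{2q}² = ‖(ℜ* f)²‖_q`, duality
(`eLpNorm_le_of_forall_enorm_integral_mul_le`) reduces the linear estimate to the bound
`|∫ (ℜ* f)² h| ≲ ‖f‖_p² ‖h‖_{q'}` for bounded `h` carried by a set of finite measure.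

Off the diagonal, `Q × Q` is a disjoint union of products of dyadic cubes whose side is comparable
to their distance (`exists_mem_whitneyPairs`), and the trilinear form splits accordingly
(`enorm_integral_le_tsum_whitney`). A parabolic rescaling carries each such pair to cubes of size
and separation comparable to `1`. It turns the phase into another elliptic phase: derivatives of
order at least three improve, the Hessian is preserved, and terms of lower order are controlled by
the Hessian (`IsEllipticPhase.rescaledPhase`), which is why the parameter `A` only has to be
enlarged to `max A A₀`. The bilinear hypothesis, extended to bounded measurable functions, therefore
bounds every pair of cubes of side `2⁻ʲ`, with a constant which is an explicit power of `2ʲ`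
(`BilinearRestrictionEstimate.exists_whitneyEstimate`).

For a fixed scale the products `ℜ* f_k ℜ* f_k'` have space frequencies in the sum sets of the
pairs, which overlap boundedly. They are thus almost orthogonal, and testing them against `h` costs
only an `ℓˢ` norm of their `L^q` norms, for `1 / s ≥ max b (1 - b)` (`sum_stProj_rpow_le`,
`sum_enorm_integral_mul_le`).

To sum over the scales, `f` and `h` are cut into atoms, the `i`-th of which has height at most `l i`
and is carried by a set of measure at most `2 ^ (-M i)`, such that these bounds determine the `L^p`
norm up to a constant (`exists_atomic_decomposition`). Every `L^p` norm of an atom is bounded by a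
product of powers of height and measure, so the bilinear estimates at the exponents `(a + α, b ± β)` near
`(a, b)` may be compared directly with the desired one. They give a factor which decays
geometrically in the distance between the scale of the cubes and the scales of the three atoms
(`sum_enorm_integral_le_of_whitneyEstimate`); this takes the place of multilinear interpolation. The
remaining sum over scales is bounded by Young's and Hölder's inequalities
(`exists_tsum_scales_le`, `exists_trilinear_bound`). It converges because the power of `2ʲ` left
over is nonpositive if `p ≤ 2q`, and negative whenever embeddings between the sequence spaces are
not available (`exists_exponent_perturbation`); the two conditions on `p` and `q` enter there.
-/

open MeasureTheory

/-! ### Sums of dyadic powers -/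

lemma two_rpow_ne_top (x : ℝ) : (2 : ℝ≥0∞) ^ x ≠ ⊤ := by
  simp [ENNReal.rpow_eq_top_iff]

lemma two_rpow_add (x y : ℝ) : (2 : ℝ≥0∞) ^ (x + y) = 2 ^ x * 2 ^ y :=
  ENNReal.rpow_add _ _ (by norm_num) (by norm_num)

lemma two_rpow_le_two_rpow {x y : ℝ} (h : x ≤ y) : (2 : ℝ≥0∞) ^ x ≤ 2 ^ y :=
  ENNReal.rpow_le_rpow_of_exponent_le (by norm_num) h

lemma two_rpow_neg_natCast (k : ℕ) : (2 : ℝ≥0∞) ^ (-(k : ℝ)) = 2⁻¹ ^ k := by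
  rw [ENNReal.rpow_neg, ENNReal.rpow_natCast, ENNReal.inv_pow]

lemma tsum_two_rpow_neg_mul_nat_lt_top {a : ℝ} (ha : 0 < a) :
    ∑' k : ℕ, (2 : ℝ≥0∞) ^ (-(a * k)) < ⊤ := by
  have h : ∀ k : ℕ, (2 : ℝ≥0∞) ^ (-(a * k)) = ((2 : ℝ≥0∞) ^ (-a)) ^ k := fun k => by
    rw [← ENNReal.rpow_natCast, ← ENNReal.rpow_mul]; ring_nf
  simp_rw [h]
  rw [ENNReal.tsum_geometric]
  refine ENNReal.inv_lt_top.2 (tsub_pos_of_lt ?_)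
  calc (2 : ℝ≥0∞) ^ (-a) < 2 ^ (0 : ℝ) :=
        ENNReal.rpow_lt_rpow_of_exponent_lt (by norm_num) (by norm_num) (by linarith)
    _ = 1 := by simp

lemma tsum_two_rpow_neg_mul_abs_lt_top {a : ℝ} (ha : 0 < a) :
    ∑' k : ℤ, (2 : ℝ≥0∞) ^ (-(a * |(k : ℝ)|)) < ⊤ := by
  have h := tsum_two_rpow_neg_mul_nat_lt_top ha
  have hle : ∑' k : ℤ, (2 : ℝ≥0∞) ^ (-(a * |(k : ℝ)|)) ≤
      ∑' k : ℕ, (2 : ℝ≥0∞) ^ (-(a * k)) + ∑' k : ℕ, (2 : ℝ≥0∞) ^ (-(a * k)) := by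
    rw [← Summable.tsum_add ENNReal.summable ENNReal.summable]
    have : ∀ k : ℤ, (2 : ℝ≥0∞) ^ (-(a * |(k : ℝ)|)) = 2 ^ (-(a * (k.natAbs : ℝ))) := fun k => by
      rw [Nat.cast_natAbs, Int.cast_abs]
    simp_rw [this]
    rw [tsum_of_nat_of_neg_add_one ENNReal.summable ENNReal.summable,
      ← Summable.tsum_add ENNReal.summable ENNReal.summable]
    refine ENNReal.tsum_le_tsum fun k => add_le_add (by simp) (two_rpow_le_two_rpow ?_)
    have : ((-((k : ℤ) + 1)).natAbs : ℝ) = k + 1 := by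
      rw [Int.natAbs_neg]; norm_cast
    rw [this]
    nlinarith
  exact hle.trans_lt (ENNReal.add_lt_top.2 ⟨h, h⟩)

/-- A geometric series whose ratio is at most `1 / 2` is at most twice its largest term. -/
lemma tsum_two_rpow_lt_le {M : ℝ} (hM : 1 ≤ M) (D : ℝ≥0∞) :
    ∑' i : ℤ, (if (2 : ℝ≥0∞) ^ (-(M * i)) < D then (2 : ℝ≥0∞) ^ (-(M * i)) else 0) ≤ 2 * D := by
  have hM0 : 0 < M := by linarith
  rcases eq_or_ne D 0 with rfl | hD0
  · simp
  rcases eq_or_ne D ⊤ with rfl | hDt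
  · simp
  have hDr : 0 < D.toReal := ENNReal.toReal_pos hD0 hDt
  set i₁ : ℤ := ⌈-(Real.logb 2 D.toReal) / M⌉ with hi₁
  have hDl : D = (2 : ℝ≥0∞) ^ (Real.logb 2 D.toReal) := by
    have h2 : (2 : ℝ≥0∞) = ENNReal.ofReal 2 := by simp
    rw [h2, ENNReal.ofReal_rpow_of_pos (by norm_num), Real.rpow_logb (by norm_num) (by norm_num) hDr,
      ENNReal.ofReal_toReal hDt]
  have hkey : ∀ i : ℤ, (2 : ℝ≥0∞) ^ (-(M * i)) < D → i₁ ≤ i := by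
    intro i hi
    rw [hDl] at hi
    have h1 : -(M * i) < Real.logb 2 D.toReal := by
      by_contra hcon
      exact absurd hi (not_lt.2 (two_rpow_le_two_rpow (not_lt.1 hcon)))
    rw [hi₁, Int.ceil_le, div_le_iff₀ hM0]
    nlinarith
  have h2 : (2 : ℝ≥0∞) ^ (-(M * i₁)) ≤ D := by
    conv_rhs => rw [hDl]
    refine two_rpow_le_two_rpow ?_
    have := Int.le_ceil (-(Real.logb 2 D.toReal) / M)
    rw [div_le_iff₀ hM0, ← hi₁] at this
    nlinarith
  have hinj : Function.Injective (fun k : ℕ => i₁ + (k : ℤ)) := fun a b h => by simpa using h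
  rw [← hinj.tsum_eq]
  · calc ∑' k : ℕ, (if (2 : ℝ≥0∞) ^ (-(M * ((i₁ + (k : ℤ) : ℤ) : ℝ))) < D
          then (2 : ℝ≥0∞) ^ (-(M * ((i₁ + (k : ℤ) : ℤ) : ℝ))) else 0)
        ≤ ∑' k : ℕ, D * (2⁻¹ : ℝ≥0∞) ^ k := by
          refine ENNReal.tsum_le_tsum fun k => ?_
          refine le_trans (b := (2 : ℝ≥0∞) ^ (-(M * ((i₁ + (k : ℤ) : ℤ) : ℝ)))) (by split_ifs <;> simp) ?_
          calc (2 : ℝ≥0∞) ^ (-(M * ((i₁ + (k : ℤ) : ℤ) : ℝ)))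
              ≤ 2 ^ (-(M * i₁) + -(k : ℝ)) := by
                refine two_rpow_le_two_rpow ?_
                push_cast
                nlinarith [Nat.cast_nonneg (α := ℝ) k]
            _ = 2 ^ (-(M * i₁)) * (2⁻¹ : ℝ≥0∞) ^ k := by
                rw [two_rpow_add, two_rpow_neg_natCast]
            _ ≤ _ := by gcongr
      _ = 2 * D := by
          rw [ENNReal.tsum_mul_left, ENNReal.tsum_geometric]
          rw [ENNReal.one_sub_inv_two, inv_inv, mul_comm]
  · intro i hi
    simp only [Function.mem_support, ne_eq, ite_eq_right_iff, Classical.not_imp] at hi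
    have := hkey i hi.1
    exact ⟨(i - i₁).toNat, by simp; omega⟩

/-! ### Decomposition of a function by the measure of its superlevel sets -/

section Level

variable {X : Type*} [MeasurableSpace X] (μ : Measure X)

/-- The smallest height above which `f` lives on a set of measure at most `t` (the decreasing
rearrangement of `f` at `t`), for a bounded nonnegative function `f`. -/
noncomputable def level (f : X → ℝ) (t : ℝ≥0∞) : ℝ :=
  sInf {l : ℝ | 0 ≤ l ∧ μ {x | l < f x} ≤ t}

variable {μ}

lemma level_nonneg (f : X → ℝ) (t : ℝ≥0∞) : 0 ≤ level μ f t :=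
  Real.sInf_nonneg fun _ hl => hl.1

lemma bddBelow_level_set (f : X → ℝ) (t : ℝ≥0∞) :
    BddBelow {l : ℝ | 0 ≤ l ∧ μ {x | l < f x} ≤ t} := ⟨0, fun _ hl => hl.1⟩

lemma level_set_nonempty {f : X → ℝ} {K : ℝ} (hK0 : 0 ≤ K) (hK : ∀ x, f x ≤ K) (t : ℝ≥0∞) :
    {l : ℝ | 0 ≤ l ∧ μ {x | l < f x} ≤ t}.Nonempty := by
  refine ⟨K, hK0, ?_⟩
  have : {x | K < f x} = ∅ := by ext x; simpa using hK x
  simp [this]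

lemma measure_level_lt_le {f : X → ℝ} {K : ℝ} (hK0 : 0 ≤ K) (hK : ∀ x, f x ≤ K) (t : ℝ≥0∞) :
    μ {x | level μ f t < f x} ≤ t := by
  have h1 : {x | level μ f t < f x} = ⋃ n : ℕ, {x | level μ f t + 1 / ((n : ℝ) + 1) < f x} := by
    ext x
    simp only [Set.mem_ofPred_eq, Set.mem_iUnion]
    constructor
    · intro h
      obtain ⟨n, hn⟩ := exists_nat_one_div_lt (sub_pos.2 h)
      exact ⟨n, by linarith⟩
    · rintro ⟨n, hn⟩
      have : 0 < 1 / ((n : ℝ) + 1) := by positivity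
      linarith
  have hmono : Monotone fun n : ℕ => {x | level μ f t + 1 / ((n : ℝ) + 1) < f x} := by
    intro a b hab x hx
    simp only [Set.mem_ofPred_eq] at hx ⊢
    have : 1 / ((b : ℝ) + 1) ≤ 1 / ((a : ℝ) + 1) := Nat.one_div_le_one_div hab
    linarith
  rw [h1, hmono.measure_iUnion]
  refine iSup_le fun n => ?_
  obtain ⟨l, hl, hlt⟩ := exists_lt_of_csInf_lt (level_set_nonempty (μ := μ) hK0 hK t)
    (show level μ f t < level μ f t + 1 / ((n : ℝ) + 1) by
      have : 0 < 1 / ((n : ℝ) + 1) := by positivity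
      linarith)
  refine le_trans (measure_mono fun x hx => ?_) hl.2
  simp only [Set.mem_ofPred_eq] at hx ⊢
  linarith

lemma lt_measure_of_lt_level {f : X → ℝ} {t : ℝ≥0∞} {s : ℝ} (hs0 : 0 ≤ s)
    (hs : s < level μ f t) : t < μ {x | s < f x} := by
  by_contra h
  exact absurd hs (not_lt.2 (csInf_le (bddBelow_level_set f t) ⟨hs0, not_lt.1 h⟩))

lemma level_anti {f : X → ℝ} {K : ℝ} (hK0 : 0 ≤ K) (hK : ∀ x, f x ≤ K) {s t : ℝ≥0∞}
    (hst : s ≤ t) : level μ f t ≤ level μ f s :=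
  csInf_le_csInf (bddBelow_level_set f t) (level_set_nonempty hK0 hK s)
    fun _ hl => ⟨hl.1, hl.2.trans hst⟩

/-- The dyadic samples of the decreasing rearrangement control its `L^p` norm: by the layer cake
formula both sides are integrals over heights, which are compared pointwise by a geometric series. -/
lemma tsum_level_rpow_le {f : X → ℝ} (hf : Measurable f) (hf0 : ∀ x, 0 ≤ f x)
    {p M : ℝ} (hp : 0 < p) (hM : 1 ≤ M) :
    ∑' i : ℤ, (2 : ℝ≥0∞) ^ (-(M * i)) *
      ENNReal.ofReal (level μ f ((2 : ℝ≥0∞) ^ (-(M * i)))) ^ p ≤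
    2 * ∫⁻ x, ENNReal.ofReal (f x) ^ p ∂μ := by
  set lev : ℤ → ℝ := fun i => level μ f ((2 : ℝ≥0∞) ^ (-(M * i)))
  have hlev : ∀ i, 0 ≤ lev i := fun i => level_nonneg _ _
  have h1 : ∀ i, ENNReal.ofReal (lev i) ^ p =
      ∫⁻ s in Set.Ioi (0 : ℝ), (Set.Iio (lev i ^ p)).indicator 1 s := by
    intro i
    rw [lintegral_indicator_one measurableSet_Iio, Measure.restrict_apply measurableSet_Iio,
      ENNReal.ofReal_rpow_of_nonneg (hlev i) hp.le, Set.inter_comm, Set.Ioi_inter_Iio,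
      Real.volume_Ioo, sub_zero]
  have h2 : ∫⁻ x, ENNReal.ofReal (f x) ^ p ∂μ =
      ∫⁻ s in Set.Ioi (0 : ℝ), μ {x | s < f x ^ p} := by
    rw [← lintegral_eq_lintegral_meas_lt μ (Filter.Eventually.of_forall fun x =>
      Real.rpow_nonneg (hf0 x) p) (by fun_prop)]
    exact lintegral_congr fun x => ENNReal.ofReal_rpow_of_nonneg (hf0 x) hp.le
  rw [h2, ← lintegral_const_mul' _ _ (by norm_num)]
  simp_rw [show ∀ i : ℤ, ENNReal.ofReal (level μ f ((2 : ℝ≥0∞) ^ (-(M * i)))) ^ p =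
      ENNReal.ofReal (lev i) ^ p from fun _ => rfl, h1]
  simp_rw [← lintegral_const_mul' _ _ (two_rpow_ne_top _)]
  rw [← lintegral_tsum]
  · refine setLIntegral_mono' measurableSet_Ioi fun s hs => ?_
    rw [Set.mem_Ioi] at hs
    refine le_trans (ENNReal.tsum_le_tsum fun i => ?_) (tsum_two_rpow_lt_le hM (μ {x | s < f x ^ p}))
    by_cases hsl : s < lev i ^ p
    · have h3 : s ^ p⁻¹ < lev i := by
        rw [Real.rpow_inv_lt_iff_of_pos hs.le (hlev i) hp]; exact hsl
      have h4 := lt_measure_of_lt_level (μ := μ) (Real.rpow_nonneg hs.le _) h3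
      have h5 : {x | s ^ p⁻¹ < f x} = {x | s < f x ^ p} := by
        ext x
        exact Real.rpow_inv_lt_iff_of_pos hs.le (hf0 x) hp
      rw [h5] at h4
      rw [if_pos h4]
      simp [hsl]
    · simp [hsl]
  · intro i
    exact ((measurable_one.indicator measurableSet_Iio).const_mul _).aemeasurable

/-- Atomic decomposition: a bounded nonnegative function carried by a set of finite measure lives on
disjoint sets `G i`, `i ∈ ℤ`, with `G i` of measure at most `2 ^ (-M i)` and `f ≤ l i` on `G i`,
where `2 ^ (-M i) l_i ^ p` sums to at most a constant times `∫ f ^ p`. -/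
theorem exists_atomic_decomposition {f : X → ℝ} (hf : Measurable f) (hf0 : ∀ x, 0 ≤ f x)
    {K : ℝ} (hK : ∀ x, f x ≤ K) (hfin : μ {x | 0 < f x} < ⊤)
    {p M : ℝ} (hp : 0 < p) (hM : 1 ≤ M) :
    ∃ (l : ℤ → ℝ) (G : ℤ → Set X), (∀ i, 0 ≤ l i) ∧ (∀ i, MeasurableSet (G i)) ∧
      Pairwise (Function.onFun Disjoint G) ∧ (∀ i, μ (G i) ≤ (2 : ℝ≥0∞) ^ (-(M * i))) ∧
      (∀ i, ∀ x ∈ G i, f x ≤ l i) ∧ (∀ᵐ x ∂μ, 0 < f x → ∃ i, x ∈ G i) ∧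
      ∑' i : ℤ, (2 : ℝ≥0∞) ^ (-(M * i)) * ENNReal.ofReal (l i) ^ p ≤
        2 ^ (M + 1) * ∫⁻ x, ENNReal.ofReal (f x) ^ p ∂μ := by
  rcases isEmpty_or_nonempty X with hX | ⟨⟨x₀⟩⟩
  · refine ⟨fun _ => 0, fun _ => ∅, by simp, by simp, ?_, by simp, by simp, ?_, ?_⟩
    · intro i j _; simp [Function.onFun]
    · exact Filter.Eventually.of_forall fun x => (hX.false x).elim
    · simp [hp]
  have hK0 : 0 ≤ K := (hf0 x₀).trans (hK x₀)
  have hM0 : 0 < M := by linarith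
  set lev : ℤ → ℝ := fun i => level μ f ((2 : ℝ≥0∞) ^ (-(M * i))) with hlevdef
  set E : ℤ → Set X := fun i => {x | lev i < f x} with hE
  have hlevmono : Monotone lev := fun i j hij => by
    refine level_anti hK0 hK (two_rpow_le_two_rpow ?_)
    have : (i : ℝ) ≤ j := by exact_mod_cast hij
    nlinarith
  have hEanti : Antitone E := fun i j hij x hx => (hlevmono hij).trans_lt hx
  have hEmeas : ∀ i, MeasurableSet (E i) := fun i => measurableSet_lt measurable_const hf
  have hEle : ∀ i, μ (E i) ≤ (2 : ℝ≥0∞) ^ (-(M * i)) := fun i => measure_level_lt_le hK0 hK _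
  refine ⟨fun i => lev (i + 1), fun i => E i \ E (i + 1), fun i => level_nonneg _ _,
    fun i => (hEmeas i).diff (hEmeas _), ?_, fun i => (measure_mono Set.sdiff_subset).trans (hEle i),
    fun i x hx => not_lt.1 hx.2, ?_, ?_⟩
  · have haux : ∀ i j : ℤ, i < j → Disjoint (E i \ E (i + 1)) (E j \ E (j + 1)) := fun i j hij => by
      rw [Set.disjoint_left]
      exact fun x hx hx' => hx.2 (hEanti (by omega : i + 1 ≤ j) hx'.1)
    intro i j hij
    rcases lt_or_gt_of_ne hij with h | h
    · exact haux i j h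
    · exact (haux j i h).symm
  · have hnull : μ (⋂ i, E i) = 0 := by
      refine le_antisymm (ENNReal.le_of_forall_pos_le_add fun ε hε _ => ?_) bot_le
      obtain ⟨k, hk⟩ := ENNReal.exists_inv_two_pow_lt (ENNReal.coe_pos.2 hε).ne'
      rw [zero_add]
      refine (measure_mono (Set.iInter_subset E k)).trans ((hEle k).trans (le_trans ?_ hk.le))
      rw [← two_rpow_neg_natCast]
      refine two_rpow_le_two_rpow ?_
      push_cast
      nlinarith [Nat.cast_nonneg (α := ℝ) k]
    obtain ⟨i₀, hi₀⟩ : ∃ i : ℤ, lev i = 0 := by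
      obtain ⟨k, hk⟩ := ENNReal.exists_nat_gt hfin.ne
      refine ⟨-k, le_antisymm (csInf_le (bddBelow_level_set _ _) ⟨le_rfl, hk.le.trans ?_⟩)
        (level_nonneg _ _)⟩
      calc (k : ℝ≥0∞) ≤ (2 : ℝ≥0∞) ^ k := by exact_mod_cast k.lt_two_pow_self.le
        _ = 2 ^ (k : ℝ) := by rw [ENNReal.rpow_natCast]
        _ ≤ _ := by
          refine two_rpow_le_two_rpow ?_
          push_cast
          nlinarith [Nat.cast_nonneg (α := ℝ) k]
    have hae : ∀ᵐ x ∂μ, x ∉ ⋂ i, E i := measure_eq_zero_iff_ae_notMem.1 hnull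
    filter_upwards [hae] with x hx hpos
    obtain ⟨j, hj⟩ : ∃ j, x ∉ E j := by simpa using hx
    obtain ⟨i, hi, himax⟩ := Int.exists_greatest_of_bdd (P := fun i => x ∈ E i)
      ⟨j, fun i hi => by
        by_contra hcon
        exact hj (hEanti (not_le.1 hcon).le hi)⟩ ⟨i₀, by simpa [hE, hi₀] using hpos⟩
    exact ⟨i, hi, fun h => by have := himax _ h; omega⟩
  · have h := tsum_level_rpow_le (μ := μ) hf hf0 hp hM
    rw [← (Equiv.addRight (1 : ℤ)).tsum_eq] at h
    calc ∑' i : ℤ, (2 : ℝ≥0∞) ^ (-(M * i)) * ENNReal.ofReal (lev (i + 1)) ^ p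
        = 2 ^ M * ∑' i : ℤ, (2 : ℝ≥0∞) ^ (-(M * ((i + 1 : ℤ) : ℝ))) *
            ENNReal.ofReal (lev (i + 1)) ^ p := by
          rw [← ENNReal.tsum_mul_left]
          congr 1; ext i
          rw [← mul_assoc, ← two_rpow_add]
          congr 2; push_cast; ring
      _ ≤ 2 ^ M * (2 * ∫⁻ x, ENNReal.ofReal (f x) ^ p ∂μ) := by
          gcongr
          exact h
      _ = _ := by
          rw [two_rpow_add, ENNReal.rpow_one, mul_assoc]

end Level

/-! ### Convolution and Hölder inequalities for sums over `ℤ` -/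

lemma ENNReal.tsum_mul_le_weight_mul_Lp {ι : Type*} {p : ℝ} (hp : 1 ≤ p) (w f : ι → ℝ≥0∞) :
    ∑' i, w i * f i ≤ (∑' i, w i) ^ (1 - p⁻¹) * (∑' i, w i * f i ^ p) ^ p⁻¹ := by
  rw [ENNReal.tsum_eq_iSup_sum]
  refine iSup_le fun s => (ENNReal.inner_le_weight_mul_Lp_of_nonneg s hp w f).trans ?_
  have hp' : p⁻¹ ≤ 1 := inv_le_one_of_one_le₀ hp
  exact mul_le_mul' (ENNReal.rpow_le_rpow (ENNReal.sum_le_tsum s) (by linarith))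
    (ENNReal.rpow_le_rpow (ENNReal.sum_le_tsum s) (inv_nonneg.2 (by linarith)))

lemma ENNReal.tsum_mul_le_Lp_mul_Lq {ι : Type*} {p q : ℝ} (hpq : p.HolderConjugate q)
    (f g : ι → ℝ≥0∞) :
    ∑' i, f i * g i ≤ (∑' i, f i ^ p) ^ (1 / p) * (∑' i, g i ^ q) ^ (1 / q) := by
  rw [ENNReal.tsum_eq_iSup_sum]
  refine iSup_le fun s => (ENNReal.inner_le_Lp_mul_Lq s f g hpq).trans ?_
  have hp := hpq.pos
  have hq := hpq.symm.pos
  gcongr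
  · exact ENNReal.sum_le_tsum s
  · exact ENNReal.sum_le_tsum s

/-- Young's inequality `ℓ¹ * ℓᵖ ⊆ ℓᵖ` on `ℤ`. -/
lemma ENNReal.tsum_conv_rpow_le {p : ℝ} (hp : 1 ≤ p) (w A : ℤ → ℝ≥0∞) :
    ∑' j, (∑' i, w (i - j) * A i) ^ p ≤
      (∑' i, w i) ^ (p - 1) * ((∑' i, w (-i)) * ∑' i, A i ^ p) := by
  have hp0 : 0 < p := by linarith
  have h1 : ∀ j, (∑' i, w (i - j) * A i) ^ p ≤
      (∑' i, w i) ^ (p - 1) * ∑' i, w (i - j) * A i ^ p := fun j => by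
    have h := ENNReal.tsum_mul_le_weight_mul_Lp hp (fun i => w (i - j)) A
    have h2 : ∑' i, w (i - j) = ∑' i, w i := (Equiv.subRight j).tsum_eq w
    rw [h2] at h
    calc _ ≤ ((∑' i, w i) ^ (1 - p⁻¹) * (∑' i, w (i - j) * A i ^ p) ^ p⁻¹) ^ p := by gcongr
      _ = _ := by
        rw [ENNReal.mul_rpow_of_nonneg _ _ hp0.le, ← ENNReal.rpow_mul, ← ENNReal.rpow_mul,
          inv_mul_cancel₀ hp0.ne', ENNReal.rpow_one, sub_mul, inv_mul_cancel₀ hp0.ne', one_mul]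
  calc _ ≤ ∑' j, (∑' i, w i) ^ (p - 1) * ∑' i, w (i - j) * A i ^ p := ENNReal.tsum_le_tsum h1
    _ = (∑' i, w i) ^ (p - 1) * ∑' i, (∑' j, w (i - j)) * A i ^ p := by
        rw [ENNReal.tsum_mul_left, ENNReal.tsum_comm]
        simp_rw [ENNReal.tsum_mul_right]
    _ = _ := by
        have h3 : ∀ i, ∑' j, w (i - j) = ∑' j, w (-j) := fun i => by
          rw [← (Equiv.subRight i).tsum_eq (fun j => w (-j))]
          simp
        simp_rw [h3]
        rw [ENNReal.tsum_mul_left]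

/-- The sum over scales. The two factors coming from `f` lie in `ℓᵖ`, the factor coming from the
dual function in `ℓ^{q'}`; either `p ≤ 2q`, or the scales carry weights `θ` with `∑ θ ^ q < ∞`. -/
lemma exists_tsum_scales_le {p q q' : ℝ} (hp : 1 ≤ p) (hqq : q.HolderConjugate q')
    (w₁ w₂ : ℤ → ℝ≥0∞) (hw₁ : ∑' i, w₁ i < ⊤) (hw₂ : ∑' i, w₂ i < ⊤) (θ : ℤ → ℝ≥0∞)
    (hθ : (p ≤ 2 * q ∧ ∀ j, θ j ≤ 1) ∨ ∑' j, θ j ^ q < ⊤) :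
    ∃ C : ℝ≥0, ∀ A B : ℤ → ℝ≥0∞,
      ∑' j, θ j * (∑' i, w₁ (i - j) * A i) * (∑' i, w₁ (i - j) * A i) *
        (∑' i, w₂ (i - j) * B i) ≤
      C * ((∑' i, A i ^ p) ^ (1 / p)) ^ 2 * (∑' i, B i ^ q') ^ (1 / q') := by
  have hp0 : 0 < p := by linarith
  have hq0 : 0 < q := hqq.pos
  have hq'0 : 0 < q' := hqq.symm.pos
  have hneg : ∀ w : ℤ → ℝ≥0∞, ∑' i, w (-i) = ∑' i, w i := fun w => (Equiv.neg ℤ).tsum_eq w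
  set D₁ := (∑' i, w₁ i) ^ (p - 1) * ∑' i, w₁ i with hD₁
  set D₂ := (∑' i, w₂ i) ^ (q' - 1) * ∑' i, w₂ i with hD₂
  have hD₁t : D₁ < ⊤ := ENNReal.mul_lt_top
    (ENNReal.rpow_lt_top_of_nonneg (by linarith) hw₁.ne) hw₁
  have hD₂t : D₂ < ⊤ := ENNReal.mul_lt_top
    (ENNReal.rpow_lt_top_of_nonneg (by linarith [hqq.symm.lt]) hw₂.ne) hw₂
  obtain ⟨W, hWt, hW⟩ : ∃ W : ℝ≥0∞, W < ⊤ ∧ ∀ K : ℤ → ℝ≥0∞,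
      (∑' j, (θ j * K j * K j) ^ q) ^ (1 / q) ≤ W * ((∑' j, K j ^ p) ^ (1 / p)) ^ 2 := by
    rcases hθ with ⟨hpq, hθ1⟩ | hθ
    · refine ⟨1, by simp, fun K => ?_⟩
      set S := ∑' j, K j ^ p with hS
      have hpt : ∀ j, (θ j * K j * K j) ^ q ≤ K j ^ p * S ^ ((2 * q - p) / p) := fun j => by
        have h1 : θ j * K j * K j ≤ K j ^ (2 : ℝ) := by
          calc θ j * K j * K j ≤ 1 * K j * K j := by gcongr; exact hθ1 j
            _ = K j ^ (2 : ℝ) := by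
              rw [one_mul, show (2 : ℝ) = ((2 : ℕ) : ℝ) by norm_num, ENNReal.rpow_natCast, sq]
        calc (θ j * K j * K j) ^ q ≤ (K j ^ (2 : ℝ)) ^ q := by gcongr
          _ = K j ^ p * (K j ^ p) ^ ((2 * q - p) / p) := by
            rw [← ENNReal.rpow_mul, ← ENNReal.rpow_mul,
              ← ENNReal.rpow_add_of_nonneg _ _ hp0.le (mul_nonneg hp0.le
                (div_nonneg (by linarith) hp0.le))]
            congr 1
            field_simp
            ring
          _ ≤ _ := by
            refine mul_le_mul' le_rfl (ENNReal.rpow_le_rpow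
              (ENNReal.le_tsum (f := fun j => K j ^ p) j) (div_nonneg (by linarith) hp0.le))
      calc (∑' j, (θ j * K j * K j) ^ q) ^ (1 / q)
          ≤ (∑' j, K j ^ p * S ^ ((2 * q - p) / p)) ^ (1 / q) := by
            gcongr; exact hpt _
        _ = (S * S ^ ((2 * q - p) / p)) ^ (1 / q) := by rw [ENNReal.tsum_mul_right]
        _ = 1 * (S ^ (1 / p)) ^ 2 := by
            have h2 : S * S ^ ((2 * q - p) / p) = S ^ (2 * q / p) := by
              conv_lhs => rw [← ENNReal.rpow_one S]
              rw [ENNReal.rpow_one S]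
              nth_rewrite 1 [← ENNReal.rpow_one S]
              rw [← ENNReal.rpow_add_of_nonneg _ _ zero_le_one (div_nonneg (by linarith) hp0.le)]
              congr 1
              field_simp
              ring
            rw [h2, one_mul, ← ENNReal.rpow_natCast, ← ENNReal.rpow_mul, ← ENNReal.rpow_mul]
            congr 1
            push_cast
            field_simp
    · refine ⟨(∑' j, θ j ^ q) ^ (1 / q), ENNReal.rpow_lt_top_of_nonneg (by positivity) hθ.ne,
        fun K => ?_⟩
      set S := (∑' j, K j ^ p) ^ (1 / p) with hS
      have hK : ∀ j, K j ≤ S := fun j => by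
        calc K j = (K j ^ p) ^ (1 / p) := by
              rw [← ENNReal.rpow_mul, mul_one_div_cancel hp0.ne', ENNReal.rpow_one]
          _ ≤ S := ENNReal.rpow_le_rpow (ENNReal.le_tsum (f := fun j => K j ^ p) j) (by positivity)
      calc (∑' j, (θ j * K j * K j) ^ q) ^ (1 / q)
          ≤ (∑' j, θ j ^ q * (S ^ 2) ^ q) ^ (1 / q) := by
            gcongr with j
            rw [← ENNReal.mul_rpow_of_nonneg (θ j) (S ^ 2) hq0.le, sq, mul_assoc]
            exact ENNReal.rpow_le_rpow (mul_le_mul' le_rfl (mul_le_mul' (hK j) (hK j))) hq0.le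
        _ = _ := by
            rw [ENNReal.tsum_mul_right, ENNReal.mul_rpow_of_nonneg _ _ (by positivity),
              ← ENNReal.rpow_mul (S ^ 2), mul_one_div_cancel hq0.ne', ENNReal.rpow_one]
  refine ⟨(W * (D₁ ^ (1 / p)) ^ 2 * D₂ ^ (1 / q')).toNNReal, fun A B => ?_⟩
  rw [ENNReal.coe_toNNReal (ENNReal.mul_ne_top (ENNReal.mul_ne_top hWt.ne
    (ENNReal.pow_ne_top (ENNReal.rpow_ne_top_of_nonneg (by positivity) hD₁t.ne)))
    (ENNReal.rpow_ne_top_of_nonneg (by positivity) hD₂t.ne))]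
  refine (ENNReal.tsum_mul_le_Lp_mul_Lq hqq _ _).trans ?_
  have h1 := ENNReal.tsum_conv_rpow_le hp w₁ A
  have h2 := ENNReal.tsum_conv_rpow_le hqq.symm.lt.le w₂ B
  rw [hneg, ← mul_assoc] at h1 h2
  calc _ ≤ (W * ((∑' j, (∑' i, w₁ (i - j) * A i) ^ p) ^ (1 / p)) ^ 2) *
        (∑' j, (∑' i, w₂ (i - j) * B i) ^ q') ^ (1 / q') := by gcongr; exact hW _
    _ ≤ (W * ((D₁ * ∑' i, A i ^ p) ^ (1 / p)) ^ 2) * (D₂ * ∑' i, B i ^ q') ^ (1 / q') := by gcongr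
    _ = _ := by
      rw [ENNReal.mul_rpow_of_nonneg D₁ _ (by positivity),
        ENNReal.mul_rpow_of_nonneg D₂ _ (by positivity), mul_pow]
      ring

/-! ### The rescaled phase -/

lemma mem_unitCube {m : ℕ} {x : EuclideanSpace ℝ (Fin m)} :
    x ∈ unitCube m ↔ ∀ i, |x i| ≤ 1 := by
  simp [unitCube, cube]

lemma zero_mem_unitCube (m : ℕ) : (0 : EuclideanSpace ℝ (Fin m)) ∈ unitCube m := by
  simp [mem_unitCube]

lemma convex_cube {m : ℕ} (c : EuclideanSpace ℝ (Fin m)) (r : ℝ) : Convex ℝ (cube c r) := by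
  intro x hx y hy a b ha hb hab i
  have h1 := abs_le.1 (hx i)
  have h2 := abs_le.1 (hy i)
  have : b = 1 - a := by linarith
  subst this
  simp only [PiLp.add_apply, PiLp.smul_apply, smul_eq_mul]
  rw [abs_le]
  constructor <;> nlinarith

lemma isClosed_cube {m : ℕ} (c : EuclideanSpace ℝ (Fin m)) (r : ℝ) : IsClosed (cube c r) := by
  have : cube c r = ⋂ i, {x : EuclideanSpace ℝ (Fin m) | |x i - c i| ≤ r} := by
    ext x; simp [cube]
  rw [this]
  exact isClosed_iInter fun i => isClosed_le (by fun_prop) continuous_const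

lemma abs_apply_le_norm {m : ℕ} (x : EuclideanSpace ℝ (Fin m)) (i : Fin m) : |x i| ≤ ‖x‖ := by
  simpa using PiLp.norm_apply_le x i

lemma norm_le_of_abs_apply_le {m : ℕ} {x : EuclideanSpace ℝ (Fin m)} {r : ℝ}
    (hx : ∀ i, |x i| ≤ r) : ‖x‖ ≤ m * r := by
  have h1 : ‖x‖ ≤ ∑ i, |x i| := by
    have h := EuclideanSpace.norm_sq_eq x
    have h2 : ∑ i, ‖x i‖ ^ 2 ≤ (∑ i, |x i|) ^ 2 := by
      simpa using Finset.sum_sq_le_sq_sum_of_nonneg (s := Finset.univ) (f := fun i => |x i|)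
        (fun i _ => abs_nonneg _)
    exact abs_le_of_sq_le_sq' (h ▸ h2) (Finset.sum_nonneg fun i _ => abs_nonneg _) |>.2
  refine h1.trans ((Finset.sum_le_sum fun i _ => hx i).trans ?_)
  simp

lemma isCompact_cube {m : ℕ} (c : EuclideanSpace ℝ (Fin m)) (r : ℝ) : IsCompact (cube c r) := by
  refine Metric.isCompact_of_isClosed_isBounded (isClosed_cube c r) ?_
  refine (Metric.isBounded_closedBall (x := c) (r := m * |r|)).subset fun x hx => ?_
  rw [Metric.mem_closedBall, dist_eq_norm]
  exact norm_le_of_abs_apply_le fun i => by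
    simpa using (hx i).trans (le_abs_self r)

lemma ball_subset_cube {m : ℕ} (c : EuclideanSpace ℝ (Fin m)) (r : ℝ) :
    Metric.ball c r ⊆ cube c r := by
  intro x hx i
  rw [Metric.mem_ball, dist_eq_norm] at hx
  simpa using (abs_apply_le_norm (x - c) i).trans hx.le

lemma uniqueDiffOn_cube {m : ℕ} (c : EuclideanSpace ℝ (Fin m)) {r : ℝ} (hr : 0 < r) :
    UniqueDiffOn ℝ (cube c r) := by
  refine uniqueDiffOn_convex (convex_cube c r) ⟨c, ?_⟩
  exact interior_mono (ball_subset_cube c r)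
    (by rw [Metric.isOpen_ball.interior_eq]; exact Metric.mem_ball_self hr)

lemma uniqueDiffOn_unitCube (m : ℕ) : UniqueDiffOn ℝ (unitCube m) :=
  uniqueDiffOn_cube 0 one_pos

/-- The phase `Φ` on the cube with centre `c` and half side length `r`, parabolically rescaled to
the unit cube: its Taylor polynomial of degree one at `c` is removed, and the variable and the value
are dilated by `r⁻¹` and `r⁻²`. -/
noncomputable def rescaledPhase {m : ℕ} (Φ : EuclideanSpace ℝ (Fin m) → ℝ)
    (c : EuclideanSpace ℝ (Fin m)) (r : ℝ) (Y : EuclideanSpace ℝ (Fin m)) : ℝ :=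
  (r ^ 2)⁻¹ * (Φ (c + r • Y) - (Φ c + r * fderivWithin ℝ Φ (unitCube m) c Y))

lemma add_smul_mem_unitCube {m : ℕ} {c : EuclideanSpace ℝ (Fin m)} {r : ℝ} (hr : 0 < r)
    (hc : cube c r ⊆ unitCube m) {Y : EuclideanSpace ℝ (Fin m)} (hY : Y ∈ unitCube m) :
    c + r • Y ∈ unitCube m := by
  apply hc
  intro i
  have := mem_unitCube.1 hY i
  simp only [PiLp.add_apply, PiLp.smul_apply, smul_eq_mul, add_sub_cancel_left, abs_mul,
    abs_of_pos hr]
  nlinarith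

open scoped Pointwise in
lemma iteratedFDerivWithin_comp_add_smul {m N k : ℕ} {Φ : EuclideanSpace ℝ (Fin m) → ℝ}
    (hΦ : ContDiffOn ℝ N Φ (unitCube m)) (hk : k ≤ N) {c : EuclideanSpace ℝ (Fin m)} {r : ℝ}
    (hr : 0 < r) (hc : cube c r ⊆ unitCube m) {Y : EuclideanSpace ℝ (Fin m)}
    (hY : Y ∈ unitCube m) (v : Fin k → EuclideanSpace ℝ (Fin m)) :
    iteratedFDerivWithin ℝ k (fun Y => Φ (c + r • Y)) (unitCube m) Y v =
      r ^ k * iteratedFDerivWithin ℝ k Φ (unitCube m) (c + r • Y) v := by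
  set Q := unitCube m with hQ
  set s : Set (EuclideanSpace ℝ (Fin m)) := (fun z => c + z) ⁻¹' Q with hs
  set g : EuclideanSpace ℝ (Fin m) →L[ℝ] EuclideanSpace ℝ (Fin m) :=
    r • ContinuousLinearMap.id ℝ _ with hg
  have hgY : ∀ Y, g Y = r • Y := fun Y => by simp [hg]
  have hcs : c +ᵥ s = Q := by
    ext z
    simp only [hs, Set.mem_vadd_set, Set.mem_preimage, vadd_eq_add]
    constructor
    · rintro ⟨y, hy, rfl⟩; exact hy
    · intro hz; exact ⟨z - c, by simpa using hz, by simp⟩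
  have hQc : Convex ℝ Q := convex_cube 0 1
  have hsub : Q ⊆ g ⁻¹' s := by
    intro Y hY
    simp only [hs, Set.mem_preimage, hgY]
    exact add_smul_mem_unitCube hr hc hY
  have hscv : Convex ℝ s := hQc.translate_preimage_right c
  have hgcv : Convex ℝ (g ⁻¹' s) := hscv.linear_preimage g.toLinearMap
  have hQint : (0 : EuclideanSpace ℝ (Fin m)) ∈ interior Q :=
    interior_mono (ball_subset_cube 0 1)
      (by rw [Metric.isOpen_ball.interior_eq]; exact Metric.mem_ball_self one_pos)
  have hgint : (interior (g ⁻¹' s)).Nonempty := ⟨0, interior_mono hsub hQint⟩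
  have hsint : (interior s).Nonempty := by
    refine ⟨-c, ?_⟩
    rw [mem_interior_iff_mem_nhds]
    refine (continuous_const.add continuous_id).continuousAt.preimage_mem_nhds ?_
    simpa using mem_interior_iff_mem_nhds.1 hQint
  have hus : UniqueDiffOn ℝ s := uniqueDiffOn_convex hscv hsint
  have hug : UniqueDiffOn ℝ (g ⁻¹' s) := uniqueDiffOn_convex hgcv hgint
  have hΦc : ContDiffOn ℝ N (fun z => Φ (c + z)) s :=
    hΦ.comp (contDiff_const.add contDiff_id).contDiffOn fun z hz => hz
  have hcomp : ContDiffOn ℝ N ((fun z => Φ (c + z)) ∘ g) (g ⁻¹' s) :=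
    hΦc.comp g.contDiff.contDiffOn fun z hz => hz
  have h1 : iteratedFDerivWithin ℝ k ((fun z => Φ (c + z)) ∘ g) Q Y =
      iteratedFDerivWithin ℝ k ((fun z => Φ (c + z)) ∘ g) (g ⁻¹' s) Y :=
    iteratedFDerivWithin_subset hsub (uniqueDiffOn_unitCube m) hug
      (hcomp.of_le (by exact_mod_cast hk)) hY
  have h2 := g.iteratedFDerivWithin_comp_right hΦc hus hug (hsub hY) (i := k)
    (by exact_mod_cast hk)
  have h3 : (fun z => Φ (c + z)) ∘ g = fun Y => Φ (c + r • Y) := by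
    ext Y; simp [hgY]
  rw [h3] at h1 h2
  rw [h1, h2, iteratedFDerivWithin_comp_add_left, hcs, hgY]
  simp only [ContinuousMultilinearMap.compContinuousLinearMap_apply, hgY]
  rw [ContinuousMultilinearMap.map_smul_univ]
  simp

lemma iteratedFDerivWithin_affine_eq_zero {m k : ℕ} (a : ℝ)
    (D : EuclideanSpace ℝ (Fin m) →L[ℝ] ℝ) {Y : EuclideanSpace ℝ (Fin m)}
    (hY : Y ∈ unitCube m) (v : Fin (k + 2) → EuclideanSpace ℝ (Fin m)) :
    iteratedFDerivWithin ℝ (k + 2) (fun Y => a + D Y) (unitCube m) Y v = 0 := by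
  rw [iteratedFDerivWithin_succ_apply_right (uniqueDiffOn_unitCube m) hY]
  have : iteratedFDerivWithin ℝ (k + 1) (fun y => fderivWithin ℝ (fun Y => a + D Y)
      (unitCube m) y) (unitCube m) Y = iteratedFDerivWithin ℝ (k + 1) (fun _ => D) (unitCube m) Y := by
    refine iteratedFDerivWithin_congr (fun y hy => ?_) hY _
    rw [fderivWithin_const_add]
    exact D.fderivWithin (uniqueDiffOn_unitCube m y hy)
  rw [this, iteratedFDerivWithin_succ_const]
  simp

/-- All partial derivatives of order at least two of the rescaled phase are those of the phase,
times a nonnegative power of `r`. -/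
lemma partialDeriv_rescaledPhase {m N k : ℕ} {Φ : EuclideanSpace ℝ (Fin m) → ℝ}
    (hΦ : ContDiffOn ℝ N Φ (unitCube m)) (hk : k + 2 ≤ N) {c : EuclideanSpace ℝ (Fin m)} {r : ℝ}
    (hr : 0 < r) (hc : cube c r ⊆ unitCube m) {Y : EuclideanSpace ℝ (Fin m)}
    (hY : Y ∈ unitCube m) (i : Fin (k + 2) → Fin m) :
    partialDeriv (rescaledPhase Φ c r) i Y = r ^ k * partialDeriv Φ i (c + r • Y) := by
  set D := r • fderivWithin ℝ Φ (unitCube m) c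
  have hN : ((k + 2 : ℕ) : WithTop ℕ∞) ≤ N := by exact_mod_cast hk
  have h1 : ContDiffOn ℝ N (fun Y => Φ (c + r • Y)) (unitCube m) :=
    hΦ.comp (by fun_prop : ContDiff ℝ N fun Y => c + r • Y).contDiffOn
      fun Y hY => add_smul_mem_unitCube hr hc hY
  have h2 : ContDiff ℝ ((k + 2 : ℕ) : WithTop ℕ∞) (fun Y => Φ c + D Y) :=
    contDiff_const.add D.contDiff
  have h3 : rescaledPhase Φ c r =
      (r ^ 2)⁻¹ • ((fun Y => Φ (c + r • Y)) - (fun Y => Φ c + D Y)) := by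
    ext Y; simp [rescaledPhase, D]
  have hu := uniqueDiffOn_unitCube m
  have h1' := (h1 Y hY).of_le hN
  have h2' := h2.contDiffWithinAt (s := unitCube m) (x := Y)
  have h12 : ContDiffWithinAt ℝ ((k + 2 : ℕ) : WithTop ℕ∞)
      ((fun Y => Φ (c + r • Y)) - (fun Y => Φ c + D Y)) (unitCube m) Y := h1'.sub h2'
  unfold partialDeriv
  rw [h3, iteratedFDerivWithin_const_smul_apply h12 hu hY,
    iteratedFDerivWithin_sub_apply h1' h2' hu hY]
  simp only [smul_apply, sub_apply]
  rw [iteratedFDerivWithin_comp_add_smul hΦ hk hr hc hY,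
    iteratedFDerivWithin_affine_eq_zero _ _ hY]
  rw [sub_zero, smul_eq_mul, pow_add]
  field_simp

/-! ### Ellipticity of the rescaled phase -/

/-- The entries of a Hermitian matrix are bounded by its eigenvalues, since the rows of the matrix
of eigenvectors are unit vectors. -/
lemma abs_apply_le_of_eigenvalues {m : ℕ} {H : Matrix (Fin m) (Fin m) ℝ} (hH : H.IsHermitian)
    {B : ℝ} (hB : ∀ i, |hH.eigenvalues i| ≤ B) (a b : Fin m) : |H a b| ≤ B := by
  set U : Matrix (Fin m) (Fin m) ℝ := hH.eigenvectorUnitary.1 with hU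
  have hUU : U * U.transpose = 1 := by
    have := (Matrix.mem_unitaryGroup_iff (A := U)).1 hH.eigenvectorUnitary.2
    simpa [Matrix.star_eq_conjTranspose] using this
  have hrow : ∀ a, ∑ k, U a k ^ 2 = 1 := fun a => by
    have := congrFun (congrFun hUU a) a
    simpa [Matrix.mul_apply, sq] using this
  have hspec : H a b = ∑ k, U a k * hH.eigenvalues k * U b k := by
    have h := hH.spectral_theorem
    conv_lhs => rw [h]
    simp [Unitary.conjStarAlgAut_apply, Matrix.mul_apply, Matrix.diagonal_apply, hU]
  have hBnn : 0 ≤ B := (abs_nonneg _).trans (hB a)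
  rw [hspec]
  calc |∑ k, U a k * hH.eigenvalues k * U b k|
      ≤ ∑ k, |U a k * hH.eigenvalues k * U b k| := Finset.abs_sum_le_sum_abs _ _
    _ ≤ ∑ k, B * ((U a k ^ 2 + U b k ^ 2) / 2) := by
        refine Finset.sum_le_sum fun k _ => ?_
        rw [abs_mul, abs_mul]
        have h1 : |U a k| * |U b k| ≤ (U a k ^ 2 + U b k ^ 2) / 2 := by
          have := two_mul_le_add_sq |U a k| |U b k|
          rw [sq_abs, sq_abs] at this
          linarith
        calc |U a k| * |hH.eigenvalues k| * |U b k|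
            = |hH.eigenvalues k| * (|U a k| * |U b k|) := by ring
          _ ≤ B * ((U a k ^ 2 + U b k ^ 2) / 2) :=
            mul_le_mul (hB k) h1 (by positivity) hBnn
    _ = B := by
        rw [← Finset.mul_sum, ← Finset.sum_div, Finset.sum_add_distrib, hrow, hrow]
        norm_num

lemma closure_interior_unitCube (m : ℕ) :
    unitCube m ⊆ closure (interior (unitCube m)) := by
  have h : (interior (unitCube m)).Nonempty := ⟨0, interior_mono (ball_subset_cube 0 1)
    (by rw [Metric.isOpen_ball.interior_eq]; exact Metric.mem_ball_self one_pos)⟩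
  have hc : Convex ℝ (unitCube m) := convex_cube 0 1
  rw [hc.closure_interior_eq_closure_of_nonempty_interior h]
  exact subset_closure

lemma isHermitian_hessianMatrix {m N : ℕ} (hN : 2 ≤ N) {Φ : EuclideanSpace ℝ (Fin m) → ℝ}
    (hΦ : ContDiffOn ℝ N Φ (unitCube m)) {x : EuclideanSpace ℝ (Fin m)} (hx : x ∈ unitCube m) :
    (hessianMatrix Φ x).IsHermitian := by
  have hsymm : IsSymmSndFDerivWithinAt ℝ Φ (unitCube m) x :=
    (hΦ x hx).isSymmSndFDerivWithinAt (by simpa using hN)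
      (uniqueDiffOn_unitCube m) (closure_interior_unitCube m hx) hx
  ext a b
  simp only [hessianMatrix, Matrix.conjTranspose_apply, Matrix.of_apply, star_trivial, partialDeriv]
  rw [iteratedFDerivWithin_two_apply _ (uniqueDiffOn_unitCube m) hx,
    iteratedFDerivWithin_two_apply _ (uniqueDiffOn_unitCube m) hx]
  exact hsymm _ _

/-- The second derivatives of an elliptic phase are bounded independently of `A`. This makes the
regularity of the rescaled phases depend on `A` only through `max A A₀`. -/
lemma IsEllipticPhase.abs_partialDeriv_two_le {m N : ℕ} (hN : 2 ≤ N) {A ε : ℝ} (hε : ε ≤ 1)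
    {Φ : EuclideanSpace ℝ (Fin m) → ℝ} (hΦ : IsEllipticPhase A N ε Φ)
    {x : EuclideanSpace ℝ (Fin m)} (hx : x ∈ unitCube m) (i : Fin 2 → Fin m) :
    |partialDeriv Φ i x| ≤ 2 := by
  have hH := isHermitian_hessianMatrix hN hΦ.contDiffOn hx
  have h1 : partialDeriv Φ i x = hessianMatrix Φ x (i 0) (i 1) := by
    have : i = ![i 0, i 1] := by ext j; fin_cases j <;> rfl
    simp only [hessianMatrix, Matrix.of_apply]
    rw [← this]
  rw [h1]
  refine abs_apply_le_of_eigenvalues hH (fun j => ?_) _ _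
  have h2 : Module.End.HasEigenvalue (Matrix.toLin' (hessianMatrix Φ x)) (hH.eigenvalues j) := by
    rw [Module.End.hasEigenvalue_iff_mem_spectrum, Matrix.spectrum_toLin']
    exact hH.eigenvalues_mem_spectrum_real j
  have h3 := hΦ.hessian_eigenvalue x hx _ h2
  rw [abs_le]
  constructor <;> linarith [h3.1, h3.2]

lemma norm_clm_le_of_abs_single_le {m : ℕ} (D : EuclideanSpace ℝ (Fin m) →L[ℝ] ℝ) {B : ℝ}
    (hB : ∀ i, |D (EuclideanSpace.single i 1)| ≤ B) (hB0 : 0 ≤ B) : ‖D‖ ≤ m * B := by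
  refine D.opNorm_le_bound (by positivity) fun v => ?_
  have hv : v = ∑ i, v i • EuclideanSpace.single i (1 : ℝ) := by
    ext j; simp [Pi.single_apply]
  conv_lhs => rw [hv, map_sum]
  refine (norm_sum_le _ _).trans ?_
  calc ∑ i, ‖D (v i • EuclideanSpace.single i (1 : ℝ))‖ ≤ ∑ _i : Fin m, B * ‖v‖ := by
        refine Finset.sum_le_sum fun i _ => ?_
        rw [map_smul, norm_smul, mul_comm]
        exact mul_le_mul (hB i) (PiLp.norm_apply_le v i) (norm_nonneg _) hB0
    _ = m * B * ‖v‖ := by simp [mul_assoc]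

lemma abs_le_of_abs_partial_le {m : ℕ} {g : EuclideanSpace ℝ (Fin m) → ℝ}
    (hg : DifferentiableOn ℝ g (unitCube m)) {B : ℝ} (hB0 : 0 ≤ B)
    (hB : ∀ x ∈ unitCube m, ∀ i,
      |fderivWithin ℝ g (unitCube m) x (EuclideanSpace.single i 1)| ≤ B)
    (h0 : g 0 = 0) {Y : EuclideanSpace ℝ (Fin m)} (hY : Y ∈ unitCube m) :
    |g Y| ≤ m * B * m := by
  have h := (convex_cube 0 1 : Convex ℝ (unitCube m)).norm_image_sub_le_of_norm_fderivWithin_le hg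
    (fun x hx => norm_clm_le_of_abs_single_le _ (hB x hx) hB0) (zero_mem_unitCube m) hY
  rw [h0, sub_zero, sub_zero, Real.norm_eq_abs] at h
  refine h.trans (mul_le_mul_of_nonneg_left ?_ (by positivity))
  simpa using norm_le_of_abs_apply_le (mem_unitCube.1 hY)

/-- The parabolic rescaling of an elliptic phase is elliptic: derivatives of order at least three
improve, the Hessian is merely transported, and its bound controls the lower order terms by
integration. -/
lemma IsEllipticPhase.rescaledPhase {m N : ℕ} (hN : 2 ≤ N) {A A' ε : ℝ} (hε : ε ≤ 1)
    {Φ : EuclideanSpace ℝ (Fin m) → ℝ} (hΦ : IsEllipticPhase A N ε Φ) (hAA : A ≤ A')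
    (hA' : 2 * (1 + (m : ℝ) ^ 2) ^ 2 ≤ A')
    {c : EuclideanSpace ℝ (Fin m)} {r : ℝ} (hr : 0 < r) (hr1 : r ≤ 1)
    (hc : cube c r ⊆ unitCube m) :
    IsEllipticPhase A' N ε (rescaledPhase Φ c r) := by
  have hu := uniqueDiffOn_unitCube m
  have hL : ∀ {Y}, Y ∈ unitCube m → c + r • Y ∈ unitCube m :=
    fun hY => add_smul_mem_unitCube hr hc hY
  have hcm : c ∈ unitCube m := by simpa using hL (zero_mem_unitCube m)
  set Ψ := _root_.rescaledPhase Φ c r with hΨ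
  have hΨc : ContDiffOn ℝ N Ψ (unitCube m) := by
    have h1 : ContDiffOn ℝ N (fun Y => Φ (c + r • Y)) (unitCube m) :=
      hΦ.contDiffOn.comp (by fun_prop : ContDiff ℝ N fun Y => c + r • Y).contDiffOn
        fun Y hY => hL hY
    refine contDiffOn_const.mul (h1.sub ?_)
    have : ContDiff ℝ N (fderivWithin ℝ Φ (unitCube m) c) := ContinuousLinearMap.contDiff _
    exact (contDiff_const.add (contDiff_const.mul this)).contDiffOn
  have hΨ0 : Ψ 0 = 0 := by simp [hΨ, _root_.rescaledPhase]
  have hone : ∀ Y ∈ unitCube m, ∀ v, fderivWithin ℝ Ψ (unitCube m) Y v =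
      r⁻¹ * (fderivWithin ℝ Φ (unitCube m) (c + r • Y) v - fderivWithin ℝ Φ (unitCube m) c v) := by
    intro Y hY v
    have hd : HasFDerivWithinAt Φ (fderivWithin ℝ Φ (unitCube m) (c + r • Y)) (unitCube m)
        (c + r • Y) := by
      refine DifferentiableWithinAt.hasFDerivWithinAt ?_
      exact (hΦ.contDiffOn.differentiableOn (by exact_mod_cast (by lia : N ≠ 0))) _ (hL hY)
    have hlin : HasFDerivWithinAt (fun Y : EuclideanSpace ℝ (Fin m) => c + r • Y)
        (r • ContinuousLinearMap.id ℝ _) (unitCube m) Y :=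
      ((hasFDerivWithinAt_id Y _).const_smul r).const_add c
    have h1 := hd.comp Y hlin fun Y hY => hL hY
    have h2 : HasFDerivWithinAt (fun Y => Φ c + r * fderivWithin ℝ Φ (unitCube m) c Y)
        (r • fderivWithin ℝ Φ (unitCube m) c) (unitCube m) Y :=
      (((fderivWithin ℝ Φ (unitCube m) c).hasFDerivWithinAt).const_mul r).const_add _
    have h3 := (h1.sub h2).const_mul (r ^ 2)⁻¹
    have h4 : HasFDerivWithinAt Ψ _ (unitCube m) Y := h3
    rw [h4.fderivWithin (hu Y hY)]
    simp
    field_simp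
  have hgrad : ∀ i : Fin 1 → Fin m, ∀ Y ∈ unitCube m,
      partialDeriv Ψ i Y = fderivWithin ℝ Ψ (unitCube m) Y (EuclideanSpace.single (i 0) 1) :=
    fun i Y hY => iteratedFDerivWithin_one_apply (hu Y hY) _
  have htwo : ∀ i : Fin 2 → Fin m, ∀ Y ∈ unitCube m,
      partialDeriv Ψ i Y = partialDeriv Φ i (c + r • Y) := fun i Y hY => by
    simpa using partialDeriv_rescaledPhase hΦ.contDiffOn (k := 0) hN hr hc hY i
  have hm2 : (0 : ℝ) ≤ (m : ℝ) ^ 2 := by positivity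
  -- The gradient is the integral of the Hessian.
  have hgradle : ∀ Y ∈ unitCube m, ∀ i,
      |fderivWithin ℝ Ψ (unitCube m) Y (EuclideanSpace.single i 1)| ≤ m * 2 * m := by
    intro Y hY i
    have hdd : DifferentiableOn ℝ (fderivWithin ℝ Ψ (unitCube m)) (unitCube m) :=
      (hΨc.fderivWithin hu (m := 1) (by exact_mod_cast hN)).differentiableOn one_ne_zero
    have hd : DifferentiableOn ℝ
        (fun Y => fderivWithin ℝ Ψ (unitCube m) Y (EuclideanSpace.single i 1)) (unitCube m) :=
      hdd.clm_apply (differentiableOn_const _)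
    refine abs_le_of_abs_partial_le hd (by norm_num) (fun x hx j => ?_) ?_ hY
    · have h5 : fderivWithin ℝ
          (fun Y => fderivWithin ℝ Ψ (unitCube m) Y (EuclideanSpace.single i 1)) (unitCube m) x
          (EuclideanSpace.single j 1) = partialDeriv Ψ ![j, i] x := by
        unfold partialDeriv
        rw [iteratedFDerivWithin_two_apply _ hu hx]
        have h6 := (hdd x hx).hasFDerivWithinAt.clm_apply
          (hasFDerivWithinAt_const (EuclideanSpace.single i (1 : ℝ)) x (unitCube m))
        rw [h6.fderivWithin (hu x hx)]
        simp
      rw [h5, htwo _ _ hx]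
      exact hΦ.abs_partialDeriv_two_le hN hε (hL hx) _
    · rw [hone 0 (zero_mem_unitCube m)]
      simp
  refine ⟨hΨc, fun k hk i Y hY => ?_, hΨ0, fun i => ?_, fun x hx μ hμ => ?_⟩
  · match k, hk, i with
    | 0, _, i =>
      have h7 : partialDeriv Ψ i Y = Ψ Y := by simp [partialDeriv]
      rw [h7]
      refine (abs_le_of_abs_partial_le (hΨc.differentiableOn
        (by exact_mod_cast (by lia : N ≠ 0))) (by positivity) hgradle hΨ0 hY).trans ?_
      refine le_trans ?_ hA'
      nlinarith [sq_nonneg ((m : ℝ) ^ 2)]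
    | 1, _, i =>
      rw [hgrad _ _ hY]
      refine (hgradle Y hY _).trans (le_trans ?_ hA')
      nlinarith [sq_nonneg ((m : ℝ) ^ 2)]
    | k + 2, hk, i =>
      rw [partialDeriv_rescaledPhase hΦ.contDiffOn hk hr hc hY, abs_mul, abs_of_pos (pow_pos hr k)]
      refine (mul_le_of_le_one_left (abs_nonneg _) (pow_le_one₀ hr.le hr1)).trans ?_
      exact (hΦ.abs_partialDeriv_le _ hk _ _ (hL hY)).trans hAA
  · rw [hgrad _ _ (zero_mem_unitCube m), hone 0 (zero_mem_unitCube m)]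
    simp
  · have h8 : hessianMatrix Ψ x = hessianMatrix Φ (c + r • x) := by
      ext a b
      simp only [hessianMatrix, Matrix.of_apply]
      exact htwo _ _ hx
    rw [h8] at hμ
    exact hΦ.hessian_eigenvalue _ (hL hx) μ hμ

/-! ### Elementary properties of the extension operator -/

/-- The oscillating kernel of the extension operator. -/
noncomputable def phaseKernel {m : ℕ} (Φ : EuclideanSpace ℝ (Fin m) → ℝ)
    (z : EuclideanSpace ℝ (Fin m) × ℝ) (y : EuclideanSpace ℝ (Fin m)) : ℂ :=
  Complex.exp (-(2 * Real.pi * Complex.I * ((inner ℝ z.1 y + z.2 * Φ y : ℝ) : ℂ)))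

lemma norm_phaseKernel {m : ℕ} (Φ : EuclideanSpace ℝ (Fin m) → ℝ)
    (z : EuclideanSpace ℝ (Fin m) × ℝ) (y : EuclideanSpace ℝ (Fin m)) :
    ‖phaseKernel Φ z y‖ = 1 := by
  have : -(2 * Real.pi * Complex.I * ((inner ℝ z.1 y + z.2 * Φ y : ℝ) : ℂ)) =
      ((-(2 * Real.pi * (inner ℝ z.1 y + z.2 * Φ y)) : ℝ) : ℂ) * Complex.I := by
    push_cast; ring
  rw [phaseKernel, this, Complex.norm_exp_ofReal_mul_I]

lemma measurable_phaseKernel {m : ℕ} {Φ : EuclideanSpace ℝ (Fin m) → ℝ} (hΦ : Measurable Φ) :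
    Measurable (Function.uncurry (phaseKernel Φ)) := by
  have h1 : Measurable fun w : (EuclideanSpace ℝ (Fin m) × ℝ) × EuclideanSpace ℝ (Fin m) =>
      (inner ℝ w.1.1 w.2 + w.1.2 * Φ w.2 : ℝ) :=
    (measurable_fst.fst.inner measurable_snd).add
      (measurable_fst.snd.mul (hΦ.comp measurable_snd))
  exact Complex.measurable_exp.comp
    (((Complex.measurable_ofReal.comp h1).const_mul (2 * Real.pi * Complex.I)).neg)

lemma continuous_phaseKernel_left {m : ℕ} (Φ : EuclideanSpace ℝ (Fin m) → ℝ)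
    (y : EuclideanSpace ℝ (Fin m)) : Continuous fun z => phaseKernel Φ z y := by
  unfold phaseKernel
  fun_prop

lemma adjointRestriction_eq {m : ℕ} (Φ : EuclideanSpace ℝ (Fin m) → ℝ)
    (f : EuclideanSpace ℝ (Fin m) → ℂ) (z : EuclideanSpace ℝ (Fin m) × ℝ) :
    adjointRestriction Φ f z = ∫ y in unitCube m, phaseKernel Φ z y * f y := rfl

lemma adjointRestriction_eq_integral {m : ℕ} (Φ : EuclideanSpace ℝ (Fin m) → ℝ)
    {f : EuclideanSpace ℝ (Fin m) → ℂ} (hf : Function.support f ⊆ unitCube m)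
    (z : EuclideanSpace ℝ (Fin m) × ℝ) :
    adjointRestriction Φ f z = ∫ y, phaseKernel Φ z y * f y := by
  rw [adjointRestriction_eq]
  refine setIntegral_eq_integral_of_forall_compl_eq_zero fun y hy => ?_
  have : f y = 0 := by
    by_contra h
    exact hy (hf h)
  simp [this]

lemma integrable_phaseKernel_mul {m : ℕ} {Φ : EuclideanSpace ℝ (Fin m) → ℝ} (hΦ : Measurable Φ)
    {μ : Measure (EuclideanSpace ℝ (Fin m))}
    {f : EuclideanSpace ℝ (Fin m) → ℂ} (hf : Integrable f μ)
    (z : EuclideanSpace ℝ (Fin m) × ℝ) :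
    Integrable (fun y => phaseKernel Φ z y * f y) μ := by
  refine hf.bdd_mul (c := 1) ?_ (Filter.Eventually.of_forall fun y => (norm_phaseKernel Φ z y).le)
  exact ((measurable_phaseKernel hΦ).comp measurable_prodMk_left).aestronglyMeasurable

lemma continuous_adjointRestriction {m : ℕ} {Φ : EuclideanSpace ℝ (Fin m) → ℝ} (hΦ : Measurable Φ)
    {f : EuclideanSpace ℝ (Fin m) → ℂ} (hf : IntegrableOn f (unitCube m)) :
    Continuous (adjointRestriction Φ f) := by
  have : adjointRestriction Φ f = fun z => ∫ y in unitCube m, phaseKernel Φ z y * f y := rfl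
  rw [this]
  refine continuous_of_dominated (bound := fun y => ‖f y‖) (fun z => ?_) (fun z => ?_) hf.norm ?_
  · exact (integrable_phaseKernel_mul hΦ hf z).aestronglyMeasurable
  · exact Filter.Eventually.of_forall fun y => by rw [norm_mul, norm_phaseKernel, one_mul]
  · exact Filter.Eventually.of_forall fun y => (continuous_phaseKernel_left Φ y).mul_const _

lemma norm_adjointRestriction_le {m : ℕ} (Φ : EuclideanSpace ℝ (Fin m) → ℝ)
    (f : EuclideanSpace ℝ (Fin m) → ℂ) (z : EuclideanSpace ℝ (Fin m) × ℝ) :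
    ‖adjointRestriction Φ f z‖ ≤ ∫ y in unitCube m, ‖f y‖ := by
  rw [adjointRestriction_eq]
  refine (norm_integral_le_integral_norm _).trans (le_of_eq ?_)
  congr 1
  ext y
  rw [norm_mul, norm_phaseKernel, one_mul]

lemma adjointRestriction_sub {m : ℕ} {Φ : EuclideanSpace ℝ (Fin m) → ℝ} (hΦ : Measurable Φ)
    {f g : EuclideanSpace ℝ (Fin m) → ℂ} (hf : IntegrableOn f (unitCube m))
    (hg : IntegrableOn g (unitCube m)) (z : EuclideanSpace ℝ (Fin m) × ℝ) :
    adjointRestriction Φ (f - g) z = adjointRestriction Φ f z - adjointRestriction Φ g z := by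
  simp only [adjointRestriction_eq]
  rw [← integral_sub (integrable_phaseKernel_mul hΦ hf z) (integrable_phaseKernel_mul hΦ hg z)]
  simp [mul_sub]

lemma adjointRestriction_congr {m : ℕ} {Φ Ψ : EuclideanSpace ℝ (Fin m) → ℝ}
    (h : Set.EqOn Φ Ψ (unitCube m)) (f : EuclideanSpace ℝ (Fin m) → ℂ) :
    adjointRestriction Φ f = adjointRestriction Ψ f := by
  ext z
  refine setIntegral_congr_fun (isClosed_cube 0 1).measurableSet fun y hy => ?_
  simp only [h hy]

lemma IsEllipticPhase.congr {m N : ℕ} {A ε : ℝ} {Φ Ψ : EuclideanSpace ℝ (Fin m) → ℝ}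
    (hΦ : IsEllipticPhase A N ε Φ) (h : Set.EqOn Φ Ψ (unitCube m)) : IsEllipticPhase A N ε Ψ := by
  have hpd : ∀ {k : ℕ} (i : Fin k → Fin m), ∀ x ∈ unitCube m,
      partialDeriv Ψ i x = partialDeriv Φ i x := fun i x hx => by
    unfold partialDeriv
    rw [iteratedFDerivWithin_congr (fun y hy => (h hy).symm) hx]
  have h0 := zero_mem_unitCube m
  refine ⟨hΦ.contDiffOn.congr fun x hx => (h hx).symm, fun k hk i x hx => ?_, ?_, fun i => ?_,
    fun x hx μ hμ => hΦ.hessian_eigenvalue x hx μ ?_⟩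
  · rw [hpd i x hx]; exact hΦ.abs_partialDeriv_le k hk i x hx
  · rw [← h h0]; exact hΦ.map_zero
  · rw [hpd _ _ h0]; exact hΦ.grad_zero i
  · have : hessianMatrix Φ x = hessianMatrix Ψ x := by
      ext a b
      simp only [hessianMatrix, Matrix.of_apply]
      rw [hpd _ _ hx]
    rwa [this]

lemma IsEllipticPhase.measurable_indicator {m N : ℕ} {A ε : ℝ} {Φ : EuclideanSpace ℝ (Fin m) → ℝ}
    (hΦ : IsEllipticPhase A N ε Φ) : Measurable ((unitCube m).indicator Φ) := by
  classical
  have hm : MeasurableSet (unitCube m) := (isClosed_cube 0 1).measurableSet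
  rw [← Set.piecewise_eq_indicator]
  refine ContinuousOn.measurable_piecewise hΦ.contDiffOn.continuousOn continuousOn_const hm

/-! ### Passage from test functions to bounded measurable functions -/

lemma volume_hyperplane {m : ℕ} (i : Fin m) (a : ℝ) :
    volume {x : EuclideanSpace ℝ (Fin m) | x i = a} = 0 := by
  have h := (EuclideanSpace.volume_preserving_symm_measurableEquiv_toLp (Fin m)).symm
  have h2 : volume {x : Fin m → ℝ | x i = a} = 0 := by
    rw [volume_pi]
    exact Measure.pi_hyperplane (fun _ => (volume : Measure ℝ)) i a
  rw [← h.measure_preimage_equiv {x : EuclideanSpace ℝ (Fin m) | x i = a}]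
  exact h2

lemma exists_smooth_cutoff {m : ℕ} (c : EuclideanSpace ℝ (Fin m)) {ρ r : ℝ} (hρ : 0 < ρ)
    (hr : ρ < r) : ∃ χ : EuclideanSpace ℝ (Fin m) → ℝ, ContDiff ℝ ∞ χ ∧ (∀ x, 0 ≤ χ x) ∧
      (∀ x, χ x ≤ 1) ∧ (∀ x ∈ cube c ρ, χ x = 1) ∧ Function.support χ ⊆ cube c r := by
  let b : ContDiffBump (0 : ℝ) := ⟨ρ, r, hρ, hr⟩
  refine ⟨fun x => ∏ i, b (x i - c i), ?_, fun x => Finset.prod_nonneg fun i _ => b.nonneg,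
    fun x => Finset.prod_le_one (fun i _ => b.nonneg) fun i _ => b.le_one, fun x hx => ?_,
    fun x hx i => ?_⟩
  · refine contDiff_prod fun i _ => b.contDiff.comp ?_
    fun_prop
  · refine Finset.prod_eq_one fun i _ => b.one_of_mem_closedBall ?_
    simpa [Real.dist_eq] using hx i
  · have h : b (x i - c i) ≠ 0 := fun h => hx (Finset.prod_eq_zero (Finset.mem_univ i) h)
    have h2 : x i - c i ∈ Function.support b := h
    rw [b.support_eq, Metric.mem_ball, dist_zero_right, Real.norm_eq_abs] at h2
    exact h2.le

lemma memLp_of_bounded_of_support_subset {m : ℕ} {f : EuclideanSpace ℝ (Fin m) → ℂ}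
    (hf : Measurable f) {K : ℝ} (hK : ∀ x, ‖f x‖ ≤ K) {c : EuclideanSpace ℝ (Fin m)} {r : ℝ}
    (hsupp : Function.support f ⊆ cube c r) (p : ℝ≥0∞) : MemLp f p := by
  have h1 : MemLp f p (volume.restrict (cube c r)) := by
    have : IsFiniteMeasure (volume.restrict (cube c r)) :=
      ⟨by rw [Measure.restrict_apply_univ]; exact (isCompact_cube c r).measure_lt_top⟩
    exact MemLp.of_bound hf.aestronglyMeasurable K (Filter.Eventually.of_forall hK)
  rwa [← memLp_indicator_iff_restrict (isClosed_cube c r).measurableSet,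
    Set.indicator_eq_self.2 hsupp] at h1

/-- Bounded measurable functions supported in a cube are `L^p` limits of test functions supported in
the same cube. -/
lemma exists_testFunction_approx {m : ℕ} {p : ℝ≥0∞} (hp1 : 1 ≤ p) (hpt : p ≠ ⊤)
    {f : EuclideanSpace ℝ (Fin m) → ℂ} (hf : Measurable f) {K : ℝ} (hK : ∀ x, ‖f x‖ ≤ K)
    {c : EuclideanSpace ℝ (Fin m)} {r : ℝ} (hr : 0 < r)
    (hsupp : Function.support f ⊆ cube c r) {ε : ℝ} (hε : 0 < ε) :
    ∃ g, IsTestFunctionOn (cube c r) g ∧ eLpNorm (g - f) p ≤ ENNReal.ofReal ε := by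
  have hε2 : 0 < ε / 2 := by positivity
  have hmem := memLp_of_bounded_of_support_subset hf hK hsupp p
  obtain ⟨δ, hδ, hδs⟩ := hmem.eLpNorm_indicator_le hp1 hpt hε2
  -- A slightly smaller cube carries all but a small part of the mass.
  obtain ⟨ρ, hρ0, hρr, hρδ⟩ : ∃ ρ, 0 < ρ ∧ ρ < r ∧
      volume (cube c r \ cube c ρ) ≤ ENNReal.ofReal δ := by
    set ρ : ℕ → ℝ := fun k => r - r / (k + 2) with hρ
    have hanti : Antitone fun k => cube c r \ cube c (ρ k) := by
      intro a b hab x hx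
      refine ⟨hx.1, fun hx' => hx.2 fun i => (hx' i).trans ?_⟩
      have : r / ((b : ℝ) + 2) ≤ r / (a + 2) := by
        have : (a : ℝ) ≤ b := by exact_mod_cast hab
        gcongr
      simp only [hρ]
      linarith
    have hnull : volume (⋂ k, cube c r \ cube c (ρ k)) = 0 := by
      refine measure_mono_null (t := ⋃ i : Fin m, ({x | x i = c i + r} ∪ {x | x i = c i - r}))
        (fun x hx => ?_) ?_
      · rw [Set.mem_iInter] at hx
        by_contra hcon
        simp only [Set.mem_iUnion, Set.mem_union, Set.mem_ofPred_eq, not_exists, not_or] at hcon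
        have hlt : ∀ i, |x i - c i| < r := fun i => by
          refine lt_of_le_of_ne ((hx 0).1 i) fun h => ?_
          rcases (abs_eq hr.le).1 h with h | h
          · exact (hcon i).1 (by linarith)
          · exact (hcon i).2 (by linarith)
        have hex : ∀ i, ∃ k : ℕ, ∀ k' ≥ k, |x i - c i| ≤ ρ k' := fun i => by
          have ht : Filter.Tendsto ρ Filter.atTop (𝓝 (r - 0)) := by
            refine tendsto_const_nhds.sub (Filter.Tendsto.div_atTop tendsto_const_nhds ?_)
            exact Filter.tendsto_atTop_add_const_right _ _ tendsto_natCast_atTop_atTop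
          rw [sub_zero] at ht
          have := (ht.eventually (lt_mem_nhds (hlt i)))
          obtain ⟨k, hk⟩ := Filter.eventually_atTop.1 this
          exact ⟨k, fun k' hk' => (hk k' hk').le⟩
        choose k hk using hex
        exact (hx (Finset.univ.sup k)).2 fun i => hk i _ (Finset.le_sup (Finset.mem_univ i))
      · exact measure_iUnion_null fun i => measure_union_null (volume_hyperplane i _)
          (volume_hyperplane i _)
    have ht := tendsto_measure_iInter_atTop (μ := volume)
      (fun k => (((isClosed_cube c r).measurableSet.diff
        (isClosed_cube c (ρ k)).measurableSet).nullMeasurableSet)) hanti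
      ⟨0, ((measure_mono Set.sdiff_subset).trans_lt (isCompact_cube c r).measure_lt_top).ne⟩
    rw [hnull] at ht
    obtain ⟨k, hk⟩ := (ht.eventually (gt_mem_nhds (ENNReal.ofReal_pos.2 hδ))).exists
    have h3 : r / ((k : ℝ) + 2) < r := by
      rw [div_lt_iff₀ (by positivity)]
      nlinarith [Nat.cast_nonneg (α := ℝ) k]
    have h4 : 0 < r / ((k : ℝ) + 2) := by positivity
    exact ⟨ρ k, by simp only [hρ]; linarith, by simp only [hρ]; linarith, hk.le⟩
  obtain ⟨χ, hχs, hχ0, hχ1, hχone, hχsupp⟩ := exists_smooth_cutoff c hρ0 hρr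
  set f₁ := (cube c ρ).indicator f with hf₁
  have hf₁m : Measurable f₁ := hf.indicator (isClosed_cube c ρ).measurableSet
  have hmem₁ : MemLp f₁ p := hmem.indicator (isClosed_cube c ρ).measurableSet
  obtain ⟨g, -, hgs, hgε⟩ := hmem₁.exist_eLpNorm_sub_le hpt hp1 hε2
  refine ⟨fun x => (χ x : ℂ) * g x, ⟨?_, ?_⟩, ?_⟩
  · exact (Complex.ofRealCLM.contDiff.comp hχs).mul hgs
  · intro x hx
    refine hχsupp fun h => hx ?_
    simp [h]
  · have hdecomp : (fun x => (χ x : ℂ) * g x) - f =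
        (fun x => (χ x : ℂ) * (g x - f₁ x)) - (cube c r \ cube c ρ).indicator f := by
      ext x
      simp only [Pi.sub_apply]
      by_cases hx : x ∈ cube c ρ
      · have h1 : f₁ x = f x := Set.indicator_of_mem hx f
        have h2 : (cube c r \ cube c ρ).indicator f x = 0 := by simp [hx]
        rw [h1, h2, hχone x hx]
        push_cast
        ring
      · have h1 : f₁ x = 0 := Set.indicator_of_notMem hx f
        rw [h1]
        by_cases hx' : x ∈ cube c r
        · have h2 : (cube c r \ cube c ρ).indicator f x = f x := by simp [hx, hx']
          rw [h2]; ring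
        · have h2 : f x = 0 := by
            by_contra h
            exact hx' (hsupp h)
          have h3 : (cube c r \ cube c ρ).indicator f x = 0 :=
            Set.indicator_of_notMem (fun h => hx' h.1) f
          rw [h2, h3]; ring
    rw [hdecomp]
    have hgm : AEStronglyMeasurable (fun x => (χ x : ℂ) * (g x - f₁ x)) volume :=
      ((Complex.measurable_ofReal.comp hχs.continuous.measurable).mul
        (hgs.continuous.measurable.sub hf₁m)).aestronglyMeasurable
    refine (eLpNorm_sub_le hgm (hf.indicator ((isClosed_cube c r).measurableSet.diff
      (isClosed_cube c ρ).measurableSet)).aestronglyMeasurable hp1).trans ?_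
    rw [← add_halves ε, ENNReal.ofReal_add hε2.le hε2.le]
    refine add_le_add ?_ (hδs _ ((isClosed_cube c r).measurableSet.diff
      (isClosed_cube c ρ).measurableSet) hρδ)
    refine le_trans (eLpNorm_mono fun x => ?_) hgε
    rw [Pi.sub_apply, norm_mul, norm_sub_rev, Complex.norm_real, Real.norm_of_nonneg (hχ0 x)]
    exact mul_le_of_le_one_left (norm_nonneg _) (hχ1 x)

lemma tendsto_adjointRestriction {m : ℕ} {Φ : EuclideanSpace ℝ (Fin m) → ℝ} (hΦ : Measurable Φ)
    {p : ℝ≥0∞} (hp1 : 1 ≤ p) {f : EuclideanSpace ℝ (Fin m) → ℂ} (hf : MemLp f p)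
    {u : ℕ → EuclideanSpace ℝ (Fin m) → ℂ} (hu : ∀ k, MemLp (u k) p)
    (hlim : Filter.Tendsto (fun k => eLpNorm (u k - f) p) Filter.atTop (𝓝 0))
    (z : EuclideanSpace ℝ (Fin m) × ℝ) :
    Filter.Tendsto (fun k => adjointRestriction Φ (u k) z) Filter.atTop
      (𝓝 (adjointRestriction Φ f z)) := by
  have hfin : IsFiniteMeasure (volume.restrict (unitCube m)) :=
    ⟨by rw [Measure.restrict_apply_univ]; exact (isCompact_cube 0 1).measure_lt_top⟩
  have hfi : IntegrableOn f (unitCube m) :=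
    memLp_one_iff_integrable.1 ((hf.restrict _).mono_exponent hp1)
  have hui : ∀ k, IntegrableOn (u k) (unitCube m) := fun k =>
    memLp_one_iff_integrable.1 (((hu k).restrict _).mono_exponent hp1)
  have h1 : Filter.Tendsto (fun k => eLpNorm (u k - f) 1 (volume.restrict (unitCube m)))
      Filter.atTop (𝓝 0) := by
    set V := (volume.restrict (unitCube m)) Set.univ ^
      (1 / (1 : ℝ≥0∞).toReal - 1 / p.toReal) with hV
    have hVt : V ≠ ⊤ := by
      have h0 : 0 ≤ 1 / (1 : ℝ≥0∞).toReal - 1 / p.toReal := by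
        rcases eq_or_ne p ⊤ with rfl | hpt
        · simp
        · have : 1 ≤ p.toReal := by
            rw [← ENNReal.toReal_one]
            exact ENNReal.toReal_mono hpt hp1
          rw [ENNReal.toReal_one, div_one, sub_nonneg, div_le_one (by linarith)]
          exact this
      exact ENNReal.rpow_ne_top_of_nonneg h0 (measure_ne_top _ _)
    refine tendsto_of_tendsto_of_tendsto_of_le_of_le tendsto_const_nhds
      (h := fun k => eLpNorm (u k - f) p * V) ?_ (fun _ => bot_le) fun k => ?_
    · simpa using ENNReal.Tendsto.mul_const hlim (Or.inr hVt)
    · refine (eLpNorm_le_eLpNorm_mul_rpow_measure_univ hp1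
        ((hu k).sub hf).aestronglyMeasurable.restrict).trans ?_
      exact mul_le_mul' (eLpNorm_mono_measure _ Measure.restrict_le_self) le_rfl
  rw [tendsto_iff_edist_tendsto_0]
  refine tendsto_of_tendsto_of_tendsto_of_le_of_le tendsto_const_nhds h1 (fun _ => bot_le)
    fun k => ?_
  rw [edist_eq_enorm_sub, ← adjointRestriction_sub hΦ (hui k) hfi, eLpNorm_one_eq_lintegral_enorm,
    adjointRestriction_eq]
  refine (enorm_integral_le_lintegral_enorm _).trans (le_of_eq ?_)
  congr 1
  ext y
  rw [enorm_mul, ← ofReal_norm (phaseKernel Φ z y), norm_phaseKernel]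
  simp

lemma eLpNorm_le_add_of_sub_le {m : ℕ} {p δ : ℝ≥0∞} (hp1 : 1 ≤ p)
    {w w' : EuclideanSpace ℝ (Fin m) → ℂ} (hw : MemLp w p) (hw' : MemLp w' p)
    (h : eLpNorm (w - w') p ≤ δ) : eLpNorm w p ≤ eLpNorm w' p + δ := by
  have h1 := eLpNorm_add_le (f := w') (g := w - w') hw'.1 (hw.1.sub hw'.1) hp1
  rw [add_sub_cancel] at h1
  exact h1.trans (add_le_add le_rfl h)

/-- A bilinear estimate for test functions extends to bounded measurable functions. -/
lemma BilinearRestrictionEstimate.exists_bounded {n N : ℕ} {A ε : ℝ} {p q : ℝ≥0∞}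
    (h : BilinearRestrictionEstimate n A N ε p p q) (hp1 : 1 ≤ p) (hpt : p ≠ ⊤)
    {κ : ℝ} (hκ : 0 < κ) :
    ∃ C : ℝ≥0, ∀ Φ : EuclideanSpace ℝ (Fin (n - 1)) → ℝ, Measurable Φ → IsEllipticPhase A N ε Φ →
      ∀ (c₁ c₂ : EuclideanSpace ℝ (Fin (n - 1))) (r₁ r₂ : ℝ), SeparatedSubcubes κ c₁ r₁ c₂ r₂ →
      ∀ (f g : EuclideanSpace ℝ (Fin (n - 1)) → ℂ) (K : ℝ), Measurable f → Measurable g →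
      (∀ y, ‖f y‖ ≤ K) → (∀ y, ‖g y‖ ≤ K) →
      Function.support f ⊆ cube c₁ r₁ → Function.support g ⊆ cube c₂ r₂ →
        eLpNorm (fun z => adjointRestriction Φ f z * adjointRestriction Φ g z) q volume ≤
          C * eLpNorm f p volume * eLpNorm g p volume := by
  obtain ⟨C, hC⟩ := h κ hκ
  refine ⟨C, fun Φ hΦm hΦ c₁ c₂ r₁ r₂ hsep f g K hf hg hfK hgK hfs hgs => ?_⟩
  have hr₁ : 0 < r₁ := by linarith [hsep.le_side_left]
  have hr₂ : 0 < r₂ := by linarith [hsep.le_side_right]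
  have hpos : ∀ k : ℕ, (0 : ℝ) < 1 / (k + 1) := fun k => by positivity
  choose u hut hu using fun k => exists_testFunction_approx hp1 hpt hf hfK hr₁ hfs (hpos k)
  choose v hvt hv using fun k => exists_testFunction_approx hp1 hpt hg hgK hr₂ hgs (hpos k)
  have h0 : Filter.Tendsto (fun k : ℕ => ENNReal.ofReal (1 / ((k : ℝ) + 1))) Filter.atTop (𝓝 0) := by
    rw [← ENNReal.ofReal_zero]
    exact (ENNReal.continuous_ofReal.tendsto 0).comp tendsto_one_div_add_atTop_nhds_zero_nat
  have hul := tendsto_of_tendsto_of_tendsto_of_le_of_le tendsto_const_nhds h0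
    (fun _ => bot_le) hu
  have hvl := tendsto_of_tendsto_of_tendsto_of_le_of_le tendsto_const_nhds h0
    (fun _ => bot_le) hv
  have hfm := memLp_of_bounded_of_support_subset hf hfK hfs p
  have hgm := memLp_of_bounded_of_support_subset hg hgK hgs p
  have htest : ∀ {c : EuclideanSpace ℝ (Fin (n - 1))} {r : ℝ} {w}, IsTestFunctionOn (cube c r) w →
      MemLp w p := fun {c r w} hw => by
    refine hw.contDiff.continuous.memLp_of_hasCompactSupport ?_
    exact HasCompactSupport.intro (isCompact_cube c r) fun x hx => by
      by_contra hne
      exact hx (hw.support_subset hne)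
  have hum := fun k => htest (hut k)
  have hvm := fun k => htest (hvt k)
  have hfin : IsFiniteMeasure (volume.restrict (unitCube (n - 1))) :=
    ⟨by rw [Measure.restrict_apply_univ]; exact (isCompact_cube 0 1).measure_lt_top⟩
  have hint : ∀ {w : EuclideanSpace ℝ (Fin (n - 1)) → ℂ}, MemLp w p →
      IntegrableOn w (unitCube (n - 1)) :=
    fun hw => memLp_one_iff_integrable.1 ((hw.restrict _).mono_exponent hp1)
  have hle : ∀ k, eLpNorm (fun z => adjointRestriction Φ (u k) z * adjointRestriction Φ (v k) z) q
      volume ≤ C * (eLpNorm f p volume + ENNReal.ofReal (1 / ((k : ℝ) + 1))) *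
        (eLpNorm g p volume + ENNReal.ofReal (1 / ((k : ℝ) + 1))) := fun k => by
    refine (hC Φ hΦ c₁ c₂ r₁ r₂ hsep _ _ (hut k) (hvt k)).trans ?_
    have h1 := eLpNorm_le_add_of_sub_le hp1 (hum k) hfm (hu k)
    have h2 := eLpNorm_le_add_of_sub_le hp1 (hvm k) hgm (hv k)
    gcongr
  have hlim : Filter.Tendsto (fun k : ℕ =>
      C * (eLpNorm f p volume + ENNReal.ofReal (1 / ((k : ℝ) + 1))) *
        (eLpNorm g p volume + ENNReal.ofReal (1 / ((k : ℝ) + 1)))) Filter.atTop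
      (𝓝 (C * (eLpNorm f p volume + 0) * (eLpNorm g p volume + 0))) := by
    have h1 := (tendsto_const_nhds (x := eLpNorm f p volume)).add h0
    have h2 := (tendsto_const_nhds (x := eLpNorm g p volume)).add h0
    refine ENNReal.Tendsto.mul (ENNReal.Tendsto.const_mul h1 (Or.inr ENNReal.coe_ne_top))
      (Or.inr ?_) h2 (Or.inr ?_)
    · simpa using hgm.eLpNorm_ne_top
    · simpa using ENNReal.mul_ne_top ENNReal.coe_ne_top hfm.eLpNorm_ne_top
  rw [add_zero, add_zero] at hlim
  refine le_trans (Lp.eLpNorm_lim_le_liminf_eLpNorm (f := fun k z =>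
    adjointRestriction Φ (u k) z * adjointRestriction Φ (v k) z) (fun k => ?_) _ ?_) ?_
  · exact ((continuous_adjointRestriction hΦm (hint (hum k))).mul
      (continuous_adjointRestriction hΦm (hint (hvm k)))).aestronglyMeasurable
  · exact Filter.Eventually.of_forall fun z => (tendsto_adjointRestriction hΦm hp1 hfm hum hul z).mul
      (tendsto_adjointRestriction hΦm hp1 hgm hvm hvl z)
  · rw [← hlim.liminf_eq]
    exact Filter.liminf_le_liminf (Filter.Eventually.of_forall hle)

/-! ### Parabolic scaling -/

lemma eLpNorm_comp_add_smul {m : ℕ} {f : EuclideanSpace ℝ (Fin m) → ℂ} (hf : Measurable f)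
    (c : EuclideanSpace ℝ (Fin m)) {r : ℝ} (hr : 0 < r) {p : ℝ≥0∞} (hpt : p ≠ ⊤) :
    eLpNorm (fun Y => f (c + r • Y)) p =
      ENNReal.ofReal ((r ^ m)⁻¹) ^ (1 / p.toReal) * eLpNorm f p := by
  have hmap : Measure.map (fun Y : EuclideanSpace ℝ (Fin m) => c + r • Y) volume =
      ENNReal.ofReal ((r ^ m)⁻¹) • volume := by
    have h1 : (fun Y : EuclideanSpace ℝ (Fin m) => c + r • Y) = (fun y => c + y) ∘ fun Y => r • Y :=
      rfl
    rw [h1, ← Measure.map_map (by fun_prop) (by fun_prop), Measure.map_addHaar_smul _ hr.ne',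
      Measure.map_smul, map_add_left_eq_self]
    congr 2
    rw [finrank_euclideanSpace, Fintype.card_fin, abs_of_pos (by positivity)]
  have h2 : (fun Y => f (c + r • Y)) = f ∘ fun Y => c + r • Y := rfl
  rw [h2, ← eLpNorm_map_measure hf.aestronglyMeasurable (by fun_prop), hmap,
    eLpNorm_smul_measure_of_ne_top hpt, smul_eq_mul]
  congr 2
  simp

/-- The Galilean and parabolic change of variables on space-time. -/
noncomputable def galilean {m : ℕ} (v : EuclideanSpace ℝ (Fin m)) (r : ℝ)
    (z : EuclideanSpace ℝ (Fin m) × ℝ) : EuclideanSpace ℝ (Fin m) × ℝ :=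
  (r • (z.1 + z.2 • v), r ^ 2 * z.2)

lemma continuous_galilean {m : ℕ} (v : EuclideanSpace ℝ (Fin m)) (r : ℝ) :
    Continuous (galilean v r) := by
  unfold galilean; fun_prop

lemma map_galilean_volume {m : ℕ} (v : EuclideanSpace ℝ (Fin m)) {r : ℝ} (hr : 0 < r) :
    Measure.map (galilean v r) volume = ENNReal.ofReal ((r ^ (m + 2))⁻¹) • volume := by
  have hshear : MeasurePreserving
      (fun z : EuclideanSpace ℝ (Fin m) × ℝ => (z.1 + z.2 • v, z.2)) volume volume := by
    have h1 : MeasurePreserving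
        (fun z : ℝ × EuclideanSpace ℝ (Fin m) => (z.1, z.2 + z.1 • v)) (volume.prod volume)
        (volume.prod volume) :=
      (MeasurePreserving.id volume).skew_product (g := fun t x => x + t • v) (by fun_prop)
        (Filter.Eventually.of_forall fun t => map_add_right_eq_self _ _)
    exact (Measure.measurePreserving_swap.comp h1).comp Measure.measurePreserving_swap
  have h2 : galilean v r = (Prod.map (fun x : EuclideanSpace ℝ (Fin m) => r • x)
      (fun t : ℝ => r ^ 2 * t)) ∘ fun z => (z.1 + z.2 • v, z.2) := rfl
  have h3 : Measure.map (fun t : ℝ => r ^ 2 * t) volume = ENNReal.ofReal ((r ^ 2)⁻¹) • volume := by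
    rw [Real.map_volume_mul_left (by positivity), abs_of_pos (by positivity)]
  have h4 : Measure.map (fun x : EuclideanSpace ℝ (Fin m) => r • x) volume =
      ENNReal.ofReal ((r ^ m)⁻¹) • volume := by
    rw [Measure.map_addHaar_smul _ hr.ne']
    congr 2
    rw [finrank_euclideanSpace, Fintype.card_fin, abs_of_pos (by positivity)]
  rw [h2, ← Measure.map_map (by fun_prop) (by fun_prop), hshear.map_eq, Measure.volume_eq_prod,
    ← Measure.map_prod_map _ _ (by fun_prop) (by fun_prop), h3, h4, Measure.prod_smul_left,
    Measure.prod_smul_right, smul_smul, ← ENNReal.ofReal_mul (by positivity)]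
  congr 2
  rw [pow_add, mul_inv]

lemma eLpNorm_comp_galilean {m : ℕ} (v : EuclideanSpace ℝ (Fin m)) {r : ℝ} (hr : 0 < r)
    {G : EuclideanSpace ℝ (Fin m) × ℝ → ℂ} (hG : Continuous G) {q : ℝ≥0∞} (hqt : q ≠ ⊤) :
    eLpNorm (fun z => G (galilean v r z)) q =
      ENNReal.ofReal ((r ^ (m + 2))⁻¹) ^ (1 / q.toReal) * eLpNorm G q := by
  have h2 : (fun z => G (galilean v r z)) = G ∘ galilean v r := rfl
  rw [h2, ← eLpNorm_map_measure hG.aestronglyMeasurable (continuous_galilean v r).aemeasurable,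
    map_galilean_volume v hr, eLpNorm_smul_measure_of_ne_top hqt, smul_eq_mul]
  congr 2
  simp

/-- Parabolic scaling of the extension operator. -/
lemma norm_adjointRestriction_rescaledPhase {m : ℕ} {Φ : EuclideanSpace ℝ (Fin m) → ℝ}
    {f : EuclideanSpace ℝ (Fin m) → ℂ} {c : EuclideanSpace ℝ (Fin m)} {r : ℝ} (hr : 0 < r)
    (hc : cube c r ⊆ unitCube m) (hf : Function.support f ⊆ cube c r) :
    ∃ v : EuclideanSpace ℝ (Fin m), v = (InnerProductSpace.toDual ℝ _).symm
      (fderivWithin ℝ Φ (unitCube m) c) ∧ ∀ z,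
      ‖adjointRestriction Φ f z‖ = r ^ m *
        ‖adjointRestriction (rescaledPhase Φ c r) (fun Y => f (c + r • Y)) (galilean v r z)‖ := by
  set D := fderivWithin ℝ Φ (unitCube m) c with hD
  refine ⟨(InnerProductSpace.toDual ℝ _).symm D, rfl, fun z => ?_⟩
  set v := (InnerProductSpace.toDual ℝ (EuclideanSpace ℝ (Fin m))).symm D with hv
  have hvD : ∀ Y, inner ℝ v Y = D Y := fun Y => InnerProductSpace.toDual_symm_apply
  have hsupp' : Function.support (fun Y => f (c + r • Y)) ⊆ unitCube m := by
    intro Y hY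
    have := hf (show c + r • Y ∈ Function.support f from hY)
    rw [mem_unitCube]
    intro i
    have h1 := this i
    simp only [PiLp.add_apply, PiLp.smul_apply, smul_eq_mul, add_sub_cancel_left, abs_mul,
      abs_of_pos hr] at h1
    exact le_of_mul_le_mul_left (by linarith) hr
  have hker : ∀ Y, phaseKernel Φ z (c + r • Y) =
      phaseKernel Φ z c * phaseKernel (rescaledPhase Φ c r) (galilean v r z) Y := by
    intro Y
    have hΦ : Φ (c + r • Y) = Φ c + r * D Y + r ^ 2 * rescaledPhase Φ c r Y := by
      simp only [rescaledPhase]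
      field_simp
      ring
    unfold phaseKernel galilean
    rw [← Complex.exp_add]
    congr 1
    have h5 : inner ℝ z.1 (c + r • Y) + z.2 * Φ (c + r • Y) = (inner ℝ z.1 c + z.2 * Φ c) +
        (inner ℝ (r • (z.1 + z.2 • v)) Y + r ^ 2 * z.2 * rescaledPhase Φ c r Y) := by
      rw [hΦ, inner_add_right, inner_smul_right, inner_smul_left, inner_add_left, inner_smul_left,
        hvD]
      simp
      ring
    rw [h5]
    push_cast
    ring
  rw [adjointRestriction_eq_integral Φ (hf.trans hc), adjointRestriction_eq_integral _ hsupp']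
  have hsub : ∫ y, phaseKernel Φ z y * f y =
      (r ^ m : ℝ) • ∫ Y, phaseKernel Φ z (c + r • Y) * f (c + r • Y) := by
    have h6 := Measure.integral_comp_smul volume
      (fun y => phaseKernel Φ z (c + y) * f (c + y)) r
    rw [h6, integral_add_left_eq_self (fun y => phaseKernel Φ z y * f y), smul_smul,
      finrank_euclideanSpace, Fintype.card_fin, abs_of_pos (by positivity),
      mul_inv_cancel₀ (by positivity), one_smul]
  rw [hsub]
  simp_rw [hker, mul_assoc]
  rw [integral_const_mul, norm_smul, norm_mul, norm_phaseKernel, one_mul,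
    Real.norm_of_nonneg (by positivity)]

lemma measurable_rescaledPhase {m : ℕ} {Φ : EuclideanSpace ℝ (Fin m) → ℝ} (hΦ : Measurable Φ)
    (c : EuclideanSpace ℝ (Fin m)) (r : ℝ) : Measurable (rescaledPhase Φ c r) := by
  have h1 : Measurable fun Y : EuclideanSpace ℝ (Fin m) => Φ (c + r • Y) :=
    hΦ.comp (by fun_prop)
  have h2 : Measurable fun Y => fderivWithin ℝ Φ (unitCube m) c Y :=
    (ContinuousLinearMap.continuous _).measurable
  exact (h1.sub ((h2.const_mul r).const_add _)).const_mul _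

/-- The bilinear estimate for a pair of cubes of size and separation comparable to `r`. -/
lemma BilinearRestrictionEstimate.exists_rescaled {n N : ℕ} (hN : 2 ≤ N) {A A' ε : ℝ} (hε : ε ≤ 1)
    {p q : ℝ≥0∞} (hAA : A ≤ A') (hA' : 2 * (1 + ((n - 1 : ℕ) : ℝ) ^ 2) ^ 2 ≤ A')
    (h : BilinearRestrictionEstimate n A' N ε p p q) (hp1 : 1 ≤ p) (hpt : p ≠ ⊤) (hqt : q ≠ ⊤)
    {κ : ℝ} (hκ : 0 < κ) :
    ∃ C : ℝ≥0, ∀ Φ : EuclideanSpace ℝ (Fin (n - 1)) → ℝ, Measurable Φ → IsEllipticPhase A N ε Φ →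
      ∀ (c : EuclideanSpace ℝ (Fin (n - 1))) (r : ℝ), 0 < r → r ≤ 1 → cube c r ⊆ unitCube (n - 1) →
      ∀ (c₁ c₂ : EuclideanSpace ℝ (Fin (n - 1))) (r₁ r₂ : ℝ), SeparatedSubcubes κ c₁ r₁ c₂ r₂ →
      ∀ (f g : EuclideanSpace ℝ (Fin (n - 1)) → ℂ) (K : ℝ), Measurable f → Measurable g →
      (∀ y, ‖f y‖ ≤ K) → (∀ y, ‖g y‖ ≤ K) →
      (∀ Y, f (c + r • Y) ≠ 0 → Y ∈ cube c₁ r₁) → (∀ Y, g (c + r • Y) ≠ 0 → Y ∈ cube c₂ r₂) →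
        eLpNorm (fun z => adjointRestriction Φ f z * adjointRestriction Φ g z) q volume ≤
          C * (ENNReal.ofReal (r ^ (n - 1)) ^ 2 *
            ENNReal.ofReal ((r ^ (n - 1 + 2))⁻¹) ^ (1 / q.toReal) *
            (ENNReal.ofReal ((r ^ (n - 1))⁻¹) ^ (1 / p.toReal)) ^ 2) *
            eLpNorm f p volume * eLpNorm g p volume := by
  obtain ⟨C, hC⟩ := h.exists_bounded hp1 hpt hκ
  refine ⟨C, fun Φ hΦm hΦ c r hr hr1 hcr c₁ c₂ r₁ r₂ hsep f g K hf hg hfK hgK hfs hgs => ?_⟩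
  set Ψ := rescaledPhase Φ c r with hΨ
  have hΨm : Measurable Ψ := measurable_rescaledPhase hΦm c r
  have hΨe : IsEllipticPhase A' N ε Ψ := hΦ.rescaledPhase hN hε hAA hA' hr hr1 hcr
  have hback : ∀ {w : EuclideanSpace ℝ (Fin (n - 1)) → ℂ} {c' r'},
      cube c' r' ⊆ unitCube (n - 1) → (∀ Y, w (c + r • Y) ≠ 0 → Y ∈ cube c' r') →
      Function.support w ⊆ cube c r := fun {w c' r'} hcu hw y hy => by
    have hy' : c + r • (r⁻¹ • (y - c)) = y := by
      rw [smul_smul, mul_inv_cancel₀ hr.ne', one_smul, add_sub_cancel]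
    have h1 := mem_unitCube.1 (hcu (hw (r⁻¹ • (y - c)) (by rw [hy']; exact hy)))
    intro i
    have h2 := h1 i
    simp only [PiLp.smul_apply, PiLp.sub_apply, smul_eq_mul, abs_mul, abs_inv, abs_of_pos hr] at h2
    rwa [inv_mul_le_iff₀ hr, mul_one] at h2
  obtain ⟨v, hv, hvf⟩ := norm_adjointRestriction_rescaledPhase (Φ := Φ) hr hcr
    (hback hsep.subset_left hfs)
  obtain ⟨v', hv', hvg⟩ := norm_adjointRestriction_rescaledPhase (Φ := Φ) hr hcr
    (hback hsep.subset_right hgs)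
  obtain rfl : v = v' := hv.trans hv'.symm
  set f' := fun Y => f (c + r • Y) with hf'
  set g' := fun Y => g (c + r • Y) with hg'
  have hf'm : Measurable f' := hf.comp (by fun_prop)
  have hg'm : Measurable g' := hg.comp (by fun_prop)
  have hmain := hC Ψ hΨm hΨe c₁ c₂ r₁ r₂ hsep f' g' K hf'm hg'm (fun Y => hfK _) (fun Y => hgK _)
    hfs hgs
  have hint : ∀ {w : EuclideanSpace ℝ (Fin (n - 1)) → ℂ} {c' r'}, Measurable w →
      (∀ y, ‖w y‖ ≤ K) → Function.support w ⊆ cube c' r' → IntegrableOn w (unitCube (n - 1)) :=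
    fun hw hwK hws => (memLp_one_iff_integrable.1
      (memLp_of_bounded_of_support_subset hw hwK hws 1)).integrableOn
  set G := fun z => adjointRestriction Ψ f' z * adjointRestriction Ψ g' z with hG
  have hGc : Continuous G :=
    (continuous_adjointRestriction hΨm (hint hf'm (fun Y => hfK _) hfs)).mul
      (continuous_adjointRestriction hΨm (hint hg'm (fun Y => hgK _) hgs))
  have hnorm : eLpNorm (fun z => adjointRestriction Φ f z * adjointRestriction Φ g z) q volume =
      ENNReal.ofReal (r ^ (n - 1)) ^ 2 * eLpNorm (fun z => G (galilean v r z)) q := by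
    have h3 : eLpNorm (fun z => adjointRestriction Φ f z * adjointRestriction Φ g z) q volume =
        eLpNorm (((r ^ (n - 1)) ^ 2 : ℝ) • (fun z => G (galilean v r z))) q volume := by
      refine eLpNorm_congr_norm_ae (Filter.Eventually.of_forall fun z => ?_)
      rw [Pi.smul_apply, norm_smul, norm_mul, hvf, hvg, hG, norm_mul,
        Real.norm_of_nonneg (by positivity)]
      ring
    rw [h3, eLpNorm_const_smul, Real.enorm_of_nonneg (by positivity),
      ENNReal.ofReal_pow (by positivity)]
  rw [hnorm, eLpNorm_comp_galilean v hr hGc hqt]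
  calc _ ≤ ENNReal.ofReal (r ^ (n - 1)) ^ 2 *
        (ENNReal.ofReal ((r ^ (n - 1 + 2))⁻¹) ^ (1 / q.toReal) *
          (C * eLpNorm f' p volume * eLpNorm g' p volume)) := by gcongr
    _ = _ := by
      rw [hf', hg', eLpNorm_comp_add_smul hf c hr hpt, eLpNorm_comp_add_smul hg c hr hpt]
      ring

/-! ### Smooth frequency projections -/

open scoped FourierTransform

/-- A smooth bump function equal to `1` on the cube `[-1,1]^m`, which lies in the Euclidean ball of
radius `m + 1`. -/
noncomputable def freqBump (m : ℕ) : ContDiffBump (0 : EuclideanSpace ℝ (Fin m)) :=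
  ⟨m + 1, m + 2, by positivity, by linarith⟩

/-- The frequency cutoff adapted to the cube with centre `a / R` and half side length `1 / R`; it is
equal to `1` on this cube. -/
noncomputable def freqCutoff {m : ℕ} (R : ℝ) (a ξ : EuclideanSpace ℝ (Fin m)) : ℂ :=
  (freqBump m (R • ξ - a) : ℂ)

/-- The convolution kernel of the smooth projection to a frequency cube. -/
noncomputable def projKernel {m : ℕ} (R : ℝ) (a : EuclideanSpace ℝ (Fin m)) :
    EuclideanSpace ℝ (Fin m) → ℂ := 𝓕 (freqCutoff R a)

section

variable {m : ℕ} {R : ℝ} {a : EuclideanSpace ℝ (Fin m)}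

lemma contDiff_freqCutoff : ContDiff ℝ ∞ (freqCutoff R a) := by
  refine Complex.ofRealCLM.contDiff.comp ((freqBump m).contDiff.comp ?_)
  fun_prop

lemma norm_freqCutoff_le_one (ξ : EuclideanSpace ℝ (Fin m)) : ‖freqCutoff R a ξ‖ ≤ 1 := by
  rw [freqCutoff, Complex.norm_real, Real.norm_of_nonneg (freqBump m).nonneg]
  exact (freqBump m).le_one

lemma freqCutoff_eq_one {ξ : EuclideanSpace ℝ (Fin m)} (h : ∀ i, |R * ξ i - a i| ≤ 1) :
    freqCutoff R a ξ = 1 := by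
  rw [freqCutoff, (freqBump m).one_of_mem_closedBall]
  · simp
  · rw [mem_closedBall_zero_iff]
    refine (norm_le_of_abs_apply_le (r := 1) fun i => by simpa using h i).trans ?_
    simp [freqBump]

lemma abs_lt_of_freqCutoff_ne_zero {ξ : EuclideanSpace ℝ (Fin m)} (h : freqCutoff R a ξ ≠ 0)
    (i : Fin m) : |R * ξ i - a i| < m + 2 := by
  have h1 : freqBump m (R • ξ - a) ≠ 0 := by
    intro h'; exact h (by simp [freqCutoff, h'])
  have h2 : R • ξ - a ∈ Function.support (freqBump m) := h1
  rw [(freqBump m).support_eq, mem_ball_zero_iff] at h2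
  have h3 := (abs_apply_le_norm (R • ξ - a) i).trans_lt h2
  simpa [freqBump] using h3

lemma hasCompactSupport_freqCutoff (hR : 0 < R) : HasCompactSupport (freqCutoff R a) := by
  refine HasCompactSupport.intro (isCompact_cube (R⁻¹ • a) (R⁻¹ * (m + 2))) fun ξ hξ => ?_
  by_contra h
  refine hξ fun i => ?_
  have := (abs_lt_of_freqCutoff_ne_zero h i).le
  have h2 : ξ i - (R⁻¹ • a) i = R⁻¹ * (R * ξ i - a i) := by
    simp only [PiLp.smul_apply, smul_eq_mul]
    field_simp
  rw [h2, abs_mul, abs_of_pos (inv_pos.2 hR)]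
  gcongr

/-- The frequency cutoff as a Schwartz function. -/
noncomputable def freqCutoffS (hR : 0 < R) (a : EuclideanSpace ℝ (Fin m)) :
    SchwartzMap (EuclideanSpace ℝ (Fin m)) ℂ :=
  (hasCompactSupport_freqCutoff (a := a) hR).toSchwartzMap contDiff_freqCutoff

lemma integrable_freqCutoff (hR : 0 < R) : Integrable (freqCutoff R a) :=
  (freqCutoffS hR a).integrable

lemma integrable_projKernel (hR : 0 < R) : Integrable (projKernel R a) :=
  (𝓕 (freqCutoffS hR a)).integrable

lemma memLp_projKernel (hR : 0 < R) (p : ℝ≥0∞) :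
    MemLp (projKernel R a) p volume :=
  (𝓕 (freqCutoffS hR a)).memLp p volume

lemma continuous_projKernel (hR : 0 < R) : Continuous (projKernel R a) :=
  (𝓕 (freqCutoffS hR a)).continuous

lemma integral_exp_mul_projKernel (hR : 0 < R) (ξ : EuclideanSpace ℝ (Fin m)) :
    ∫ u, Complex.exp (((2 * Real.pi * inner ℝ u ξ : ℝ) : ℂ) * Complex.I) * projKernel R a u =
      freqCutoff R a ξ := by
  have h1 : 𝓕⁻ (projKernel R a) = freqCutoff R a := by
    have h2 : 𝓕⁻ (𝓕 (freqCutoffS hR a) : SchwartzMap (EuclideanSpace ℝ (Fin m)) ℂ) =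
        freqCutoffS hR a := FourierTransform.fourierInv_fourier_eq _
    have h3 := congrArg (fun f : SchwartzMap (EuclideanSpace ℝ (Fin m)) ℂ => ⇑f) h2
    simp only [SchwartzMap.fourierInv_coe] at h3
    exact h3
  rw [← h1, Real.fourierInv_eq']
  simp [smul_eq_mul]

/-- The kernels are modulated dilates of a single function, so they have the same `L¹` norm. -/
lemma lintegral_enorm_projKernel (hR : 0 < R) :
    ∫⁻ u, ‖projKernel R a u‖ₑ = ∫⁻ u, ‖projKernel (m := m) 1 0 u‖ₑ := by
  have h1 : ∀ u, ‖projKernel R a u‖ₑ =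
      ENNReal.ofReal ((R ^ m)⁻¹) * ‖projKernel 1 0 (R⁻¹ • u)‖ₑ := by
    intro u
    have h2 : projKernel R a u = (R ^ m)⁻¹ • (Complex.exp
        (((-2 * Real.pi * inner ℝ (R⁻¹ • a) u : ℝ) : ℂ) * Complex.I) *
          projKernel 1 0 (R⁻¹ • u)) := by
      simp only [projKernel, Real.fourier_eq']
      have h3 := Measure.integral_comp_smul volume
        (fun v : EuclideanSpace ℝ (Fin m) => Complex.exp
          (((-2 * Real.pi * inner ℝ (R⁻¹ • v) u : ℝ) : ℂ) * Complex.I) • freqCutoff 1 a v) R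
      rw [finrank_euclideanSpace, Fintype.card_fin, abs_of_pos (by positivity)] at h3
      have h4 : ∀ v : EuclideanSpace ℝ (Fin m), R⁻¹ • R • v = v := fun v => by
        rw [smul_smul, inv_mul_cancel₀ hR.ne', one_smul]
      have h5 : ∀ v : EuclideanSpace ℝ (Fin m), freqCutoff 1 a (R • v) = freqCutoff R a v :=
        fun v => by simp [freqCutoff]
      simp_rw [h4, h5] at h3
      rw [h3]
      congr 1
      rw [← integral_add_left_eq_self _ a, ← integral_const_mul]
      congr 1
      ext v
      have h6 : freqCutoff 1 a (a + v) = freqCutoff 1 0 v := by simp [freqCutoff]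
      rw [h6, smul_eq_mul, smul_eq_mul, ← mul_assoc, ← Complex.exp_add]
      congr 2
      rw [smul_add, inner_add_left, inner_smul_left (𝕜 := ℝ) v, inner_smul_right (𝕜 := ℝ) v]
      simp
      ring
    rw [h2, enorm_smul, enorm_mul, Real.enorm_of_nonneg (by positivity)]
    congr 1
    rw [← ofReal_norm, Complex.norm_exp_ofReal_mul_I]
    simp
  simp_rw [h1]
  rw [lintegral_const_mul _ (by
    exact ((continuous_projKernel (m := m) (a := 0) one_pos).comp
      (continuous_const_smul R⁻¹)).enorm.measurable)]
  have h7 : ∫⁻ u : EuclideanSpace ℝ (Fin m), ‖projKernel 1 0 (R⁻¹ • u)‖ₑ =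
      ∫⁻ u, ‖projKernel (m := m) 1 0 u‖ₑ ∂(Measure.map (fun u => R⁻¹ • u) volume) := by
    rw [lintegral_map (continuous_projKernel one_pos).enorm.measurable (by fun_prop)]
  rw [h7, Measure.map_addHaar_smul _ (inv_ne_zero hR.ne'), lintegral_smul_measure, smul_eq_mul,
    ← mul_assoc, ← ENNReal.ofReal_mul (by positivity)]
  rw [finrank_euclideanSpace, Fintype.card_fin, inv_pow, inv_inv, abs_of_pos (by positivity),
    inv_mul_cancel₀ (by positivity), ENNReal.ofReal_one, one_mul]

/-- The `L¹` norm common to all projection kernels. -/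
noncomputable def projConst (m : ℕ) : ℝ≥0∞ := ∫⁻ u, ‖projKernel (m := m) 1 0 u‖ₑ

lemma projConst_lt_top (m : ℕ) : projConst m < ⊤ :=
  (integrable_projKernel (m := m) (a := 0) one_pos).2

/-! ### The `L²` bound for the projections -/

/-- The smooth frequency projection of a function on `ℝᵐ`. The kernel is applied to `v (x + u)` rather
than to `v (x - u)`: this is the transpose of the projection which reproduces functions with
frequencies in the cube, under the sign convention of `adjointRestriction`. -/
noncomputable def freqProj (R : ℝ) (a : EuclideanSpace ℝ (Fin m))
    (v : EuclideanSpace ℝ (Fin m) → ℂ) (x : EuclideanSpace ℝ (Fin m)) : ℂ :=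
  ∫ u, projKernel R a u * v (x + u)

/-- The frequency projection is the Fourier multiplier with symbol `freqCutoff R a`. -/
lemma freqProj_eq_fourierInv (hR : 0 < R) {v : EuclideanSpace ℝ (Fin m) → ℂ} (hv : Integrable v)
    (x : EuclideanSpace ℝ (Fin m)) :
    freqProj R a v x = 𝓕⁻ (fun ξ => freqCutoff R a ξ * 𝓕 v ξ) x := by
  have hvx : Integrable (fun u => v (x + u)) := hv.comp_add_left x
  have h1 := VectorFourier.integral_fourierIntegral_smul_eq_flip (μ := volume) (ν := volume)
    (e := Real.fourierChar) (L := innerₗ (EuclideanSpace ℝ (Fin m)))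
    Real.continuous_fourierChar continuous_inner (integrable_freqCutoff (a := a) hR) hvx
  have h2 : ∀ ξ, VectorFourier.fourierIntegral Real.fourierChar volume
      (innerₗ (EuclideanSpace ℝ (Fin m))).flip (fun u => v (x + u)) ξ =
      Complex.exp (((2 * Real.pi * inner ℝ ξ x : ℝ) : ℂ) * Complex.I) * 𝓕 v ξ := by
    intro ξ
    rw [flip_innerₗ]
    change 𝓕 (fun u => v (x + u)) ξ = _
    rw [Real.fourier_eq', Real.fourier_eq', ← integral_const_mul,
      ← integral_add_left_eq_self (fun u => Complex.exp (((2 * Real.pi * inner ℝ ξ x : ℝ) : ℂ) *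
        Complex.I) * (Complex.exp (((-2 * Real.pi * inner ℝ u ξ : ℝ) : ℂ) * Complex.I) • v u)) x]
    congr 1
    ext u
    rw [smul_eq_mul, smul_eq_mul, ← mul_assoc, ← Complex.exp_add, inner_add_left,
      real_inner_comm ξ x]
    congr 2
    push_cast
    ring
  rw [Real.fourierInv_eq', freqProj]
  refine h1.trans ?_
  simp_rw [h2]
  congr 1
  ext ξ
  simp only [smul_eq_mul]
  push_cast
  ring

end

open scoped FourierTransform

section

variable {m : ℕ} {R : ℝ} {a : EuclideanSpace ℝ (Fin m)}

lemma lintegral_enorm_sq_schwartz (s : SchwartzMap (EuclideanSpace ℝ (Fin m)) ℂ) :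
    ∫⁻ x, ‖s x‖ₑ ^ 2 = ENNReal.ofReal (∫ x, ‖s x‖ ^ 2) := by
  rw [ofReal_integral_eq_lintegral_ofReal ((s.memLp 2 volume).integrable_norm_pow (by norm_num))
    (Filter.Eventually.of_forall fun x => by positivity)]
  refine lintegral_congr fun x => ?_
  rw [ENNReal.ofReal_pow (norm_nonneg _), ofReal_norm]

lemma lintegral_enorm_sq_fourier (s : SchwartzMap (EuclideanSpace ℝ (Fin m)) ℂ) :
    ∫⁻ x, ‖(𝓕 s : SchwartzMap (EuclideanSpace ℝ (Fin m)) ℂ) x‖ₑ ^ 2 = ∫⁻ x, ‖s x‖ₑ ^ 2 := by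
  rw [lintegral_enorm_sq_schwartz, lintegral_enorm_sq_schwartz, SchwartzMap.integral_norm_sq_fourier]

lemma exists_schwartz_freqProj (hR : 0 < R) (v : SchwartzMap (EuclideanSpace ℝ (Fin m)) ℂ) :
    ∃ w : SchwartzMap (EuclideanSpace ℝ (Fin m)) ℂ, freqProj R a v = w ∧
      ∫⁻ x, ‖w x‖ₑ ^ 2 = ∫⁻ ξ, ‖freqCutoff R a ξ‖ₑ ^ 2 *
        ‖(𝓕 v : SchwartzMap (EuclideanSpace ℝ (Fin m)) ℂ) ξ‖ₑ ^ 2 := by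
  set v' : SchwartzMap (EuclideanSpace ℝ (Fin m)) ℂ := 𝓕 v with hv'
  have hcs : HasCompactSupport fun ξ => freqCutoff R a ξ * v' ξ :=
    (hasCompactSupport_freqCutoff (a := a) hR).mul_right
  have hcd : ContDiff ℝ ∞ fun ξ => freqCutoff R a ξ * v' ξ :=
    contDiff_freqCutoff.mul (v'.smooth _)
  set w := hcs.toSchwartzMap hcd with hw
  refine ⟨𝓕⁻ w, ?_, ?_⟩
  · ext x
    rw [freqProj_eq_fourierInv hR v.integrable, SchwartzMap.fourierInv_coe]
    rfl
  · rw [← lintegral_enorm_sq_fourier, FourierTransform.fourier_fourierInv_eq]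
    refine lintegral_congr fun ξ => ?_
    have : w ξ = freqCutoff R a ξ * v' ξ := rfl
    rw [this, enorm_mul, mul_pow]

lemma sum_lintegral_freqProj_schwartz_le (hR : 0 < R) {ι : Type*} (S : Finset ι)
    (c : ι → EuclideanSpace ℝ (Fin m)) {D : ℝ≥0∞}
    (hD : ∀ ξ, ∑ k ∈ S, ‖freqCutoff R (c k) ξ‖ₑ ^ 2 ≤ D)
    (v : SchwartzMap (EuclideanSpace ℝ (Fin m)) ℂ) :
    ∑ k ∈ S, ∫⁻ x, ‖freqProj R (c k) v x‖ₑ ^ 2 ≤ D * ∫⁻ x, ‖v x‖ₑ ^ 2 := by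
  have h1 : ∀ k, ∫⁻ x, ‖freqProj R (c k) v x‖ₑ ^ 2 = ∫⁻ ξ, ‖freqCutoff R (c k) ξ‖ₑ ^ 2 *
      ‖(𝓕 v : SchwartzMap (EuclideanSpace ℝ (Fin m)) ℂ) ξ‖ₑ ^ 2 := fun k => by
    obtain ⟨w, hw, hw2⟩ := exists_schwartz_freqProj (a := c k) hR v
    rw [hw, hw2]
  have hm : Measurable fun ξ => ‖(𝓕 v : SchwartzMap (EuclideanSpace ℝ (Fin m)) ℂ) ξ‖ₑ ^ 2 :=
    ((𝓕 v : SchwartzMap (EuclideanSpace ℝ (Fin m)) ℂ).continuous.enorm.measurable).pow_const 2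
  have hm2 : ∀ k, Measurable fun ξ => ‖freqCutoff R (c k) ξ‖ₑ ^ 2 := fun k =>
    (contDiff_freqCutoff.continuous.enorm.measurable).pow_const 2
  simp_rw [h1]
  have hm3 : ∀ k, Measurable fun ξ => ‖freqCutoff R (c k) ξ‖ₑ ^ 2 *
      ‖(𝓕 v : SchwartzMap (EuclideanSpace ℝ (Fin m)) ℂ) ξ‖ₑ ^ 2 := fun k => (hm2 k).mul hm
  rw [← lintegral_finsetSum _ fun k _ => hm3 k, ← lintegral_enorm_sq_fourier v,
    ← lintegral_const_mul _ hm]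
  refine lintegral_mono fun ξ => ?_
  rw [← Finset.sum_mul]
  exact mul_le_mul' (hD ξ) le_rfl

/-- Almost orthogonality in `L²`: Plancherel for Schwartz functions, then density and the lemma of
Fatou. -/
lemma sum_lintegral_freqProj_le (hR : 0 < R) {ι : Type*} (S : Finset ι)
    (c : ι → EuclideanSpace ℝ (Fin m)) {D : ℝ≥0∞} (hD1 : 1 ≤ D)
    (hDt : D ≠ ⊤)
    (hD : ∀ ξ, ∑ k ∈ S, ‖freqCutoff R (c k) ξ‖ₑ ^ 2 ≤ D)
    {v : EuclideanSpace ℝ (Fin m) → ℂ} (hv : Measurable v) :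
    ∑ k ∈ S, ∫⁻ x, ‖freqProj R (c k) v x‖ₑ ^ 2 ≤ D * ∫⁻ x, ‖v x‖ₑ ^ 2 := by
  have hnorm : ∀ {w : EuclideanSpace ℝ (Fin m) → ℂ},
      eLpNorm w 2 = (∫⁻ x, ‖w x‖ₑ ^ 2) ^ (1 / 2 : ℝ) := fun {w} => by
    rw [eLpNorm_eq_lintegral_rpow_enorm_toReal (by norm_num) (by norm_num)]
    simp
  have hsq : ∀ {w : EuclideanSpace ℝ (Fin m) → ℂ}, ∫⁻ x, ‖w x‖ₑ ^ 2 = eLpNorm w 2 ^ 2 := fun {w} => by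
    rw [hnorm, ← ENNReal.rpow_natCast, ← ENNReal.rpow_mul]
    norm_num
  rcases eq_or_ne (∫⁻ x, ‖v x‖ₑ ^ 2) ⊤ with htop | htop
  · rw [htop, ENNReal.mul_top (by positivity)]
    exact le_top
  have hvL : MemLp v 2 := by
    refine ⟨hv.aestronglyMeasurable, ?_⟩
    rw [hnorm]
    exact ENNReal.rpow_lt_top_of_nonneg (by norm_num) htop
  have hpos : ∀ k : ℕ, (0 : ℝ) < 1 / (k + 1) := fun k => by positivity
  choose g hgc hgs hg using fun k => hvL.exist_eLpNorm_sub_le (by norm_num) (by norm_num) (hpos k)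
  set s : ℕ → SchwartzMap (EuclideanSpace ℝ (Fin m)) ℂ := fun k => (hgc k).toSchwartzMap (hgs k)
  have hs : ∀ k, ⇑(s k) = g k := fun k => rfl
  have h0 : Filter.Tendsto (fun k : ℕ => ENNReal.ofReal (1 / ((k : ℝ) + 1))) Filter.atTop (𝓝 0) := by
    rw [← ENNReal.ofReal_zero]
    exact (ENNReal.continuous_ofReal.tendsto 0).comp tendsto_one_div_add_atTop_nhds_zero_nat
  have hgm : ∀ k, MemLp (g k) 2 := fun k => by rw [← hs]; exact (s k).memLp 2 volume
  -- The projections converge pointwise, by Cauchy–Schwarz.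
  have hptw : ∀ k x, Filter.Tendsto (fun i => freqProj R (c k) (s i) x) Filter.atTop
      (𝓝 (freqProj R (c k) v x)) := by
    intro k x
    have hψ := memLp_projKernel (a := c k) hR 2
    have htr : ∀ {w : EuclideanSpace ℝ (Fin m) → ℂ}, MemLp w 2 → MemLp (fun u => w (x + u)) 2 :=
      fun hw => hw.comp_measurePreserving (measurePreserving_add_left volume x)
    have hi : ∀ {w : EuclideanSpace ℝ (Fin m) → ℂ}, MemLp w 2 →
        Integrable (fun u => projKernel R (c k) u * w (x + u)) := fun hw =>
      hψ.integrable_mul (htr hw)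
    rw [tendsto_iff_edist_tendsto_0]
    refine tendsto_of_tendsto_of_tendsto_of_le_of_le tendsto_const_nhds
      (h := fun i : ℕ => eLpNorm (projKernel R (c k)) 2 * ENNReal.ofReal (1 / ((i : ℝ) + 1)))
      ?_ (fun _ => bot_le) fun i => ?_
    · simpa using ENNReal.Tendsto.const_mul h0 (Or.inr hψ.eLpNorm_ne_top)
    · simp only [edist_eq_enorm_sub, freqProj, hs]
      rw [← integral_sub (hi (hgm i)) (hi hvL)]
      refine (enorm_integral_le_lintegral_enorm _).trans ?_
      have h1 : ∫⁻ u, ‖projKernel R (c k) u * g i (x + u) - projKernel R (c k) u * v (x + u)‖ₑ =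
          eLpNorm (projKernel R (c k) • fun u => (g i - v) (x + u)) 1 := by
        rw [eLpNorm_one_eq_lintegral_enorm]
        simp [mul_sub]
      have htrip : ENNReal.HolderTriple 2 2 1 := ⟨by rw [ENNReal.inv_two_add_inv_two, inv_one]⟩
      rw [h1]
      refine (eLpNorm_smul_le_mul_eLpNorm (p := 2) (q := 2) (r := 1)
        (htr ((hgm i).sub hvL)).aestronglyMeasurable hψ.aestronglyMeasurable).trans ?_
      refine mul_le_mul' le_rfl ?_
      rw [show (fun u => (g i - v) (x + u)) = (g i - v) ∘ fun u => x + u from rfl,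
        eLpNorm_comp_measurePreserving ((hgm i).sub hvL).aestronglyMeasurable
          (measurePreserving_add_left volume x), eLpNorm_sub_comm]
      exact hg i
  have hmeas : ∀ i k, Measurable fun x => ‖freqProj R (c k) (s i) x‖ₑ ^ 2 := fun i k => by
    obtain ⟨w, hw, -⟩ := exists_schwartz_freqProj (a := c k) hR (s i)
    rw [hw]
    exact (w.continuous.enorm.measurable).pow_const 2
  have hmeas' : ∀ k, Measurable fun x => ‖freqProj R (c k) v x‖ₑ ^ 2 := fun k => by
    refine Measurable.pow_const (Measurable.enorm ?_) 2
    refine measurable_of_tendsto_metrizable (f := fun i => freqProj R (c k) (s i)) (fun i => ?_)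
      (tendsto_pi_nhds.2 (hptw k))
    obtain ⟨w, hw, -⟩ := exists_schwartz_freqProj (a := c k) hR (s i)
    rw [hw]
    exact w.continuous.measurable
  have hle : ∀ i, eLpNorm (g i) 2 ≤ eLpNorm v 2 + ENNReal.ofReal (1 / ((i : ℝ) + 1)) := fun i =>
    eLpNorm_le_add_of_sub_le (by norm_num) (hgm i) hvL (by rw [eLpNorm_sub_comm]; exact hg i)
  have hlim : Filter.Tendsto (fun i : ℕ => D * (eLpNorm v 2 + ENNReal.ofReal (1 / ((i : ℝ) + 1))) ^ 2)
      Filter.atTop (𝓝 (D * (eLpNorm v 2 + 0) ^ 2)) := by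
    refine ENNReal.Tendsto.const_mul (ENNReal.Tendsto.pow (tendsto_const_nhds.add h0)) (Or.inr hDt)
  rw [← lintegral_finsetSum _ fun k _ => hmeas' k]
  calc ∫⁻ x, ∑ k ∈ S, ‖freqProj R (c k) v x‖ₑ ^ 2
      = ∫⁻ x, Filter.liminf (fun i => ∑ k ∈ S, ‖freqProj R (c k) (s i) x‖ₑ ^ 2) Filter.atTop := by
        refine lintegral_congr fun x => (Filter.Tendsto.liminf_eq ?_).symm
        refine tendsto_finsetSum _ fun k _ => ENNReal.Tendsto.pow ?_
        exact (hptw k x).enorm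
    _ ≤ Filter.liminf (fun i => ∫⁻ x, ∑ k ∈ S, ‖freqProj R (c k) (s i) x‖ₑ ^ 2) Filter.atTop :=
        lintegral_liminf_le fun i => Finset.measurable_sum _ fun k _ => hmeas i k
    _ ≤ Filter.liminf (fun i : ℕ => D * (eLpNorm v 2 + ENNReal.ofReal (1 / ((i : ℝ) + 1))) ^ 2)
          Filter.atTop := by
        refine Filter.liminf_le_liminf (Filter.Eventually.of_forall fun i => ?_)
        rw [lintegral_finsetSum _ fun k _ => hmeas i k]
        refine (sum_lintegral_freqProj_schwartz_le hR S c hD (s i)).trans ?_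
        rw [hsq, hs]
        exact mul_le_mul' le_rfl (pow_le_pow_left' (hle i) 2)
    _ = D * ∫⁻ x, ‖v x‖ₑ ^ 2 := by rw [hlim.liminf_eq, add_zero, hsq]

/-! ### Frequency projections on space-time -/

/-- The frequency projection in the space variables of a function on space-time. -/
noncomputable def stProj (R : ℝ) (a : EuclideanSpace ℝ (Fin m))
    (h : EuclideanSpace ℝ (Fin m) × ℝ → ℂ) (z : EuclideanSpace ℝ (Fin m) × ℝ) : ℂ :=
  ∫ u, projKernel R a u * h (z.1 + u, z.2)

lemma measurable_stProj (hR : 0 < R) {h : EuclideanSpace ℝ (Fin m) × ℝ → ℂ} (hh : Measurable h) :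
    Measurable (stProj R a h) := by
  have h1 : StronglyMeasurable (fun w : (EuclideanSpace ℝ (Fin m) × ℝ) × EuclideanSpace ℝ (Fin m) =>
      projKernel R a w.2 * h (w.1.1 + w.2, w.1.2)) := by
    refine Measurable.stronglyMeasurable ?_
    exact ((continuous_projKernel hR).measurable.comp measurable_snd).mul
      (hh.comp (((measurable_fst.fst).add measurable_snd).prodMk measurable_fst.snd))
  exact h1.integral_prod_right'.measurable

lemma enorm_stProj_le (hR : 0 < R) {h : EuclideanSpace ℝ (Fin m) × ℝ → ℂ} {ν : ℝ≥0∞}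
    (hν : ∀ z, ‖h z‖ₑ ≤ ν) (z : EuclideanSpace ℝ (Fin m) × ℝ) :
    ‖stProj R a h z‖ₑ ≤ projConst m * ν := by
  refine (enorm_integral_le_lintegral_enorm _).trans ?_
  rw [projConst, ← lintegral_enorm_projKernel (a := a) hR,
    ← lintegral_mul_const _ (continuous_projKernel hR).enorm.measurable]
  refine lintegral_mono fun u => ?_
  rw [enorm_mul]
  exact mul_le_mul' le_rfl (hν _)

lemma lintegral_enorm_stProj_le (hR : 0 < R) {h : EuclideanSpace ℝ (Fin m) × ℝ → ℂ}
    (hh : Measurable h) :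
    ∫⁻ z, ‖stProj R a h z‖ₑ ≤ projConst m * ∫⁻ z, ‖h z‖ₑ := by
  have hm : Measurable (Function.uncurry fun (z : EuclideanSpace ℝ (Fin m) × ℝ)
      (u : EuclideanSpace ℝ (Fin m)) => ‖projKernel R a u‖ₑ * ‖h (z.1 + u, z.2)‖ₑ) :=
    ((continuous_projKernel hR).enorm.measurable.comp measurable_snd).mul
      (hh.comp (((measurable_fst.fst).add measurable_snd).prodMk measurable_fst.snd)).enorm
  calc ∫⁻ z, ‖stProj R a h z‖ₑ ≤ ∫⁻ z, ∫⁻ u, ‖projKernel R a u‖ₑ *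
        ‖h ((z : EuclideanSpace ℝ (Fin m) × ℝ).1 + u, z.2)‖ₑ := by
        refine lintegral_mono fun z => (enorm_integral_le_lintegral_enorm _).trans ?_
        simp_rw [enorm_mul]
        exact le_rfl
    _ = ∫⁻ u, ∫⁻ z, ‖projKernel R a u‖ₑ *
        ‖h ((z : EuclideanSpace ℝ (Fin m) × ℝ).1 + u, z.2)‖ₑ :=
        lintegral_lintegral_swap hm.aemeasurable
    _ = ∫⁻ u, ‖projKernel R a u‖ₑ * ∫⁻ z, ‖h z‖ₑ := by
        refine lintegral_congr fun u => ?_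
        have h2 : Measurable fun z : EuclideanSpace ℝ (Fin m) × ℝ => ‖h (z.1 + u, z.2)‖ₑ :=
          (hh.comp (((measurable_fst).add_const u).prodMk measurable_snd)).enorm
        rw [lintegral_const_mul _ h2]
        have h3 := ((measurePreserving_add_right (volume : Measure (EuclideanSpace ℝ (Fin m))) u).prod
          (MeasurePreserving.id (volume : Measure ℝ))).lintegral_comp hh.enorm
        exact congrArg _ h3
    _ = _ := by
        rw [lintegral_mul_const _ (continuous_projKernel hR).enorm.measurable,
          lintegral_enorm_projKernel hR, projConst]

lemma sum_lintegral_stProj_sq_le (hR : 0 < R) {ι : Type*} (S : Finset ι)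
    (c : ι → EuclideanSpace ℝ (Fin m)) {D : ℝ≥0∞} (hD1 : 1 ≤ D) (hDt : D ≠ ⊤)
    (hD : ∀ ξ, ∑ k ∈ S, ‖freqCutoff R (c k) ξ‖ₑ ^ 2 ≤ D)
    {h : EuclideanSpace ℝ (Fin m) × ℝ → ℂ} (hh : Measurable h) :
    ∑ k ∈ S, ∫⁻ z, ‖stProj R (c k) h z‖ₑ ^ 2 ≤ D * ∫⁻ z, ‖h z‖ₑ ^ 2 := by
  have hm : ∀ k, Measurable fun z => ‖stProj R (c k) h z‖ₑ ^ 2 := fun k =>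
    (measurable_stProj hR hh).enorm.pow_const 2
  rw [Measure.volume_eq_prod, lintegral_prod_symm' _ (hh.enorm.pow_const 2)]
  simp_rw [fun k => lintegral_prod_symm' (μ := volume) (ν := volume) _ (hm k)]
  rw [← lintegral_finsetSum _ fun k _ => (hm k).lintegral_prod_left',
    ← lintegral_const_mul _ (hh.enorm.pow_const 2).lintegral_prod_left']
  refine lintegral_mono fun t => ?_
  exact sum_lintegral_freqProj_le hR S c hD1 hDt hD (v := fun x => h (x, t))
    (hh.comp (measurable_id.prodMk measurable_const))

/-- Almost orthogonality of the frequency projections on a bounded function carried by a set of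
finite measure. This is the endpoint-free form of the interpolation between `L¹`, `L²` and `L^∞`:
on such functions logarithmic convexity of the norms is enough. -/
lemma sum_stProj_rpow_le (hR : 0 < R) {ι : Type*} (S : Finset ι)
    (c : ι → EuclideanSpace ℝ (Fin m)) {D : ℝ≥0∞} (hD1 : 1 ≤ D) (hDt : D ≠ ⊤)
    (hD : ∀ ξ, ∑ k ∈ S, ‖freqCutoff R (c k) ξ‖ₑ ^ 2 ≤ D)
    {q q' : ℝ} (hqq : q.HolderConjugate q')
    {h : EuclideanSpace ℝ (Fin m) × ℝ → ℂ} (hh : Measurable h) {ν : ℝ≥0∞}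
    {H : Set (EuclideanSpace ℝ (Fin m) × ℝ)} (hH : MeasurableSet H)
    (hν : ∀ z, ‖h z‖ₑ ≤ H.indicator (fun _ => ν) z) :
    ∑ k ∈ S, (∫⁻ z, ‖stProj R (c k) h z‖ₑ ^ q') ^ (max q q' / q') ≤
      D * (projConst m + 1) ^ (max q q') * (ν * volume H ^ (1 / q')) ^ (max q q') := by
  have hq := hqq.pos
  have hq' := hqq.symm.pos
  have hq1 := hqq.lt
  have hq'1 := hqq.symm.lt
  have hmul : q * q' = q + q' := hqq.mul_eq_add
  have hν' : ∀ z, ‖h z‖ₑ ≤ ν := fun z => (hν z).trans (Set.indicator_le_self' (by simp) z)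
  have hL1 : ∫⁻ z, ‖h z‖ₑ ≤ ν * volume H := by
    refine (lintegral_mono hν).trans ?_
    rw [lintegral_indicator_const hH]
  have hL2 : ∫⁻ z, ‖h z‖ₑ ^ 2 ≤ ν ^ 2 * volume H := by
    calc ∫⁻ z, ‖h z‖ₑ ^ 2 ≤ ∫⁻ z, ν * ‖h z‖ₑ := lintegral_mono fun z => by
          rw [sq]; exact mul_le_mul' (hν' z) le_rfl
      _ ≤ _ := by
          rw [lintegral_const_mul _ hh.enorm, sq, mul_assoc]
          exact mul_le_mul' le_rfl hL1
  have hsum := (sum_lintegral_stProj_sq_le hR S c hD1 hDt hD hh).trans (mul_le_mul' le_rfl hL2)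
  set B := projConst m + 1 with hB
  have hBt : B ≠ ⊤ := ENNReal.add_ne_top.2 ⟨(projConst_lt_top m).ne, by simp⟩
  have hB1 : 1 ≤ B := le_add_self
  have hPB : projConst m ≤ B := le_self_add
  rcases le_total 2 q' with h2 | h2
  · -- Interpolation between `L²` and `L^∞`.
    have hqle : q ≤ q' := by nlinarith
    rw [max_eq_right hqle, div_self hq'.ne']
    simp_rw [ENNReal.rpow_one]
    calc ∑ k ∈ S, ∫⁻ z, ‖stProj R (c k) h z‖ₑ ^ q'
        ≤ ∑ k ∈ S, (B * ν) ^ (q' - 2) * ∫⁻ z, ‖stProj R (c k) h z‖ₑ ^ 2 := by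
          refine Finset.sum_le_sum fun k _ => ?_
          rw [← lintegral_const_mul _ ((measurable_stProj hR hh).enorm.pow_const 2)]
          refine lintegral_mono fun z => ?_
          have h3 : ‖stProj R (c k) h z‖ₑ ≤ B * ν :=
            (enorm_stProj_le hR hν' z).trans (mul_le_mul' hPB le_rfl)
          calc ‖stProj R (c k) h z‖ₑ ^ q'
              = ‖stProj R (c k) h z‖ₑ ^ (q' - 2) * ‖stProj R (c k) h z‖ₑ ^ 2 := by
                rw [← ENNReal.rpow_natCast, ← ENNReal.rpow_add_of_nonneg _ _ (by linarith)
                  (by norm_num)]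
                norm_num
            _ ≤ _ := mul_le_mul' (ENNReal.rpow_le_rpow h3 (by linarith)) le_rfl
      _ ≤ (B * ν) ^ (q' - 2) * (D * (ν ^ 2 * volume H)) := by
          rw [← Finset.mul_sum]
          exact mul_le_mul' le_rfl hsum
      _ = D * B ^ (q' - 2) * (ν ^ (q' - 2) * ν ^ 2 * volume H) := by
          rw [ENNReal.mul_rpow_of_nonneg _ _ (by linarith)]
          ring
      _ ≤ D * B ^ q' * (ν * volume H ^ (1 / q')) ^ q' := by
          rw [ENNReal.mul_rpow_of_nonneg _ _ hq'.le, ← ENNReal.rpow_mul,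
            one_div_mul_cancel hq'.ne', ENNReal.rpow_one]
          have h4 : ν ^ (q' - 2) * ν ^ 2 = ν ^ q' := by
            rw [← ENNReal.rpow_natCast, ← ENNReal.rpow_add_of_nonneg _ _ (by linarith)
                  (by norm_num)]
            norm_num
          rw [h4]
          gcongr
          linarith
  · -- Interpolation between `L¹` and `L²`.
    have hqle : q' ≤ q := by nlinarith
    rw [max_eq_left hqle]
    have hqq1 : q / q' = q - 1 := by
      rw [div_eq_iff hq'.ne']; linarith
    have hqq2 : (q' - 1) * (q / q') = 1 := by
      rw [hqq1]; linarith
    have hint : ∀ k, ∫⁻ z, ‖stProj R (c k) h z‖ₑ ^ q' ≤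
        (∫⁻ z, ‖stProj R (c k) h z‖ₑ) ^ (2 - q') * (∫⁻ z, ‖stProj R (c k) h z‖ₑ ^ 2) ^ (q' - 1) := by
      intro k
      have hm := (measurable_stProj (a := c k) hR hh).enorm
      rcases eq_or_lt_of_le h2 with h2 | h2
      · have h5 : ∀ x : ℝ≥0∞, x ^ (2 : ℝ) = x ^ 2 := fun x => by
          rw [← ENNReal.rpow_natCast]; norm_num
        rw [h2, sub_self, ENNReal.rpow_zero, one_mul, show (2 : ℝ) - 1 = 1 by norm_num,
          ENNReal.rpow_one]
        simp_rw [h5]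
        exact le_rfl
      · have hconj : (1 / (2 - q')).HolderConjugate (1 / (q' - 1)) := by
          rw [Real.holderConjugate_iff]
          constructor
          · rw [lt_div_iff₀ (by linarith)]; linarith
          · simp; ring
        have h6 := ENNReal.lintegral_mul_le_Lp_mul_Lq volume hconj
          (f := fun z => ‖stProj R (c k) h z‖ₑ ^ (2 - q'))
          (g := fun z => (‖stProj R (c k) h z‖ₑ ^ 2) ^ (q' - 1))
          (hm.pow_const _).aemeasurable ((hm.pow_const _).pow_const _).aemeasurable
        have h7 : ∀ x : ℝ≥0∞, x ^ (2 - q') * (x ^ 2) ^ (q' - 1) = x ^ q' := fun x => by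
          rw [← ENNReal.rpow_natCast, ← ENNReal.rpow_mul, ← ENNReal.rpow_add_of_nonneg _ _
            (by linarith) (by push_cast; linarith)]
          congr 1; push_cast; ring
        have h8 : ∀ x : ℝ≥0∞, (x ^ (2 - q')) ^ (1 / (2 - q')) = x := fun x => by
          rw [← ENNReal.rpow_mul, mul_one_div_cancel (by linarith), ENNReal.rpow_one]
        have h9 : ∀ x : ℝ≥0∞, (x ^ (q' - 1)) ^ (1 / (q' - 1)) = x := fun x => by
          rw [← ENNReal.rpow_mul, mul_one_div_cancel (by linarith), ENNReal.rpow_one]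
        simp only [Pi.mul_apply, h7, h8, h9, one_div_one_div] at h6
        exact h6
    calc ∑ k ∈ S, (∫⁻ z, ‖stProj R (c k) h z‖ₑ ^ q') ^ (q / q')
        ≤ ∑ k ∈ S, (B * (ν * volume H)) ^ ((2 - q') * (q / q')) *
            ∫⁻ z, ‖stProj R (c k) h z‖ₑ ^ 2 := by
          refine Finset.sum_le_sum fun k _ => ?_
          have h10 : ∫⁻ z, ‖stProj R (c k) h z‖ₑ ≤ B * (ν * volume H) :=
            (lintegral_enorm_stProj_le hR hh).trans (mul_le_mul' hPB hL1)
          calc (∫⁻ z, ‖stProj R (c k) h z‖ₑ ^ q') ^ (q / q')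
              ≤ ((B * (ν * volume H)) ^ (2 - q') *
                  (∫⁻ z, ‖stProj R (c k) h z‖ₑ ^ 2) ^ (q' - 1)) ^ (q / q') := by
                refine ENNReal.rpow_le_rpow ((hint k).trans ?_) (by positivity)
                exact mul_le_mul' (ENNReal.rpow_le_rpow h10 (by linarith)) le_rfl
            _ = _ := by
                rw [ENNReal.mul_rpow_of_nonneg _ _ (by positivity), ← ENNReal.rpow_mul,
                  ← ENNReal.rpow_mul, hqq2, ENNReal.rpow_one]
      _ ≤ (B * (ν * volume H)) ^ ((2 - q') * (q / q')) * (D * (ν ^ 2 * volume H)) := by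
          rw [← Finset.mul_sum]
          exact mul_le_mul' le_rfl hsum
      _ = D * B ^ ((2 - q') * (q / q')) * ((ν ^ ((2 - q') * (q / q')) * ν ^ 2) *
            (volume H ^ ((2 - q') * (q / q')) * volume H)) := by
          have h11 : 0 ≤ (2 - q') * (q / q') := mul_nonneg (by linarith) (by positivity)
          rw [ENNReal.mul_rpow_of_nonneg _ _ h11, ENNReal.mul_rpow_of_nonneg _ _ h11]
          ring
      _ ≤ D * B ^ q * (ν * volume H ^ (1 / q')) ^ q := by
          have h11 : 0 ≤ (2 - q') * (q / q') := mul_nonneg (by linarith) (by positivity)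
          have h12 : (2 - q') * (q / q') + 2 = q := by rw [hqq1]; nlinarith
          have h13 : (2 - q') * (q / q') + 1 = 1 / q' * q := by
            rw [one_div_mul_eq_div, hqq1]; nlinarith
          have h14 : ν ^ ((2 - q') * (q / q')) * ν ^ 2 = ν ^ q := by
            rw [← ENNReal.rpow_natCast, ← ENNReal.rpow_add_of_nonneg _ _ h11 (by norm_num)]
            exact_mod_cast congrArg (fun x => ν ^ x) h12
          have h15 : volume H ^ ((2 - q') * (q / q')) * volume H = volume H ^ (1 / q' * q) := by
            nth_rewrite 2 [← ENNReal.rpow_one (volume H)]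
            rw [← ENNReal.rpow_add_of_nonneg _ _ h11 (by norm_num), h13]
          rw [h14, h15, ENNReal.mul_rpow_of_nonneg _ _ hq.le, ← ENNReal.rpow_mul]
          gcongr
          linarith

end

/-! ### Almost orthogonality of products of extensions -/

section

variable {m : ℕ} {R : ℝ} {a : EuclideanSpace ℝ (Fin m)}

lemma phaseKernel_sub_left (Φ : EuclideanSpace ℝ (Fin m) → ℝ) (x u : EuclideanSpace ℝ (Fin m))
    (t : ℝ) (y : EuclideanSpace ℝ (Fin m)) :
    phaseKernel Φ (x - u, t) y =
      Complex.exp (((2 * Real.pi * inner ℝ u y : ℝ) : ℂ) * Complex.I) * phaseKernel Φ (x, t) y := by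
  unfold phaseKernel
  rw [← Complex.exp_add]
  congr 1
  simp only [inner_sub_left]
  push_cast
  ring

/-- A product of extensions whose frequencies lie in the cube `|R ξ - a| ≤ 1` is reproduced by
convolution with the projection kernel of that cube. -/
lemma integral_projKernel_mul_translate (hR : 0 < R) {Φ : EuclideanSpace ℝ (Fin m) → ℝ}
    (hΦ : Measurable Φ) {f g : EuclideanSpace ℝ (Fin m) → ℂ}
    (hf : IntegrableOn f (unitCube m)) (hg : IntegrableOn g (unitCube m))
    (hfg : ∀ y y', f y ≠ 0 → g y' ≠ 0 → ∀ i, |R * (y i + y' i) - a i| ≤ 1)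
    (z : EuclideanSpace ℝ (Fin m) × ℝ) :
    ∫ u, projKernel R a u * (adjointRestriction Φ f (z.1 - u, z.2) *
      adjointRestriction Φ g (z.1 - u, z.2)) =
      adjointRestriction Φ f z * adjointRestriction Φ g z := by
  set μ := (volume : Measure (EuclideanSpace ℝ (Fin m))).restrict (unitCube m) with hμ
  set G : EuclideanSpace ℝ (Fin m) × EuclideanSpace ℝ (Fin m) → ℂ := fun w =>
    (phaseKernel Φ z w.1 * f w.1) * (phaseKernel Φ z w.2 * g w.2) with hG
  have hGi : Integrable G (μ.prod μ) :=
    (integrable_phaseKernel_mul hΦ hf z).mul_prod (integrable_phaseKernel_mul hΦ hg z)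
  set e : EuclideanSpace ℝ (Fin m) → EuclideanSpace ℝ (Fin m) → ℂ := fun u ξ =>
    Complex.exp (((2 * Real.pi * inner ℝ u ξ : ℝ) : ℂ) * Complex.I) with he
  have hec : Continuous fun x : EuclideanSpace ℝ (Fin m) ×
      (EuclideanSpace ℝ (Fin m) × EuclideanSpace ℝ (Fin m)) => e x.1 (x.2.1 + x.2.2) := by
    simp only [he]
    fun_prop
  have henorm : ∀ u ξ, ‖e u ξ‖ = 1 := fun u ξ => Complex.norm_exp_ofReal_mul_I _
  have hprod : ∀ u, adjointRestriction Φ f (z.1 - u, z.2) * adjointRestriction Φ g (z.1 - u, z.2) =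
      ∫ w, e u (w.1 + w.2) * G w ∂(μ.prod μ) := by
    intro u
    rw [adjointRestriction_eq, adjointRestriction_eq, ← integral_prod_mul]
    congr 1
    ext w
    simp only [phaseKernel_sub_left, hG, he]
    rw [inner_add_right, mul_add]
    push_cast
    rw [add_mul, Complex.exp_add]
    ring
  have hswap : Integrable (Function.uncurry fun (u : EuclideanSpace ℝ (Fin m))
      (w : EuclideanSpace ℝ (Fin m) × EuclideanSpace ℝ (Fin m)) =>
      projKernel R a u * (e u (w.1 + w.2) * G w)) (volume.prod (μ.prod μ)) := by
    have h1 := (integrable_projKernel (a := a) hR).mul_prod hGi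
    have h3 := h1.bdd_mul (c := 1) hec.aestronglyMeasurable
      (Filter.Eventually.of_forall fun x => (henorm _ _).le)
    refine h3.congr (Filter.Eventually.of_forall fun x => ?_)
    exact mul_left_comm _ _ _
  simp_rw [hprod, ← integral_const_mul]
  rw [integral_integral_swap hswap]
  have hzz : adjointRestriction Φ f z * adjointRestriction Φ g z = ∫ w, G w ∂(μ.prod μ) := by
    rw [adjointRestriction_eq, adjointRestriction_eq, ← integral_prod_mul]
  rw [hzz]
  congr 1
  ext w
  have h2 : ∫ u, projKernel R a u * (e u (w.1 + w.2) * G w) = freqCutoff R a (w.1 + w.2) * G w := by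
    rw [← integral_exp_mul_projKernel hR, ← integral_mul_const]
    congr 1
    ext u
    simp only [he]
    ring
  rw [h2]
  by_cases hw : f w.1 = 0 ∨ g w.2 = 0
  · have : G w = 0 := by
      rcases hw with hw | hw <;> simp [hG, hw]
    simp [this]
  · rw [not_or] at hw
    rw [freqCutoff_eq_one (fun i => by simpa using hfg w.1 w.2 hw.1 hw.2 i), one_mul]

/-- If `F` is reproduced by convolution with the projection kernel, then the projection may be moved
to the function against which `F` is tested. -/
lemma integral_mul_stProj (hR : 0 < R) {F h : EuclideanSpace ℝ (Fin m) × ℝ → ℂ}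
    (hF : Continuous F) {K : ℝ} (hK : ∀ z, ‖F z‖ ≤ K) (hh : Measurable h) (hhi : Integrable h)
    (hrep : ∀ z, ∫ u, projKernel R a u * F (z.1 - u, z.2) = F z) :
    ∫ z, F z * h z = ∫ z, F z * stProj R a h z := by
  have hψ := integrable_projKernel (a := a) hR
  have hψc := continuous_projKernel (a := a) hR
  have hsh : Continuous fun w : (EuclideanSpace ℝ (Fin m) × ℝ) × EuclideanSpace ℝ (Fin m) =>
      F (w.1.1 - w.2, w.1.2) := hF.comp (by fun_prop)
  have h1 : Integrable (Function.uncurry fun (z : EuclideanSpace ℝ (Fin m) × ℝ)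
      (u : EuclideanSpace ℝ (Fin m)) => projKernel R a u * F (z.1 - u, z.2) * h z)
      (volume.prod volume) := by
    refine ((hhi.mul_prod hψ).bdd_mul (c := K) (f := fun w => F (w.1.1 - w.2, w.1.2))
      hsh.aestronglyMeasurable (Filter.Eventually.of_forall fun w => hK _)).congr
      (Filter.Eventually.of_forall fun w => ?_)
    simp only [Function.uncurry_def]; ring
  have h2 : Integrable (Function.uncurry fun (z : EuclideanSpace ℝ (Fin m) × ℝ)
      (u : EuclideanSpace ℝ (Fin m)) => F z * (projKernel R a u * h (z.1 + u, z.2)))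
      (volume.prod volume) := by
    have hmeas : Measurable fun w : (EuclideanSpace ℝ (Fin m) × ℝ) × EuclideanSpace ℝ (Fin m) =>
        projKernel R a w.2 * h (w.1.1 + w.2, w.1.2) :=
      (hψc.measurable.comp measurable_snd).mul
        (hh.comp (((measurable_fst.fst).add measurable_snd).prodMk measurable_fst.snd))
    have h3 : Integrable (fun w : (EuclideanSpace ℝ (Fin m) × ℝ) × EuclideanSpace ℝ (Fin m) =>
        projKernel R a w.2 * h (w.1.1 + w.2, w.1.2)) (volume.prod volume) := by
      rw [integrable_prod_iff' hmeas.aestronglyMeasurable]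
      have htr : ∀ u : EuclideanSpace ℝ (Fin m), MeasurePreserving
          (fun z : EuclideanSpace ℝ (Fin m) × ℝ => (z.1 + u, z.2)) volume volume := fun u =>
        (measurePreserving_add_right volume u).prod (MeasurePreserving.id volume)
      refine ⟨Filter.Eventually.of_forall fun u => ?_, ?_⟩
      · exact Integrable.const_mul (f := fun z : EuclideanSpace ℝ (Fin m) × ℝ =>
          h (z.1 + u, z.2)) ((htr u).integrable_comp_of_integrable hhi) (projKernel R a u)
      · have h4 : ∀ u : EuclideanSpace ℝ (Fin m), ∫ z : EuclideanSpace ℝ (Fin m) × ℝ,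
            ‖projKernel R a u * h (z.1 + u, z.2)‖ = ‖projKernel R a u‖ * ∫ z, ‖h z‖ := fun u => by
          simp_rw [norm_mul]
          rw [integral_const_mul]
          congr 1
          have h5 : MeasurableEmbedding fun z : EuclideanSpace ℝ (Fin m) × ℝ => (z.1 + u, z.2) :=
            (measurableEmbedding_addRight u).prodMap MeasurableEmbedding.id
          exact (htr u).integral_comp h5 fun z => ‖h z‖
        simp_rw [h4]
        exact hψ.norm.mul_const _
    exact h3.bdd_mul (c := K) (f := fun w => F w.1) (hF.comp continuous_fst).aestronglyMeasurable
      (Filter.Eventually.of_forall fun w => hK _)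
  calc ∫ z, F z * h z = ∫ z, ∫ u, projKernel R a u * F (z.1 - u, z.2) * h z := by
        congr 1; ext z
        rw [integral_mul_const, hrep]
    _ = ∫ u, ∫ z : EuclideanSpace ℝ (Fin m) × ℝ, projKernel R a u * F (z.1 - u, z.2) * h z :=
        integral_integral_swap h1
    _ = ∫ u, ∫ z : EuclideanSpace ℝ (Fin m) × ℝ, F z * (projKernel R a u * h (z.1 + u, z.2)) := by
        congr 1; ext u
        have htr : MeasurePreserving
            (fun z : EuclideanSpace ℝ (Fin m) × ℝ => (z.1 + u, z.2)) volume volume :=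
          (measurePreserving_add_right volume u).prod (MeasurePreserving.id volume)
        have h5 : MeasurableEmbedding fun z : EuclideanSpace ℝ (Fin m) × ℝ => (z.1 + u, z.2) :=
          (measurableEmbedding_addRight u).prodMap MeasurableEmbedding.id
        rw [← htr.integral_comp h5]
        congr 1; ext z
        simp only [add_sub_cancel_right]
        ring
    _ = ∫ z, ∫ u, F z * (projKernel R a u * h (z.1 + u, z.2)) := (integral_integral_swap h2).symm
    _ = _ := by
        congr 1; ext z
        rw [integral_const_mul, stProj]

lemma ENNReal.sum_rpow_le_sum_rpow_rpow {ι : Type*} (S : Finset ι) (X : ι → ℝ≥0∞) {s r : ℝ}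
    (hs : 0 < s) (hsr : s ≤ r) : (∑ k ∈ S, X k ^ r) ^ (1 / r) ≤ (∑ k ∈ S, X k ^ s) ^ (1 / s) := by
  have hr : 0 < r := by linarith
  set T := ∑ k ∈ S, X k ^ s with hT
  have h0 : 0 ≤ (r - s) / s := div_nonneg (by linarith) hs.le
  have h1 : ∀ k ∈ S, X k ^ r ≤ X k ^ s * T ^ ((r - s) / s) := fun k hk => by
    calc X k ^ r = X k ^ s * (X k ^ s) ^ ((r - s) / s) := by
          rw [← ENNReal.rpow_mul, ← ENNReal.rpow_add_of_nonneg _ _ hs.le (mul_nonneg hs.le h0)]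
          congr 1
          field_simp
          ring
      _ ≤ _ := mul_le_mul' le_rfl (ENNReal.rpow_le_rpow
          (Finset.single_le_sum (f := fun k => X k ^ s) (fun _ _ => bot_le) hk) h0)
  calc (∑ k ∈ S, X k ^ r) ^ (1 / r) ≤ (T * T ^ ((r - s) / s)) ^ (1 / r) := by
        refine ENNReal.rpow_le_rpow ((Finset.sum_le_sum h1).trans ?_) (by positivity)
        rw [← Finset.sum_mul]
    _ = T ^ (1 / s) := by
        nth_rewrite 1 [← ENNReal.rpow_one T]
        rw [← ENNReal.rpow_add_of_nonneg _ _ zero_le_one h0, ← ENNReal.rpow_mul]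
        congr 1
        field_simp
        ring

/-- Testing a single product of extensions against a function: the test function may be replaced
by its frequency projection. -/
lemma enorm_integral_mul_le_stProj (hR : 0 < R) {q q' : ℝ} (hqq : q.HolderConjugate q')
    {F h : EuclideanSpace ℝ (Fin m) × ℝ → ℂ} (hF : Continuous F) {K : ℝ} (hK : ∀ z, ‖F z‖ ≤ K)
    (hh : Measurable h) (hhi : Integrable h)
    (hrep : ∀ z, ∫ u, projKernel R a u * F (z.1 - u, z.2) = F z) :
    ‖∫ z, F z * h z‖ₑ ≤ eLpNorm F (ENNReal.ofReal q) *
      (∫⁻ z, ‖stProj R a h z‖ₑ ^ q') ^ (1 / q') := by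
  have hq := hqq.pos
  rw [eLpNorm_eq_lintegral_rpow_enorm_toReal (by simpa using hq) (by simp),
    ENNReal.toReal_ofReal hq.le, integral_mul_stProj hR hF hK hh hhi hrep]
  refine (enorm_integral_le_lintegral_enorm _).trans ?_
  simp_rw [enorm_mul]
  exact ENNReal.lintegral_mul_le_Lp_mul_Lq volume hqq hF.enorm.aemeasurable
    (measurable_stProj hR hh).enorm.aemeasurable

lemma ENNReal.sum_mul_le_of_sum_rpow_le {ι : Type*} (S : Finset ι) (X Y : ι → ℝ≥0∞)
    {r r' s : ℝ} (hrr : r.HolderConjugate r') (hs : 0 < s) (hsr : s ≤ r) {D P V : ℝ≥0∞}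
    (hY : ∑ k ∈ S, Y k ^ r' ≤ D * P ^ r' * V ^ r') :
    ∑ k ∈ S, X k * Y k ≤ D ^ (1 / r') * P * (∑ k ∈ S, X k ^ s) ^ (1 / s) * V := by
  have hr' := hrr.symm.pos
  have h0 : 0 ≤ 1 / r' := by positivity
  calc ∑ k ∈ S, X k * Y k ≤ (∑ k ∈ S, X k ^ r) ^ (1 / r) * (∑ k ∈ S, Y k ^ r') ^ (1 / r') :=
        ENNReal.inner_le_Lp_mul_Lq S _ _ hrr
    _ ≤ (∑ k ∈ S, X k ^ s) ^ (1 / s) * (D * P ^ r' * V ^ r') ^ (1 / r') :=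
        mul_le_mul' (ENNReal.sum_rpow_le_sum_rpow_rpow S _ hs hsr) (ENNReal.rpow_le_rpow hY h0)
    _ = _ := by
        rw [ENNReal.mul_rpow_of_nonneg _ _ h0, ENNReal.mul_rpow_of_nonneg _ _ h0,
          ← ENNReal.rpow_mul, ← ENNReal.rpow_mul, mul_one_div_cancel hr'.ne', ENNReal.rpow_one,
          ENNReal.rpow_one]
        ring

lemma Real.HolderConjugate.min_max {q q' : ℝ} (hqq : q.HolderConjugate q') :
    (min q q').HolderConjugate (max q q') := by
  rcases le_total q q' with hle | hle
  · rw [min_eq_left hle, max_eq_right hle]; exact hqq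
  · rw [min_eq_right hle, max_eq_left hle]; exact hqq.symm

/-- Testing a family of products of extensions with almost disjoint frequency cubes against a
bounded function carried by a set of finite measure. -/
lemma sum_enorm_integral_mul_le (hR : 0 < R) {ι : Type*} (S : Finset ι)
    (c : ι → EuclideanSpace ℝ (Fin m)) {D : ℝ≥0∞} (hD1 : 1 ≤ D) (hDt : D ≠ ⊤)
    (hD : ∀ ξ, ∑ k ∈ S, ‖freqCutoff R (c k) ξ‖ₑ ^ 2 ≤ D)
    {q q' s : ℝ} (hqq : q.HolderConjugate q') (hs : 0 < s) (hsq : s ≤ min q q')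
    {F : ι → EuclideanSpace ℝ (Fin m) × ℝ → ℂ} (hF : ∀ k, Continuous (F k)) {K : ℝ}
    (hK : ∀ k z, ‖F k z‖ ≤ K)
    (hrep : ∀ k ∈ S, ∀ z, ∫ u, projKernel R (c k) u * F k (z.1 - u, z.2) = F k z)
    {h : EuclideanSpace ℝ (Fin m) × ℝ → ℂ} (hh : Measurable h) {ν : ℝ≥0∞} (hνt : ν ≠ ⊤)
    {H : Set (EuclideanSpace ℝ (Fin m) × ℝ)} (hH : MeasurableSet H) (hHt : volume H ≠ ⊤)
    (hν : ∀ z, ‖h z‖ₑ ≤ H.indicator (fun _ => ν) z) :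
    ∑ k ∈ S, ‖∫ z, F k z * h z‖ₑ ≤ D ^ (1 / max q q') * (projConst m + 1) *
      (∑ k ∈ S, eLpNorm (F k) (ENNReal.ofReal q) ^ s) ^ (1 / s) * (ν * volume H ^ (1 / q')) := by
  have hhi : Integrable h := by
    refine ⟨hh.aestronglyMeasurable, ?_⟩
    refine (lintegral_mono hν).trans_lt ?_
    rw [lintegral_indicator_const hH]
    exact ENNReal.mul_lt_top hνt.lt_top hHt.lt_top
  refine (Finset.sum_le_sum fun k hk =>
    enorm_integral_mul_le_stProj hR hqq (hF k) (hK k) hh hhi (hrep k hk)).trans ?_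
  refine ENNReal.sum_mul_le_of_sum_rpow_le S _ _ hqq.min_max hs hsq ?_
  refine le_trans (le_of_eq ?_) (sum_stProj_rpow_le hR S c hD1 hDt hD hqq hh hH hν)
  refine Finset.sum_congr rfl fun k _ => ?_
  rw [← ENNReal.rpow_mul, one_div_mul_eq_div]

end

/-! ### Dyadic cubes and Whitney pairs -/

section

variable {m : ℕ}

/-- The index `k` of the dyadic cube `2 ^ (-j) • (k + [0, 1)^m)` which contains `y`. -/
noncomputable def dyadicIndex (j : ℕ) (y : EuclideanSpace ℝ (Fin m)) : Fin m → ℤ :=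
  fun i => ⌊(2 : ℝ) ^ j * y i⌋

/-- The index of the dyadic parent. -/
def parentIndex (k : Fin m → ℤ) : Fin m → ℤ := fun i => k i / 2

/-- Two dyadic cubes of the same scale are near if their closures meet. -/
def IsNear (k k' : Fin m → ℤ) : Prop := ∀ i, |k i - k' i| ≤ 1

instance (k k' : Fin m → ℤ) : Decidable (IsNear k k') := by
  unfold IsNear; infer_instance

/-- The indices of the dyadic cubes of side `2 ^ (-j)` which tile `[-1, 1)^m`. -/
noncomputable def boxIndices (m j : ℕ) : Finset (Fin m → ℤ) :=
  Fintype.piFinset fun _ => Finset.Ico (-2 ^ j) (2 ^ j)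

/-- The pairs of dyadic subcubes of `[-1, 1)^m` of side `2 ^ (-(j + 1))` which are not near, but
whose parents are. -/
noncomputable def whitneyPairs (m j : ℕ) : Finset ((Fin m → ℤ) × (Fin m → ℤ)) :=
  (boxIndices m (j + 1) ×ˢ boxIndices m (j + 1)).filter fun p =>
    IsNear (parentIndex p.1) (parentIndex p.2) ∧ ¬ IsNear p.1 p.2

lemma mem_whitneyPairs {j : ℕ} {p : (Fin m → ℤ) × (Fin m → ℤ)} :
    p ∈ whitneyPairs m j ↔ (p.1 ∈ boxIndices m (j + 1) ∧ p.2 ∈ boxIndices m (j + 1)) ∧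
      IsNear (parentIndex p.1) (parentIndex p.2) ∧ ¬ IsNear p.1 p.2 := by
  rw [whitneyPairs, Finset.mem_filter, Finset.mem_product]

lemma IsNear.parentIndex {k k' : Fin m → ℤ} (h : IsNear k k') :
    IsNear (parentIndex k) (parentIndex k') := fun i => by
  have := abs_le.1 (h i)
  simp only [_root_.parentIndex]
  rw [abs_le]
  omega

lemma parentIndex_dyadicIndex (j : ℕ) (y : EuclideanSpace ℝ (Fin m)) :
    parentIndex (dyadicIndex (j + 1) y) = dyadicIndex j y := by
  ext i
  simp only [parentIndex, dyadicIndex]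
  have h1 := Int.floor_le ((2 : ℝ) ^ j * y i)
  have h2 := Int.lt_floor_add_one ((2 : ℝ) ^ j * y i)
  set a := ⌊(2 : ℝ) ^ j * y i⌋
  have h3 : 2 * a ≤ ⌊(2 : ℝ) ^ (j + 1) * y i⌋ := Int.le_floor.2 (by push_cast; rw [pow_succ]; linarith)
  have h4 : ⌊(2 : ℝ) ^ (j + 1) * y i⌋ < 2 * a + 2 :=
    Int.floor_lt.2 (by push_cast; rw [pow_succ]; linarith)
  omega

lemma dyadicIndex_mem_boxIndices (j : ℕ) {y : EuclideanSpace ℝ (Fin m)} (hy : ∀ i, |y i| < 1) :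
    dyadicIndex j y ∈ boxIndices m j := by
  rw [boxIndices, Fintype.mem_piFinset]
  intro i
  have h := abs_lt.1 (hy i)
  have hp : (0 : ℝ) < 2 ^ j := by positivity
  rw [Finset.mem_Ico]
  refine ⟨Int.le_floor.2 (by push_cast; nlinarith), Int.floor_lt.2 (by push_cast; nlinarith)⟩

lemma IsNear.of_le {y y' : EuclideanSpace ℝ (Fin m)} {j j' : ℕ} (hj : j ≤ j')
    (h : IsNear (dyadicIndex j' y) (dyadicIndex j' y')) :
    IsNear (dyadicIndex j y) (dyadicIndex j y') := by
  induction j', hj using Nat.le_induction with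
  | base => exact h
  | succ k _ ih =>
    apply ih
    simpa only [parentIndex_dyadicIndex] using h.parentIndex

lemma eq_of_forall_isNear {y y' : EuclideanSpace ℝ (Fin m)}
    (h : ∀ j, IsNear (dyadicIndex j y) (dyadicIndex j y')) : y = y' := by
  ext i
  by_contra hne
  have hpos : 0 < |y i - y' i| := abs_pos.2 (sub_ne_zero.2 hne)
  obtain ⟨j, hj⟩ := pow_unbounded_of_one_lt (2 / |y i - y' i|) (one_lt_two (α := ℝ))
  have h1 : 2 < 2 ^ j * |y i - y' i| := by rwa [div_lt_iff₀ hpos] at hj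
  have h2 := abs_le.1 (h j i)
  simp only [dyadicIndex] at h2
  have h3 : |(2 : ℝ) ^ j * y i - 2 ^ j * y' i| < 2 := by
    have a1 := Int.floor_le ((2 : ℝ) ^ j * y i)
    have a2 := Int.lt_floor_add_one ((2 : ℝ) ^ j * y i)
    have a3 := Int.floor_le ((2 : ℝ) ^ j * y' i)
    have a4 := Int.lt_floor_add_one ((2 : ℝ) ^ j * y' i)
    have b1 : (-1 : ℝ) ≤ (⌊(2 : ℝ) ^ j * y i⌋ - ⌊(2 : ℝ) ^ j * y' i⌋ : ℝ) := by exact_mod_cast h2.1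
    have b2 : (⌊(2 : ℝ) ^ j * y i⌋ - ⌊(2 : ℝ) ^ j * y' i⌋ : ℝ) ≤ 1 := by exact_mod_cast h2.2
    rw [abs_lt]
    constructor <;> linarith
  rw [← mul_sub, abs_mul, abs_of_pos (by positivity : (0 : ℝ) < 2 ^ j)] at h3
  linarith

/-- Off the diagonal the open cube is covered by Whitney pairs. -/
lemma exists_mem_whitneyPairs {y y' : EuclideanSpace ℝ (Fin m)} (hy : ∀ i, |y i| < 1)
    (hy' : ∀ i, |y' i| < 1) (hne : y ≠ y') :
    ∃ j, (dyadicIndex (j + 1) y, dyadicIndex (j + 1) y') ∈ whitneyPairs m j := by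
  classical
  have hex : ∃ j, ¬ IsNear (dyadicIndex j y) (dyadicIndex j y') := by
    by_contra! hcon
    exact hne (eq_of_forall_isNear hcon)
  have h0 : IsNear (dyadicIndex 0 y) (dyadicIndex 0 y') := fun i => by
    have h1 := Finset.mem_Ico.1 (Fintype.mem_piFinset.1 (dyadicIndex_mem_boxIndices 0 hy) i)
    have h2 := Finset.mem_Ico.1 (Fintype.mem_piFinset.1 (dyadicIndex_mem_boxIndices 0 hy') i)
    rw [abs_le]
    norm_num at h1 h2
    omega
  obtain ⟨j, hj⟩ : ∃ j, Nat.find hex = j + 1 := by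
    refine Nat.exists_eq_succ_of_ne_zero fun hz => ?_
    have := Nat.find_spec hex
    rw [hz] at this
    exact this h0
  refine ⟨j, ?_⟩
  rw [mem_whitneyPairs]
  refine ⟨⟨dyadicIndex_mem_boxIndices _ hy, dyadicIndex_mem_boxIndices _ hy'⟩, ?_, ?_⟩
  · rw [parentIndex_dyadicIndex, parentIndex_dyadicIndex]
    exact not_not.1 (Nat.find_min hex (by omega))
  · rw [← hj]
    exact Nat.find_spec hex

lemma eq_of_mem_whitneyPairs {y y' : EuclideanSpace ℝ (Fin m)} {j j' : ℕ}
    (h : (dyadicIndex (j + 1) y, dyadicIndex (j + 1) y') ∈ whitneyPairs m j)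
    (h' : (dyadicIndex (j' + 1) y, dyadicIndex (j' + 1) y') ∈ whitneyPairs m j') : j = j' := by
  simp only [mem_whitneyPairs, parentIndex_dyadicIndex] at h h'
  rcases lt_trichotomy j j' with hlt | heq | hlt
  · exact absurd (h'.2.1.of_le hlt) h.2.2
  · exact heq
  · exact absurd (h.2.1.of_le hlt) h'.2.2

lemma measurable_dyadicIndex (j : ℕ) :
    Measurable (dyadicIndex j : EuclideanSpace ℝ (Fin m) → Fin m → ℤ) := by
  refine measurable_pi_lambda _ fun i => Int.measurable_floor.comp ?_
  fun_prop

lemma volume_dyadicIndex_preimage_le (j : ℕ) (k : Fin m → ℤ) :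
    volume (dyadicIndex j ⁻¹' {k} : Set (EuclideanSpace ℝ (Fin m))) ≤ 2 ^ (-((m : ℝ) * j)) := by
  have h1 : (dyadicIndex j ⁻¹' {k} : Set (EuclideanSpace ℝ (Fin m))) ⊆ WithLp.ofLp ⁻¹'
      (Set.pi Set.univ fun i => Set.Ico ((k i : ℝ) / 2 ^ j) ((k i + 1 : ℝ) / 2 ^ j)) := by
    intro y hy i _
    have hk : ⌊(2 : ℝ) ^ j * y i⌋ = k i := congrFun hy i
    have hp : (0 : ℝ) < 2 ^ j := by positivity
    have a1 := Int.floor_le ((2 : ℝ) ^ j * y i)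
    have a2 := Int.lt_floor_add_one ((2 : ℝ) ^ j * y i)
    rw [hk] at a1 a2
    exact ⟨(div_le_iff₀ hp).2 (by linarith), (lt_div_iff₀ hp).2 (by linarith)⟩
  refine (measure_mono h1).trans ?_
  rw [(PiLp.volume_preserving_ofLp (Fin m)).measure_preimage
    (MeasurableSet.univ_pi fun i => measurableSet_Ico).nullMeasurableSet, Real.volume_pi_Ico]
  have h2 : ∀ i, ENNReal.ofReal ((k i + 1 : ℝ) / 2 ^ j - (k i : ℝ) / 2 ^ j) = 2 ^ (-(j : ℝ)) := by
    intro i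
    rw [← sub_div, add_sub_cancel_left, two_rpow_neg_natCast, one_div,
      ENNReal.ofReal_inv_of_pos (by positivity), ENNReal.ofReal_pow (by norm_num), ENNReal.inv_pow]
    simp
  simp_rw [h2]
  rw [Finset.prod_const, Finset.card_univ, Fintype.card_fin, ← ENNReal.rpow_natCast,
    ← ENNReal.rpow_mul]
  refine le_of_eq ?_
  congr 1
  ring

/-- A Whitney pair of side `2 ^ (-(j + 1))` fits into a subcube of `Q` of half side `2 ^ (-j)`.
After rescaling that subcube to `Q`, the pair becomes a pair of cubes of side `1 / 2` at distance at
least `1 / 2`. -/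
lemma exists_rescaled_of_mem_whitneyPairs {j : ℕ} {p : (Fin m → ℤ) × (Fin m → ℤ)}
    (hp : p ∈ whitneyPairs m j) :
    ∃ c c₁ c₂ : EuclideanSpace ℝ (Fin m), cube c (2⁻¹ ^ j) ⊆ unitCube m ∧
      SeparatedSubcubes (1 / 2) c₁ (1 / 4) c₂ (1 / 4) ∧
      (∀ Y, dyadicIndex (j + 1) (c + (2⁻¹ : ℝ) ^ j • Y) = p.1 → Y ∈ cube c₁ (1 / 4)) ∧
      ∀ Y, dyadicIndex (j + 1) (c + (2⁻¹ : ℝ) ^ j • Y) = p.2 → Y ∈ cube c₂ (1 / 4) := by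
  obtain ⟨k, k'⟩ := p
  simp only [mem_whitneyPairs, boxIndices, Fintype.mem_piFinset, Finset.mem_Ico, IsNear,
    parentIndex] at hp
  obtain ⟨⟨hk, hk'⟩, hnear, hfar⟩ := hp
  have hZ : (1 : ℤ) ≤ 2 ^ j := one_le_pow₀ (by norm_num)
  -- The lower corner of the common subcube, in units of its half side.
  set K : Fin m → ℤ := fun i => min (min (k i / 2) (k' i / 2)) (2 ^ j - 2) with hK
  have hK1 : ∀ i, -2 ^ j ≤ K i ∧ K i + 2 ≤ 2 ^ j ∧ 2 * K i ≤ k i ∧ k i + 1 ≤ 2 * K i + 4 ∧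
      2 * K i ≤ k' i ∧ k' i + 1 ≤ 2 * K i + 4 := fun i => by
    have h1 := hk i
    have h2 := hk' i
    have h3 := abs_le.1 (hnear i)
    rw [pow_succ] at h1 h2
    simp only [hK]
    omega
  have hr : (0 : ℝ) < 2⁻¹ ^ j := by positivity
  have hr2 : (2 : ℝ)⁻¹ ^ j * 2 ^ j = 1 := by rw [← mul_pow]; norm_num
  have hsub : ∀ l : Fin m → ℤ, (∀ i, 2 * K i ≤ l i ∧ l i + 1 ≤ 2 * K i + 4) →
      cube (WithLp.toLp 2 fun i => (l i + 1 / 2 : ℝ) / 2 - (K i + 1)) (1 / 4) ⊆ unitCube m := by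
    intro l hl x hx i
    have h1 := abs_le.1 (hx i)
    have h2 : (2 * K i : ℝ) ≤ l i := by exact_mod_cast (hl i).1
    have h3 : (l i + 1 : ℝ) ≤ 2 * K i + 4 := by exact_mod_cast (hl i).2
    simp only [PiLp.zero_apply, sub_zero] at h1 ⊢
    rw [abs_le]
    constructor <;> linarith
  have hmem : ∀ l : Fin m → ℤ, ∀ Y : EuclideanSpace ℝ (Fin m),
      dyadicIndex (j + 1) ((WithLp.toLp 2 fun i => (2⁻¹ : ℝ) ^ j * (K i + 1)) + (2⁻¹ : ℝ) ^ j • Y) =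
        l → Y ∈ cube (WithLp.toLp 2 fun i => (l i + 1 / 2 : ℝ) / 2 - (K i + 1)) (1 / 4) := by
    intro l Y hY i
    have h1 : ⌊(2 : ℝ) ^ (j + 1) * ((2⁻¹ : ℝ) ^ j * (K i + 1) + 2⁻¹ ^ j * Y i)⌋ = l i := by
      simpa [dyadicIndex] using congrFun hY i
    have h2 : (2 : ℝ) ^ (j + 1) * ((2⁻¹ : ℝ) ^ j * (K i + 1) + 2⁻¹ ^ j * Y i) =
        2 * (K i + 1 + Y i) := by
      rw [pow_succ]
      linear_combination (2 * (K i + 1 + Y i)) * hr2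
    rw [h2, Int.floor_eq_iff] at h1
    simp only
    rw [abs_le]
    constructor <;> linarith [h1.1, h1.2]
  refine ⟨WithLp.toLp 2 fun i => (2⁻¹ : ℝ) ^ j * (K i + 1), _, _, ?_, ?_, hmem k, hmem k'⟩
  · intro x hx i
    have h1 := abs_le.1 (hx i)
    have h2 : (-2 ^ j : ℝ) ≤ K i := by exact_mod_cast (hK1 i).1
    have h3 : (K i + 2 : ℝ) ≤ 2 ^ j := by exact_mod_cast (hK1 i).2.1
    simp only [PiLp.zero_apply, sub_zero] at h1 ⊢
    rw [abs_le]
    constructor <;> nlinarith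
  · refine ⟨hsub k fun i => ⟨(hK1 i).2.2.1, (hK1 i).2.2.2.1⟩,
      hsub k' fun i => (hK1 i).2.2.2.2, by norm_num, by norm_num, fun x hx y hy => ?_⟩
    push Not at hfar
    obtain ⟨i, hi⟩ := hfar
    have h1 := abs_le.1 (hx i)
    have h2 := abs_le.1 (hy i)
    simp only at h1 h2
    have h3 : |x i - y i| ≤ dist x y := by
      rw [dist_eq_norm]
      exact abs_apply_le_norm (x - y) i
    refine le_trans ?_ h3
    have h4 : (2 : ℤ) ≤ |k i - k' i| := hi
    rcases le_abs.1 h4 with h5 | h5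
    · have h6 : (2 : ℝ) ≤ k i - k' i := by exact_mod_cast h5
      exact le_abs.2 (Or.inl (by linarith))
    · have h6 : (2 : ℝ) ≤ -(k i - k' i) := by exact_mod_cast h5
      exact le_abs.2 (Or.inr (by linarith))

lemma card_boxIndices (m j : ℕ) : (boxIndices m j).card = 2 ^ (m * (j + 1)) := by
  rw [boxIndices, Fintype.card_piFinset]
  simp only [Int.card_Ico, Finset.prod_const, Finset.card_univ, Fintype.card_fin]
  rw [mul_comm m, pow_mul]
  congr 1
  have : (2 : ℤ) ^ j - -2 ^ j = ((2 ^ (j + 1) : ℕ) : ℤ) := by push_cast; ring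
  rw [this, Int.toNat_natCast]

lemma abs_sub_le_three_of_mem_whitneyPairs {j : ℕ} {p : (Fin m → ℤ) × (Fin m → ℤ)}
    (hp : p ∈ whitneyPairs m j) (i : Fin m) : |p.1 i - p.2 i| ≤ 3 := by
  have := abs_le.1 ((mem_whitneyPairs.1 hp).2.1 i)
  simp only [parentIndex] at this
  rw [abs_le]
  omega

lemma whitneyPairs_swap {j : ℕ} {p : (Fin m → ℤ) × (Fin m → ℤ)} (hp : p ∈ whitneyPairs m j) :
    p.swap ∈ whitneyPairs m j := by
  simp only [mem_whitneyPairs, IsNear, Prod.fst_swap, Prod.snd_swap] at hp ⊢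
  refine ⟨hp.1.symm, ?_, ?_⟩
  · simpa only [abs_sub_comm] using hp.2.1
  · simpa only [abs_sub_comm] using hp.2.2

lemma sum_whitneyPairs_fst_le (j : ℕ) (x : (Fin m → ℤ) → ℝ≥0∞) :
    ∑ p ∈ whitneyPairs m j, x p.1 ≤ 7 ^ m * ∑ k ∈ boxIndices m (j + 1), x k := by
  classical
  have hsub : whitneyPairs m j ⊆ (boxIndices m (j + 1) ×ˢ boxIndices m (j + 1)).filter
      fun p => p.2 ∈ Fintype.piFinset fun i => Finset.Icc (p.1 i - 3) (p.1 i + 3) := by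
    intro p hp
    refine Finset.mem_filter.2 ⟨(Finset.mem_filter.1 hp).1, Fintype.mem_piFinset.2 fun i => ?_⟩
    have := abs_le.1 (abs_sub_le_three_of_mem_whitneyPairs hp i)
    rw [Finset.mem_Icc]
    omega
  calc ∑ p ∈ whitneyPairs m j, x p.1 ≤ _ := Finset.sum_le_sum_of_subset hsub
    _ = ∑ k ∈ boxIndices m (j + 1), ∑ k' ∈ (boxIndices m (j + 1)).filter
          fun k' => k' ∈ Fintype.piFinset fun i => Finset.Icc (k i - 3) (k i + 3), x k := by
        rw [Finset.sum_filter, Finset.sum_product]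
        refine Finset.sum_congr rfl fun k _ => ?_
        rw [Finset.sum_filter]
    _ ≤ ∑ k ∈ boxIndices m (j + 1), 7 ^ m * x k := by
        refine Finset.sum_le_sum fun k _ => ?_
        rw [Finset.sum_const, nsmul_eq_mul]
        refine mul_le_mul' ?_ le_rfl
        have h1 : ((boxIndices m (j + 1)).filter fun k' => k' ∈ Fintype.piFinset
            fun i => Finset.Icc (k i - 3) (k i + 3)).card ≤ 7 ^ m := by
          refine (Finset.card_le_card fun k' hk' => (Finset.mem_filter.1 hk').2).trans ?_
          rw [Fintype.card_piFinset]
          have h2 : ∀ i, (Finset.Icc (k i - 3) (k i + 3)).card = 7 := fun i => by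
            rw [Int.card_Icc]; omega
          simp [h2]
        exact_mod_cast h1
    _ = _ := by rw [Finset.mul_sum]

lemma sum_whitneyPairs_snd_le (j : ℕ) (x : (Fin m → ℤ) → ℝ≥0∞) :
    ∑ p ∈ whitneyPairs m j, x p.2 ≤ 7 ^ m * ∑ k ∈ boxIndices m (j + 1), x k := by
  refine le_trans (le_of_eq ?_) (sum_whitneyPairs_fst_le j x)
  exact Finset.sum_bij' (fun p _ => p.swap) (fun p _ => p.swap) (fun p hp => whitneyPairs_swap hp)
    (fun p hp => whitneyPairs_swap hp) (by simp) (by simp) (by simp)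

lemma card_whitneyPairs_le (m j : ℕ) :
    ((whitneyPairs m j).card : ℝ≥0∞) ≤ 7 ^ m * 2 ^ m * 2 ^ ((m : ℝ) * (j + 1)) := by
  have h := sum_whitneyPairs_fst_le (m := m) j fun _ => 1
  simp only [Finset.sum_const, nsmul_eq_mul, mul_one, card_boxIndices] at h
  refine h.trans (le_of_eq ?_)
  rw [mul_assoc]
  congr 1
  have : (m : ℝ) * (j + 1) = ((m * (j + 1) : ℕ) : ℝ) := by push_cast; ring
  rw [this, ENNReal.rpow_natCast]
  push_cast
  rw [← pow_add]
  ring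

/-- The centre of the sum of two dyadic cubes with indices `p.1` and `p.2`, in units of their
side. -/
noncomputable def sumCenter (p : (Fin m → ℤ) × (Fin m → ℤ)) : EuclideanSpace ℝ (Fin m) :=
  WithLp.toLp 2 fun i => (p.1 i + p.2 i + 1 : ℝ)

lemma abs_sub_sumCenter_le {j : ℕ} {p : (Fin m → ℤ) × (Fin m → ℤ)}
    {y y' : EuclideanSpace ℝ (Fin m)} (hy : dyadicIndex j y = p.1) (hy' : dyadicIndex j y' = p.2)
    (i : Fin m) : |(2 : ℝ) ^ j * (y i + y' i) - sumCenter p i| ≤ 1 := by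
  have h1 : ⌊(2 : ℝ) ^ j * y i⌋ = p.1 i := congrFun hy i
  have h2 : ⌊(2 : ℝ) ^ j * y' i⌋ = p.2 i := congrFun hy' i
  rw [Int.floor_eq_iff] at h1 h2
  simp only [sumCenter]
  rw [abs_le]
  constructor <;> linarith [h1.1, h1.2, h2.1, h2.2]

/-- The sum sets of the Whitney pairs of a fixed scale have bounded overlap. -/
lemma sum_enorm_freqCutoff_sq_le (j : ℕ) (R : ℝ) (ξ : EuclideanSpace ℝ (Fin m)) :
    ∑ p ∈ whitneyPairs m j, ‖freqCutoff R (sumCenter p) ξ‖ₑ ^ 2 ≤ ((m + 7) ^ m * (m + 7) ^ m : ℕ) := by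
  classical
  -- Both indices of a pair that contributes at `ξ` lie in this box.
  set J : Finset (Fin m → ℤ) := Fintype.piFinset fun i =>
    Finset.Icc ⌈(R * ξ i - 1 - (m + 5)) / 2⌉ ⌊(R * ξ i - 1 + (m + 5)) / 2⌋ with hJ
  have hmem : ∀ l l' : Fin m → ℤ, (∀ i, |l i - l' i| ≤ 3) →
      (∀ i, |R * ξ i - (l i + l' i + 1 : ℝ)| < m + 2) → l ∈ J := fun l l' h3 hlt => by
    refine Fintype.mem_piFinset.2 fun i => Finset.mem_Icc.2 ?_
    have a := abs_lt.1 (hlt i)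
    have b1 : (-3 : ℝ) ≤ l i - l' i := by exact_mod_cast (abs_le.1 (h3 i)).1
    have b2 : (l i - l' i : ℝ) ≤ 3 := by exact_mod_cast (abs_le.1 (h3 i)).2
    exact ⟨Int.ceil_le.2 (by linarith), Int.le_floor.2 (by linarith)⟩
  have hcard : J.card ≤ (m + 7) ^ m := by
    rw [hJ, Fintype.card_piFinset]
    refine (Finset.prod_le_pow_card _ _ (m + 7) fun i _ => ?_).trans (by simp)
    rw [Int.card_Icc]
    have a1 := Int.le_ceil ((R * ξ i - 1 - (m + 5)) / 2)
    have a2 := Int.floor_le ((R * ξ i - 1 + (m + 5)) / 2)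
    have a3 : (⌊(R * ξ i - 1 + (m + 5)) / 2⌋ - ⌈(R * ξ i - 1 - (m + 5)) / 2⌉ : ℝ) ≤ m + 5 := by
      linarith
    have a4 : ⌊(R * ξ i - 1 + (m + 5)) / 2⌋ - ⌈(R * ξ i - 1 - (m + 5)) / 2⌉ ≤ (m : ℤ) + 5 := by
      exact_mod_cast a3
    omega
  calc ∑ p ∈ whitneyPairs m j, ‖freqCutoff R (sumCenter p) ξ‖ₑ ^ 2
      ≤ ∑ p ∈ whitneyPairs m j, if p ∈ J ×ˢ J then (1 : ℝ≥0∞) else 0 := by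
        refine Finset.sum_le_sum fun p hp => ?_
        by_cases h0 : freqCutoff R (sumCenter p) ξ = 0
        · simp [h0]
        have hlt := abs_lt_of_freqCutoff_ne_zero h0
        have h3 := abs_sub_le_three_of_mem_whitneyPairs hp
        have h1 : p ∈ J ×ˢ J := by
          refine Finset.mem_product.2 ⟨hmem _ p.2 h3 hlt, hmem _ p.1 (fun i => ?_) fun i => ?_⟩
          · rw [abs_sub_comm]; exact h3 i
          · rw [add_comm (p.2 i : ℝ)]; exact hlt i
        rw [if_pos h1]
        refine pow_le_one' ?_ 2
        rw [← ofReal_norm]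
        exact ENNReal.ofReal_le_one.2 (norm_freqCutoff_le_one ξ)
    _ = (((whitneyPairs m j).filter fun p => p ∈ J ×ˢ J).card : ℝ≥0∞) := by
        rw [Finset.sum_ite, Finset.sum_const_zero, add_zero, Finset.sum_const, nsmul_eq_mul,
          mul_one]
    _ ≤ _ := by
        have h1 : ((whitneyPairs m j).filter fun p => p ∈ J ×ˢ J).card ≤ J.card * J.card := by
          rw [← Finset.card_product]
          exact Finset.card_le_card fun p hp => (Finset.mem_filter.1 hp).2
        exact_mod_cast h1.trans (Nat.mul_le_mul hcard hcard)

end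

/-! ### The bilinear estimate for Whitney pairs -/

section

variable {m : ℕ}

/-- The bilinear estimate `L^(1/a) × L^(1/a) → L^(1/b)` for functions carried by the cubes of a
Whitney pair, with the power of the side `2 ^ (-(j + 1))` which parabolic scaling dictates. -/
def WhitneyEstimate (Φ : EuclideanSpace ℝ (Fin m) → ℝ) (a b : ℝ) (C : ℝ≥0) : Prop :=
  ∀ (j : ℕ), ∀ p ∈ whitneyPairs m j, ∀ (f g : EuclideanSpace ℝ (Fin m) → ℂ) (K : ℝ),
    Measurable f → Measurable g → (∀ y, ‖f y‖ ≤ K) → (∀ y, ‖g y‖ ≤ K) →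
    (∀ y, f y ≠ 0 → dyadicIndex (j + 1) y = p.1) → (∀ y, g y ≠ 0 → dyadicIndex (j + 1) y = p.2) →
    eLpNorm (fun z => adjointRestriction Φ f z * adjointRestriction Φ g z) (ENNReal.ofReal b⁻¹) ≤
      C * 2 ^ (((m + 2) * b - 2 * m + 2 * m * a) * (j + 1)) * eLpNorm f (ENNReal.ofReal a⁻¹) *
        eLpNorm g (ENNReal.ofReal a⁻¹)

lemma WhitneyEstimate.mono {Φ : EuclideanSpace ℝ (Fin m) → ℝ} {a b : ℝ} {C C' : ℝ≥0}
    (h : WhitneyEstimate Φ a b C) (hC : C ≤ C') : WhitneyEstimate Φ a b C' := by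
  intro j p hp f g K hf hg hfK hgK hfp hgp
  refine (h j p hp f g K hf hg hfK hgK hfp hgp).trans ?_
  gcongr

lemma ofReal_two_inv_pow (j k : ℕ) :
    ENNReal.ofReal (((2 : ℝ)⁻¹ ^ j) ^ k) = 2 ^ (-((j : ℝ) * k)) := by
  rw [← pow_mul, inv_pow, ENNReal.ofReal_inv_of_pos (by positivity),
    ENNReal.ofReal_pow (by norm_num), ENNReal.rpow_neg]
  congr 1
  have : (j : ℝ) * k = ((j * k : ℕ) : ℝ) := by push_cast; ring
  rw [this, ENNReal.rpow_natCast]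
  simp

lemma ofReal_two_inv_pow_inv (j k : ℕ) :
    ENNReal.ofReal ((((2 : ℝ)⁻¹ ^ j) ^ k)⁻¹) = 2 ^ ((j : ℝ) * k) := by
  rw [ENNReal.ofReal_inv_of_pos (by positivity), ofReal_two_inv_pow, ENNReal.rpow_neg, inv_inv]

end

/-- The bilinear restriction estimate at unit scale yields the estimate for Whitney pairs of all
scales. -/
lemma BilinearRestrictionEstimate.exists_whitneyEstimate {n N : ℕ} (hN : 2 ≤ N) {A A' ε a b : ℝ}
    (hε : ε ≤ 1) (hAA : A ≤ A') (hA' : 2 * (1 + ((n - 1 : ℕ) : ℝ) ^ 2) ^ 2 ≤ A')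
    (ha : 0 < a) (ha1 : a ≤ 1) (hb : 0 < b)
    (h : BilinearRestrictionEstimate n A' N ε (ENNReal.ofReal a⁻¹) (ENNReal.ofReal a⁻¹)
      (ENNReal.ofReal b⁻¹)) :
    ∃ C : ℝ≥0, ∀ Φ : EuclideanSpace ℝ (Fin (n - 1)) → ℝ, Measurable Φ → IsEllipticPhase A N ε Φ →
      WhitneyEstimate Φ a b C := by
  obtain ⟨C, hC⟩ := h.exists_rescaled hN hε hAA hA'
    (by rw [ENNReal.one_le_ofReal]; exact (one_le_inv₀ ha).2 ha1) ENNReal.ofReal_ne_top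
    ENNReal.ofReal_ne_top (κ := 1 / 2) (by norm_num)
  set m := n - 1 with hm
  set x : ℝ := (m + 2) * b - 2 * m + 2 * m * a with hx
  refine ⟨C * ((2 : ℝ≥0∞) ^ (-x)).toNNReal, fun Φ hΦ hΦe j p hp f g K hf hg hfK hgK hfp hgp => ?_⟩
  obtain ⟨c, c₁, c₂, hcQ, hsep, h1, h2⟩ := exists_rescaled_of_mem_whitneyPairs hp
  have hr1 : (2⁻¹ : ℝ) ^ j ≤ 1 := pow_le_one₀ (by norm_num) (by norm_num)
  refine (hC Φ hΦ hΦe c _ (by positivity) hr1 hcQ c₁ c₂ _ _ hsep f g K hf hg hfK hgK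
    (fun Y hY => h1 Y (hfp _ hY)) (fun Y hY => h2 Y (hgp _ hY))).trans (le_of_eq ?_)
  congr 1
  congr 1
  rw [ENNReal.coe_mul, ENNReal.coe_toNNReal (two_rpow_ne_top _), mul_assoc (C : ℝ≥0∞)]
  congr 1
  rw [ofReal_two_inv_pow, ofReal_two_inv_pow_inv, ofReal_two_inv_pow_inv,
    ENNReal.toReal_ofReal (by positivity), ENNReal.toReal_ofReal (by positivity), one_div, inv_inv,
    one_div, inv_inv, ← ENNReal.rpow_natCast, ← ENNReal.rpow_natCast, ← ENNReal.rpow_mul,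
    ← ENNReal.rpow_mul, ← ENNReal.rpow_mul, ← ENNReal.rpow_mul, ← two_rpow_add, ← two_rpow_add,
    ← two_rpow_add]
  congr 1
  rw [hx]
  push_cast
  ring

section

variable {m : ℕ}

lemma ENNReal.rpow_sum_rpow_le {ι : Type*} (S : Finset ι) (x : ι → ℝ≥0∞) {w : ℝ} (hw : 0 < w)
    {M : ℝ≥0∞} (hM : (S.card : ℝ≥0∞) ≤ M) :
    (∑ k ∈ S, x k ^ w) ^ (1 / w) ≤ M ^ (max (1 - w) 0 / w) * ∑ k ∈ S, x k := by
  rcases le_total 1 w with h1 | h1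
  · have h := ENNReal.sum_rpow_le_sum_rpow_rpow S x one_pos h1
    simpa [max_eq_right (show 1 - w ≤ 0 by linarith)] using h
  · have h := ENNReal.rpow_sum_le_const_mul_sum_rpow S (fun k => x k ^ w) (p := 1 / w)
      ((one_le_div hw).2 h1)
    refine h.trans ?_
    rw [max_eq_left (by linarith)]
    refine mul_le_mul' ?_ (le_of_eq (Finset.sum_congr rfl fun k _ => ?_))
    · have : 1 / w - 1 = (1 - w) / w := by field_simp
      rw [this]
      exact ENNReal.rpow_le_rpow hM (div_nonneg (by linarith) hw.le)
    · rw [← ENNReal.rpow_mul, mul_one_div_cancel hw.ne', ENNReal.rpow_one]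

/-- Hölder's inequality for finite sums, where the missing exponent is paid for by the number of
terms. -/
lemma ENNReal.sum_rpow_mul_rpow_le {ι : Type*} (S : Finset ι) (x y : ι → ℝ≥0∞) {u v : ℝ}
    (hu : 0 < u) (hv : 0 < v) {M : ℝ≥0∞} (hM : (S.card : ℝ≥0∞) ≤ M) :
    ∑ k ∈ S, x k ^ u * y k ^ v ≤
      M ^ max (1 - (u + v)) 0 * (∑ k ∈ S, x k) ^ u * (∑ k ∈ S, y k) ^ v := by
  set w := u + v with hw
  have hw0 : 0 < w := by positivity
  have hm0 : 0 ≤ max (1 - w) 0 := le_max_right _ _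
  have hconj : (w / u).HolderConjugate (w / v) := by
    rw [Real.holderConjugate_iff]
    refine ⟨(one_lt_div hu).2 (by linarith), ?_⟩
    rw [inv_div, inv_div, ← add_div, div_self hw0.ne']
  have key : ∀ (x : ι → ℝ≥0∞) (t : ℝ), 0 < t → (∑ k ∈ S, (x k ^ t) ^ (w / t)) ^ (1 / (w / t)) ≤
      M ^ (max (1 - w) 0 / w * t) * (∑ k ∈ S, x k) ^ t := fun x t ht => by
    have h1 : ∀ k, (x k ^ t) ^ (w / t) = x k ^ w := fun k => by
      rw [← ENNReal.rpow_mul, mul_div_cancel₀ _ ht.ne']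
    simp_rw [h1]
    have h2 : 1 / (w / t) = 1 / w * t := by field_simp
    rw [h2, ENNReal.rpow_mul, ENNReal.rpow_mul, ← ENNReal.mul_rpow_of_nonneg _ _ ht.le]
    exact ENNReal.rpow_le_rpow (ENNReal.rpow_sum_rpow_le S x hw0 hM) ht.le
  calc ∑ k ∈ S, x k ^ u * y k ^ v ≤ _ := ENNReal.inner_le_Lp_mul_Lq S _ _ hconj
    _ ≤ (M ^ (max (1 - w) 0 / w * u) * (∑ k ∈ S, x k) ^ u) *
          (M ^ (max (1 - w) 0 / w * v) * (∑ k ∈ S, y k) ^ v) :=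
        mul_le_mul' (key x u hu) (key y v hv)
    _ = M ^ (max (1 - w) 0 / w * u) * M ^ (max (1 - w) 0 / w * v) * (∑ k ∈ S, x k) ^ u *
          (∑ k ∈ S, y k) ^ v := by ring
    _ = _ := by
        rw [← ENNReal.rpow_add_of_nonneg _ _ (by positivity) (by positivity), ← mul_add, ← hw,
          div_mul_cancel₀ _ hw0.ne']

lemma eLpNorm_le_mul_volume_rpow {X : Type*} [MeasurableSpace X] {μ : Measure X} {f : X → ℂ}
    {G : Set X} (hG : MeasurableSet G) {l : ℝ≥0∞} (hf : ∀ y, ‖f y‖ₑ ≤ G.indicator (fun _ => l) y)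
    {a : ℝ} (ha : 0 < a) : eLpNorm f (ENNReal.ofReal a⁻¹) μ ≤ l * μ G ^ a := by
  have ha' : 0 < a⁻¹ := inv_pos.2 ha
  rw [eLpNorm_eq_lintegral_rpow_enorm_toReal (by simpa using ha) (by simp),
    ENNReal.toReal_ofReal ha'.le]
  calc (∫⁻ x, ‖f x‖ₑ ^ a⁻¹ ∂μ) ^ (1 / a⁻¹)
      ≤ (∫⁻ x, G.indicator (fun _ => l ^ a⁻¹) x ∂μ) ^ (1 / a⁻¹) := by
        refine ENNReal.rpow_le_rpow (lintegral_mono fun x => ?_) (by positivity)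
        by_cases hx : x ∈ G
        · simpa [hx] using ENNReal.rpow_le_rpow (hf x) ha'.le
        · have := hf x
          simp only [hx, not_false_eq_true, Set.indicator_of_notMem] at this ⊢
          rw [le_zero_iff.1 this, ENNReal.zero_rpow_of_pos ha']
    _ = l * μ G ^ a := by
        rw [lintegral_indicator_const hG, one_div, inv_inv, ENNReal.mul_rpow_of_nonneg _ _ ha.le,
          ← ENNReal.rpow_mul, inv_mul_cancel₀ ha.ne', ENNReal.rpow_one]

/-- The part of `f` carried by the dyadic cube with index `k`. -/
noncomputable def dyadicPart (j : ℕ) (k : Fin m → ℤ) (f : EuclideanSpace ℝ (Fin m) → ℂ) :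
    EuclideanSpace ℝ (Fin m) → ℂ :=
  (dyadicIndex j ⁻¹' {k}).indicator f

lemma measurableSet_dyadicIndex_preimage (j : ℕ) (k : Fin m → ℤ) :
    MeasurableSet (dyadicIndex j ⁻¹' {k} : Set (EuclideanSpace ℝ (Fin m))) :=
  measurable_dyadicIndex j (measurableSet_singleton k)

lemma measurable_dyadicPart {j : ℕ} {k : Fin m → ℤ} {f : EuclideanSpace ℝ (Fin m) → ℂ}
    (hf : Measurable f) : Measurable (dyadicPart j k f) :=
  hf.indicator (measurableSet_dyadicIndex_preimage j k)

lemma norm_dyadicPart_le (j : ℕ) (k : Fin m → ℤ) (f : EuclideanSpace ℝ (Fin m) → ℂ)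
    (y : EuclideanSpace ℝ (Fin m)) : ‖dyadicPart j k f y‖ ≤ ‖f y‖ :=
  norm_indicator_le_norm_self _ _

lemma dyadicIndex_eq_of_dyadicPart_ne_zero {j : ℕ} {k : Fin m → ℤ}
    {f : EuclideanSpace ℝ (Fin m) → ℂ} {y : EuclideanSpace ℝ (Fin m)}
    (h : dyadicPart j k f y ≠ 0) : dyadicIndex j y = k := by
  by_contra hne
  exact h (Set.indicator_of_notMem (s := dyadicIndex j ⁻¹' {k}) hne f)

lemma enorm_dyadicPart_le {j : ℕ} {k : Fin m → ℤ} {f : EuclideanSpace ℝ (Fin m) → ℂ}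
    {G : Set (EuclideanSpace ℝ (Fin m))} {l : ℝ≥0∞}
    (hf : ∀ y, ‖f y‖ₑ ≤ G.indicator (fun _ => l) y) (y : EuclideanSpace ℝ (Fin m)) :
    ‖dyadicPart j k f y‖ₑ ≤ (G ∩ dyadicIndex j ⁻¹' {k}).indicator (fun _ => l) y := by
  have h := hf y
  by_cases h1 : y ∈ dyadicIndex j ⁻¹' {k}
  · by_cases h2 : y ∈ G <;> simp_all [dyadicPart]
  · simp [dyadicPart, h1]

/-- The proportion of the dyadic cube of side `2 ^ (-j)` with index `k` that lies in `G`. -/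
noncomputable def density (j : ℕ) (G : Set (EuclideanSpace ℝ (Fin m))) (k : Fin m → ℤ) : ℝ≥0∞ :=
  2 ^ ((m : ℝ) * j) * volume (G ∩ dyadicIndex j ⁻¹' {k})

lemma density_le_one (j : ℕ) (G : Set (EuclideanSpace ℝ (Fin m))) (k : Fin m → ℤ) :
    density j G k ≤ 1 := by
  calc density j G k ≤ 2 ^ ((m : ℝ) * j) * 2 ^ (-((m : ℝ) * j)) :=
        mul_le_mul' le_rfl ((measure_mono Set.inter_subset_right).trans
          (volume_dyadicIndex_preimage_le j k))
    _ = 1 := by rw [← two_rpow_add]; simp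

lemma volume_inter_eq_density (j : ℕ) (G : Set (EuclideanSpace ℝ (Fin m))) (k : Fin m → ℤ) :
    volume (G ∩ dyadicIndex j ⁻¹' {k}) = 2 ^ (-((m : ℝ) * j)) * density j G k := by
  rw [density, ← mul_assoc, ← two_rpow_add]
  simp

lemma sum_density_le (j : ℕ) {G : Set (EuclideanSpace ℝ (Fin m))} (hG : MeasurableSet G)
    (S : Finset (Fin m → ℤ)) : ∑ k ∈ S, density j G k ≤ 2 ^ ((m : ℝ) * j) * volume G := by
  simp only [density]
  rw [← Finset.mul_sum]
  refine mul_le_mul' le_rfl ?_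
  rw [← measure_biUnion_finset ?_ fun k _ => hG.inter (measurableSet_dyadicIndex_preimage j k)]
  · exact measure_mono (Set.iUnion₂_subset fun k _ => Set.inter_subset_left)
  · intro k _ k' _ hne
    refine Set.disjoint_left.2 fun y hy hy' => hne ?_
    exact hy.2.symm.trans hy'.2

/-- The estimate for a single Whitney pair, for functions of height at most `l`, `l'` on the sets
`G`, `G'`, expressed by the densities of these sets in the two cubes. -/
lemma WhitneyEstimate.eLpNorm_dyadicPart_le {Φ : EuclideanSpace ℝ (Fin m) → ℝ} {a b : ℝ} {C : ℝ≥0}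
    (hW : WhitneyEstimate Φ a b C) (ha : 0 < a) {j : ℕ} {p : (Fin m → ℤ) × (Fin m → ℤ)}
    (hp : p ∈ whitneyPairs m j) {f g : EuclideanSpace ℝ (Fin m) → ℂ} {K : ℝ} (hf : Measurable f)
    (hg : Measurable g) (hfK : ∀ y, ‖f y‖ ≤ K) (hgK : ∀ y, ‖g y‖ ≤ K)
    {G G' : Set (EuclideanSpace ℝ (Fin m))} (hG : MeasurableSet G) (hG' : MeasurableSet G')
    {l l' : ℝ≥0∞} (hfl : ∀ y, ‖f y‖ₑ ≤ G.indicator (fun _ => l) y)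
    (hgl : ∀ y, ‖g y‖ₑ ≤ G'.indicator (fun _ => l') y) :
    eLpNorm (fun z => adjointRestriction Φ (dyadicPart (j + 1) p.1 f) z *
      adjointRestriction Φ (dyadicPart (j + 1) p.2 g) z) (ENNReal.ofReal b⁻¹) ≤
      C * 2 ^ (((m + 2) * b - 2 * m) * (j + 1)) * l * l' *
        (density (j + 1) G p.1 ^ a * density (j + 1) G' p.2 ^ a) := by
  refine (hW j p hp _ _ K (measurable_dyadicPart hf) (measurable_dyadicPart hg)
    (fun y => (norm_dyadicPart_le _ _ _ y).trans (hfK y))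
    (fun y => (norm_dyadicPart_le _ _ _ y).trans (hgK y))
    (fun y => dyadicIndex_eq_of_dyadicPart_ne_zero)
    (fun y => dyadicIndex_eq_of_dyadicPart_ne_zero)).trans ?_
  have h1 := eLpNorm_le_mul_volume_rpow (μ := volume)
    (hG.inter (measurableSet_dyadicIndex_preimage (j + 1) p.1)) (enorm_dyadicPart_le hfl) ha
  have h2 := eLpNorm_le_mul_volume_rpow (μ := volume)
    (hG'.inter (measurableSet_dyadicIndex_preimage (j + 1) p.2)) (enorm_dyadicPart_le hgl) ha
  rw [volume_inter_eq_density, ENNReal.mul_rpow_of_nonneg _ _ ha.le, ← ENNReal.rpow_mul] at h1 h2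
  refine (mul_le_mul' (mul_le_mul' le_rfl h1) h2).trans (le_of_eq ?_)
  have h3 : (2 : ℝ≥0∞) ^ (((m + 2) * b - 2 * m + 2 * m * a) * (j + 1)) *
      2 ^ (-((m : ℝ) * (j + 1 : ℕ)) * a) * 2 ^ (-((m : ℝ) * (j + 1 : ℕ)) * a) =
      2 ^ (((m + 2) * b - 2 * m) * (j + 1)) := by
    rw [← two_rpow_add, ← two_rpow_add]
    congr 1
    push_cast
    ring
  rw [← h3]
  ring

lemma ENNReal.rpow_le_self_mul {K X Y : ℝ≥0∞} (hK : 1 ≤ K) (hX : X ≤ K * Y) {u : ℝ} (hu : 0 ≤ u)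
    (hu1 : u ≤ 1) : X ^ u ≤ K * Y ^ u := by
  refine (ENNReal.rpow_le_rpow hX hu).trans ?_
  rw [ENNReal.mul_rpow_of_nonneg _ _ hu]
  refine mul_le_mul' ?_ le_rfl
  simpa using ENNReal.rpow_le_rpow_of_exponent_le hK hu1

/-- The sum of the densities over the Whitney pairs of one scale. As densities are at most `1`, the
exponent `a` may be lowered to any `u`, `v ≤ a`, which is how estimates at nearby exponents arise.
The loss `θ` bounds the power of the number of pairs which is needed if `u + v < S`. -/
lemma sum_density_rpow_le (j : ℕ) {G G' : Set (EuclideanSpace ℝ (Fin m))} (hG : MeasurableSet G)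
    (hG' : MeasurableSet G') {i i' : ℤ} (hGi : volume G ≤ 2 ^ (-((m : ℝ) * i)))
    (hGi' : volume G' ≤ 2 ^ (-((m : ℝ) * i'))) {a u v S θ : ℝ} (hu : 0 < u) (hua : u ≤ a)
    (hv : 0 < v) (hva : v ≤ a) (ha1 : a ≤ 1) (hS : 0 < S) (hθ : 0 ≤ θ) (hθS : S - (u + v) ≤ θ)
    (hθ1 : θ ≤ 1) :
    (∑ p ∈ whitneyPairs m j, (density (j + 1) G p.1 ^ a * density (j + 1) G' p.2 ^ a) ^ S⁻¹) ^ S ≤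
      7 ^ m * 7 ^ m * (7 ^ m * 2 ^ m) *
        2 ^ (m * θ * (j + 1) + m * (j + 1 - i) * u + m * (j + 1 - i') * v) := by
  set x : (Fin m → ℤ) × (Fin m → ℤ) → ℝ≥0∞ := fun p => density (j + 1) G p.1 with hx
  set y : (Fin m → ℤ) × (Fin m → ℤ) → ℝ≥0∞ := fun p => density (j + 1) G' p.2 with hy
  have hSi : 0 < S⁻¹ := inv_pos.2 hS
  have h7 : (1 : ℝ≥0∞) ≤ 7 ^ m := one_le_pow₀ (by norm_num)
  have h2 : (1 : ℝ≥0∞) ≤ 2 ^ m := one_le_pow₀ (by norm_num)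
  have h14 : (1 : ℝ≥0∞) ≤ 7 ^ m * 2 ^ m := one_le_mul h7 h2
  set M : ℝ≥0∞ := 7 ^ m * 2 ^ m * 2 ^ ((m : ℝ) * (j + 1)) with hM
  have hM1 : 1 ≤ M := by
    refine one_le_mul h14 ?_
    simpa using two_rpow_le_two_rpow (show (0 : ℝ) ≤ (m : ℝ) * (j + 1) by positivity)
  have hterm : ∀ p ∈ whitneyPairs m j, (x p ^ a * y p ^ a) ^ S⁻¹ ≤
      x p ^ (u * S⁻¹) * y p ^ (v * S⁻¹) := fun p _ => by
    rw [ENNReal.mul_rpow_of_nonneg _ _ hSi.le, ENNReal.rpow_mul, ENNReal.rpow_mul]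
    exact mul_le_mul'
      (ENNReal.rpow_le_rpow (ENNReal.rpow_le_rpow_of_exponent_ge (density_le_one _ _ _) hua) hSi.le)
      (ENNReal.rpow_le_rpow (ENNReal.rpow_le_rpow_of_exponent_ge (density_le_one _ _ _) hva) hSi.le)
  have hsum := (Finset.sum_le_sum hterm).trans (ENNReal.sum_rpow_mul_rpow_le (whitneyPairs m j) x y
    (mul_pos hu hSi) (mul_pos hv hSi) (card_whitneyPairs_le m j))
  have hscale : ∀ (E : Set (EuclideanSpace ℝ (Fin m))) (l : ℤ), MeasurableSet E →
      volume E ≤ 2 ^ (-((m : ℝ) * l)) →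
      7 ^ m * ∑ k ∈ boxIndices m (j + 1), density (j + 1) E k ≤
        7 ^ m * 2 ^ ((m : ℝ) * (j + 1 - l)) := fun E l hE hEl => by
    refine mul_le_mul' le_rfl ((sum_density_le _ hE _).trans ((mul_le_mul' le_rfl hEl).trans ?_))
    rw [← two_rpow_add]
    refine two_rpow_le_two_rpow (le_of_eq ?_)
    push_cast
    ring
  have hX : (∑ p ∈ whitneyPairs m j, x p) ^ u ≤ 7 ^ m * 2 ^ (m * (j + 1 - i) * u) := by
    rw [ENNReal.rpow_mul]
    exact ENNReal.rpow_le_self_mul h7 ((sum_whitneyPairs_fst_le j _).trans (hscale G i hG hGi))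
      hu.le (hua.trans ha1)
  have hY : (∑ p ∈ whitneyPairs m j, y p) ^ v ≤ 7 ^ m * 2 ^ (m * (j + 1 - i') * v) := by
    rw [ENNReal.rpow_mul]
    exact ENNReal.rpow_le_self_mul h7 ((sum_whitneyPairs_snd_le j _).trans (hscale G' i' hG' hGi'))
      hv.le (hva.trans ha1)
  have hMθ : M ^ (max (1 - (u * S⁻¹ + v * S⁻¹)) 0 * S) ≤
      7 ^ m * 2 ^ m * 2 ^ (m * θ * (j + 1)) := by
    have hle : max (1 - (u * S⁻¹ + v * S⁻¹)) 0 * S ≤ θ := by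
      rw [max_mul_of_nonneg _ _ hS.le, zero_mul]
      refine max_le ?_ hθ
      have : (1 - (u * S⁻¹ + v * S⁻¹)) * S = S - (u + v) := by field_simp
      rwa [this]
    refine (ENNReal.rpow_le_rpow_of_exponent_le hM1 hle).trans ?_
    refine (ENNReal.rpow_le_self_mul h14 le_rfl hθ hθ1).trans (mul_le_mul' le_rfl ?_)
    rw [← ENNReal.rpow_mul]
    exact two_rpow_le_two_rpow (le_of_eq (by ring))
  refine (ENNReal.rpow_le_rpow hsum hS.le).trans ?_
  rw [ENNReal.mul_rpow_of_nonneg _ _ hS.le, ENNReal.mul_rpow_of_nonneg _ _ hS.le,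
    ← ENNReal.rpow_mul, ← ENNReal.rpow_mul, ← ENNReal.rpow_mul, mul_assoc u, mul_assoc v,
    inv_mul_cancel₀ hS.ne', mul_one, mul_one]
  refine (mul_le_mul' (mul_le_mul' hMθ hX) hY).trans (le_of_eq ?_)
  rw [two_rpow_add, two_rpow_add]
  ring

end

/-! ### Estimates for the pieces of a single scale -/

section

variable {m : ℕ}

lemma integrableOn_unitCube_of_bounded {f : EuclideanSpace ℝ (Fin m) → ℂ} {K : ℝ}
    (hf : Measurable f) (hfK : ∀ y, ‖f y‖ ≤ K) : IntegrableOn f (unitCube m) :=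
  Measure.integrableOn_of_bounded (isCompact_cube 0 1).measure_lt_top.ne hf.aestronglyMeasurable
    (Filter.Eventually.of_forall hfK)

/-- The constant of the estimate for pieces of a single scale. -/
noncomputable def scaleConst (m : ℕ) (C : ℝ≥0) : ℝ≥0∞ :=
  ((m + 7) ^ m * (m + 7) ^ m : ℕ) * (projConst m + 1) * C * (7 ^ m * 7 ^ m * (7 ^ m * 2 ^ m))

lemma scaleConst_ne_top (m : ℕ) (C : ℝ≥0) : scaleConst m C ≠ ⊤ := by
  refine ENNReal.mul_ne_top (ENNReal.mul_ne_top (ENNReal.mul_ne_top (ENNReal.natCast_ne_top _)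
    (ENNReal.add_ne_top.2 ⟨(projConst_lt_top m).ne, ENNReal.one_ne_top⟩)) ENNReal.coe_ne_top) ?_
  have h : (7 ^ m * 7 ^ m * (7 ^ m * 2 ^ m) : ℝ≥0∞) =
      ((7 ^ m * 7 ^ m * (7 ^ m * 2 ^ m) : ℕ) : ℝ≥0∞) := by
    push_cast; rfl
  rw [h]
  exact ENNReal.natCast_ne_top _

/-- The sum over the Whitney pairs of one scale, for atoms `f`, `g`, `h`: almost orthogonality reduces
it to an `ℓ^(1/S)` sum of the single pair estimates. -/
lemma WhitneyEstimate.sum_enorm_integral_le {Φ : EuclideanSpace ℝ (Fin m) → ℝ}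
    (hΦ : Measurable Φ) {a b : ℝ} {C : ℝ≥0} (hW : WhitneyEstimate Φ a b C) (ha : 0 < a)
    (ha1 : a ≤ 1) (hb : 0 < b) (hb1 : b < 1) {S θ u v : ℝ} (hbS : b ≤ S) (hbS' : 1 - b ≤ S)
    (hu : 0 < u) (hua : u ≤ a) (hv : 0 < v) (hva : v ≤ a) (hθ : 0 ≤ θ) (hθ1 : θ ≤ 1)
    (hθS : S - (u + v) ≤ θ) (j : ℕ) {f g : EuclideanSpace ℝ (Fin m) → ℂ} {K : ℝ}
    (hf : Measurable f) (hg : Measurable g) (hfK : ∀ y, ‖f y‖ ≤ K) (hgK : ∀ y, ‖g y‖ ≤ K)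
    {G G' : Set (EuclideanSpace ℝ (Fin m))} (hG : MeasurableSet G) (hG' : MeasurableSet G')
    {l l' : ℝ≥0∞} (hfl : ∀ y, ‖f y‖ₑ ≤ G.indicator (fun _ => l) y)
    (hgl : ∀ y, ‖g y‖ₑ ≤ G'.indicator (fun _ => l') y) {i i' i₃ : ℤ}
    (hGi : volume G ≤ 2 ^ (-((m : ℝ) * i))) (hGi' : volume G' ≤ 2 ^ (-((m : ℝ) * i')))
    {h : EuclideanSpace ℝ (Fin m) × ℝ → ℂ} (hh : Measurable h) {ν : ℝ≥0∞} (hν : ν ≠ ⊤)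
    {H : Set (EuclideanSpace ℝ (Fin m) × ℝ)} (hH : MeasurableSet H)
    (hHi : volume H ≤ 2 ^ (((m : ℝ) + 2) * i₃)) (hhν : ∀ z, ‖h z‖ₑ ≤ H.indicator (fun _ => ν) z) :
    ∑ p ∈ whitneyPairs m j, ‖∫ z, adjointRestriction Φ (dyadicPart (j + 1) p.1 f) z *
        adjointRestriction Φ (dyadicPart (j + 1) p.2 g) z * h z‖ₑ ≤
      scaleConst m C * l * l' * ν *
        2 ^ (((m + 2) * b - 2 * m) * (j + 1) + (m * θ * (j + 1) + m * (j + 1 - i) * u +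
          m * (j + 1 - i') * v) + (m + 2) * i₃ * (1 - b)) := by
  have hS : 0 < S := hb.trans_le hbS
  have hb1' : 0 < 1 - b := by linarith
  have hK0 : 0 ≤ K := (norm_nonneg _).trans (hfK 0)
  have hqq : b⁻¹.HolderConjugate (1 - b)⁻¹ := by
    rw [Real.holderConjugate_iff]
    refine ⟨(one_lt_inv₀ hb).2 hb1, by rw [inv_inv, inv_inv]; ring⟩
  have hs : S⁻¹ ≤ min b⁻¹ (1 - b)⁻¹ :=
    le_min (inv_anti₀ hb hbS) (inv_anti₀ hb1' hbS')
  set D : ℝ≥0∞ := (((m + 7) ^ m * (m + 7) ^ m : ℕ) : ℝ≥0∞) with hD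
  have hD1 : 1 ≤ D := by
    have : 1 ≤ (m + 7) ^ m * (m + 7) ^ m := Nat.one_le_iff_ne_zero.2 (by positivity)
    rw [hD]
    exact_mod_cast this
  have hfp : ∀ k : Fin m → ℤ, IntegrableOn (dyadicPart (j + 1) k f) (unitCube m) := fun k =>
    integrableOn_unitCube_of_bounded (measurable_dyadicPart hf)
      fun y => (norm_dyadicPart_le _ _ _ y).trans (hfK y)
  have hgp : ∀ k : Fin m → ℤ, IntegrableOn (dyadicPart (j + 1) k g) (unitCube m) := fun k =>
    integrableOn_unitCube_of_bounded (measurable_dyadicPart hg)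
      fun y => (norm_dyadicPart_le _ _ _ y).trans (hgK y)
  have hbound : ∀ (k : Fin m → ℤ) (e : EuclideanSpace ℝ (Fin m) → ℂ), Measurable e →
      (∀ y, ‖e y‖ ≤ K) → ∀ z, ‖adjointRestriction Φ (dyadicPart (j + 1) k e) z‖ ≤
        ∫ _ in unitCube m, K := fun k e he heK z =>
    (norm_adjointRestriction_le Φ _ z).trans (integral_mono
      (integrableOn_unitCube_of_bounded (measurable_dyadicPart he)
        fun y => (norm_dyadicPart_le _ _ _ y).trans (heK y)).norm
      (integrableOn_const (isCompact_cube 0 1).measure_lt_top.ne)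
      fun y => (norm_dyadicPart_le _ _ _ y).trans (heK y))
  have key := sum_enorm_integral_mul_le (R := 2 ^ (j + 1)) (by positivity) (whitneyPairs m j)
    sumCenter hD1 (ENNReal.natCast_ne_top _) (sum_enorm_freqCutoff_sq_le j _) hqq
    (inv_pos.2 hS) hs
    (F := fun p z => adjointRestriction Φ (dyadicPart (j + 1) p.1 f) z *
        adjointRestriction Φ (dyadicPart (j + 1) p.2 g) z)
    (fun p => (continuous_adjointRestriction hΦ (hfp _)).mul
      (continuous_adjointRestriction hΦ (hgp _)))
    (K := (∫ _ in unitCube m, K) * ∫ _ in unitCube m, K)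
    (fun p z => by
      rw [norm_mul]
      exact mul_le_mul (hbound _ f hf hfK z) (hbound _ g hg hgK z) (norm_nonneg _)
        (integral_nonneg fun _ => hK0))
    (fun p hp z => integral_projKernel_mul_translate (by positivity) hΦ (hfp _) (hgp _)
      (fun y y' hy hy' => abs_sub_sumCenter_le (dyadicIndex_eq_of_dyadicPart_ne_zero hy)
        (dyadicIndex_eq_of_dyadicPart_ne_zero hy')) z)
    hh hν hH (hHi.trans_lt (two_rpow_ne_top _).lt_top).ne hhν
  refine key.trans ?_
  have h1 : D ^ (1 / max b⁻¹ (1 - b)⁻¹) ≤ D := by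
    have : 1 / max b⁻¹ (1 - b)⁻¹ ≤ 1 := by
      rw [div_le_one (lt_max_of_lt_left (inv_pos.2 hb))]
      exact le_max_of_le_left hqq.lt.le
    simpa using ENNReal.rpow_le_rpow_of_exponent_le hD1 this
  have h2 : (∑ p ∈ whitneyPairs m j, eLpNorm (fun z =>
      adjointRestriction Φ (dyadicPart (j + 1) p.1 f) z *
        adjointRestriction Φ (dyadicPart (j + 1) p.2 g) z) (ENNReal.ofReal b⁻¹) ^ S⁻¹) ^ (1 / S⁻¹) ≤
      (C * 2 ^ (((m + 2) * b - 2 * m) * (j + 1)) * l * l') * (7 ^ m * 7 ^ m * (7 ^ m * 2 ^ m) *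
        2 ^ (m * θ * (j + 1) + m * (j + 1 - i) * u + m * (j + 1 - i') * v)) := by
    set X : ℝ≥0∞ := C * 2 ^ (((m + 2) * b - 2 * m) * (j + 1)) * l * l' with hX
    have hterm : ∑ p ∈ whitneyPairs m j, eLpNorm (fun z =>
        adjointRestriction Φ (dyadicPart (j + 1) p.1 f) z *
          adjointRestriction Φ (dyadicPart (j + 1) p.2 g) z) (ENNReal.ofReal b⁻¹) ^ S⁻¹ ≤
        X ^ S⁻¹ * ∑ p ∈ whitneyPairs m j,
          (density (j + 1) G p.1 ^ a * density (j + 1) G' p.2 ^ a) ^ S⁻¹ := by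
      rw [Finset.mul_sum]
      refine Finset.sum_le_sum fun p hp => ?_
      rw [← ENNReal.mul_rpow_of_nonneg _ _ (inv_pos.2 hS).le]
      exact ENNReal.rpow_le_rpow
        (hW.eLpNorm_dyadicPart_le ha hp hf hg hfK hgK hG hG' hfl hgl) (inv_pos.2 hS).le
    rw [one_div, inv_inv]
    refine (ENNReal.rpow_le_rpow hterm hS.le).trans ?_
    rw [ENNReal.mul_rpow_of_nonneg _ _ hS.le, ← ENNReal.rpow_mul, inv_mul_cancel₀ hS.ne',
      ENNReal.rpow_one]
    exact mul_le_mul' le_rfl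
      (sum_density_rpow_le j hG hG' hGi hGi' hu hua hv hva ha1 hS hθ hθS hθ1)
  have h3 : volume H ^ (1 / (1 - b)⁻¹) ≤ 2 ^ ((m + 2) * i₃ * (1 - b)) := by
    rw [one_div, inv_inv, ENNReal.rpow_mul]
    exact ENNReal.rpow_le_rpow hHi hb1'.le
  refine (mul_le_mul' (mul_le_mul' (mul_le_mul' h1 le_rfl) h2) (mul_le_mul' le_rfl h3)).trans
    (le_of_eq ?_)
  rw [scaleConst]
  generalize m * θ * (j + 1) + m * (j + 1 - i) * u + m * (j + 1 - i') * v = e₂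
  generalize ((m : ℝ) + 2) * i₃ * (1 - b) = e₃
  rw [two_rpow_add, two_rpow_add]
  ring

/-- The estimate for pieces of a single scale, with geometric gains away from the diagonal. For each
of the three functions the exponent is perturbed up or down, according to which of the two scales
involved is the larger one. -/
lemma sum_enorm_integral_le_of_whitneyEstimate {Φ : EuclideanSpace ℝ (Fin m) → ℝ}
    (hΦ : Measurable Φ) {a b α β : ℝ} {C : ℝ≥0} (hW : WhitneyEstimate Φ (a + α) (b + β) C)
    (hW' : WhitneyEstimate Φ (a + α) (b - β) C) (hα : 0 < α) (hαa : α < a) (ha1 : a + α ≤ 1)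
    (hβ : 0 < β) (hβb : β < b) (hb1 : b + β < 1) {θ : ℝ} (hθ : 0 ≤ θ) (hθ1 : θ ≤ 1)
    (hθS : max b (1 - b) + β - 2 * (a - α) ≤ θ) (j : ℕ) {f g : EuclideanSpace ℝ (Fin m) → ℂ} {K : ℝ}
    (hf : Measurable f) (hg : Measurable g) (hfK : ∀ y, ‖f y‖ ≤ K) (hgK : ∀ y, ‖g y‖ ≤ K)
    {G G' : Set (EuclideanSpace ℝ (Fin m))} (hG : MeasurableSet G) (hG' : MeasurableSet G')
    {l l' : ℝ≥0∞} (hfl : ∀ y, ‖f y‖ₑ ≤ G.indicator (fun _ => l) y)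
    (hgl : ∀ y, ‖g y‖ₑ ≤ G'.indicator (fun _ => l') y) {i i' i₃ : ℤ}
    (hGi : volume G ≤ 2 ^ (-((m : ℝ) * i))) (hGi' : volume G' ≤ 2 ^ (-((m : ℝ) * i')))
    {h : EuclideanSpace ℝ (Fin m) × ℝ → ℂ} (hh : Measurable h) {ν : ℝ≥0∞} (hν : ν ≠ ⊤)
    {H : Set (EuclideanSpace ℝ (Fin m) × ℝ)} (hH : MeasurableSet H)
    (hHi : volume H ≤ 2 ^ (((m : ℝ) + 2) * i₃)) (hhν : ∀ z, ‖h z‖ₑ ≤ H.indicator (fun _ => ν) z) :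
    ∑ p ∈ whitneyPairs m j, ‖∫ z, adjointRestriction Φ (dyadicPart (j + 1) p.1 f) z *
        adjointRestriction Φ (dyadicPart (j + 1) p.2 g) z * h z‖ₑ ≤
      scaleConst m C * (2 ^ (((m + 2) * b - 2 * m * (1 - a) + m * θ) * (j + 1)) *
        (2 ^ (-(m * α * |((i - (j + 1) : ℤ) : ℝ)|)) * (2 ^ (-(m * a * i)) * l)) *
        (2 ^ (-(m * α * |((i' - (j + 1) : ℤ) : ℝ)|)) * (2 ^ (-(m * a * i')) * l')) *
        (2 ^ (-((m + 2) * β * |((i₃ - (j + 1) : ℤ) : ℝ)|)) * (2 ^ ((m + 2) * (1 - b) * i₃) * ν))) := by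
  -- The sign of each perturbation is that of the corresponding difference of scales.
  have hsign : ∀ (x γ : ℝ), ∃ σ : ℝ, (σ = γ ∨ σ = -γ) ∧ σ * x = γ * |x| := fun x γ => by
    rcases le_total 0 x with hx | hx
    · exact ⟨γ, Or.inl rfl, by rw [abs_of_nonneg hx]⟩
    · exact ⟨-γ, Or.inr rfl, by rw [abs_of_nonpos hx]; ring⟩
  obtain ⟨σ, hσ, hσx⟩ := hsign ((i - (j + 1) : ℤ) : ℝ) α
  obtain ⟨σ', hσ', hσx'⟩ := hsign ((i' - (j + 1) : ℤ) : ℝ) α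
  obtain ⟨τ, hτ, hτx⟩ := hsign ((i₃ - (j + 1) : ℤ) : ℝ) β
  have hWτ : WhitneyEstimate Φ (a + α) (b + τ) C := by
    rcases hτ with rfl | rfl
    · exact hW
    · exact hW'
  have hσb : -α ≤ σ ∧ σ ≤ α := by rcases hσ with rfl | rfl <;> constructor <;> linarith
  have hσb' : -α ≤ σ' ∧ σ' ≤ α := by rcases hσ' with rfl | rfl <;> constructor <;> linarith
  have hτb : -β ≤ τ ∧ τ ≤ β := by rcases hτ with rfl | rfl <;> constructor <;> linarith
  have hmax1 := le_max_left b (1 - b)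
  have hmax2 := le_max_right b (1 - b)
  refine (hWτ.sum_enorm_integral_le hΦ (S := max b (1 - b) + β) (θ := θ) (u := a + σ)
    (v := a + σ') (by linarith) ha1 (by linarith) (by linarith) (by linarith) (by linarith)
    (by linarith) (by linarith) (by linarith) (by linarith) hθ hθ1 (by linarith) j hf hg hfK hgK
    hG hG' hfl hgl hGi hGi' hh hν hH hHi hhν).trans (le_of_eq ?_)
  have hreorder : ∀ c e₀ e₁ e₂ e₃ e₄ e₅ e₆ : ℝ≥0∞,
      c * (e₀ * (e₁ * (e₂ * l)) * (e₃ * (e₄ * l')) * (e₅ * (e₆ * ν))) =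
        c * l * l' * ν * (e₀ * e₁ * e₂ * e₃ * e₄ * e₅ * e₆) := fun _ _ _ _ _ _ _ _ => by ring
  rw [hreorder, ← two_rpow_add, ← two_rpow_add, ← two_rpow_add, ← two_rpow_add, ← two_rpow_add,
    ← two_rpow_add]
  congr 2
  push_cast at hσx hσx' hτx ⊢
  linear_combination (-m) * hσx - m * hσx' - (m + 2) * hτx

end

/-! ### The Whitney decomposition of the trilinear form -/

section

variable {m : ℕ}

/-- The integrand of the trilinear form `∫ ℜ* f ⬝ ℜ* g ⬝ h`, written as a triple integral. -/
noncomputable def trilinearIntegrand (Φ : EuclideanSpace ℝ (Fin m) → ℝ)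
    (f g : EuclideanSpace ℝ (Fin m) → ℂ) (h : EuclideanSpace ℝ (Fin m) × ℝ → ℂ)
    (w : (EuclideanSpace ℝ (Fin m) × ℝ) × (EuclideanSpace ℝ (Fin m) × EuclideanSpace ℝ (Fin m))) :
    ℂ :=
  (phaseKernel Φ w.1 w.2.1 * phaseKernel Φ w.1 w.2.2) * (h w.1 * (f w.2.1 * g w.2.2))

/-- The product measure for the trilinear form, where the frequencies range over `Q`. -/
noncomputable def trilinearMeasure (m : ℕ) :
    Measure ((EuclideanSpace ℝ (Fin m) × ℝ) ×
      (EuclideanSpace ℝ (Fin m) × EuclideanSpace ℝ (Fin m))) :=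
  volume.prod ((volume.restrict (unitCube m)).prod (volume.restrict (unitCube m)))

lemma measurable_phaseKernel_apply {X : Type*} [MeasurableSpace X]
    {Φ : EuclideanSpace ℝ (Fin m) → ℝ} (hΦ : Measurable Φ) {z : X → EuclideanSpace ℝ (Fin m) × ℝ}
    {y : X → EuclideanSpace ℝ (Fin m)} (hz : Measurable z) (hy : Measurable y) :
    Measurable fun x => phaseKernel Φ (z x) (y x) := by
  have h1 : Measurable fun x => (z x, y x) := hz.prodMk hy
  have h2 := (measurable_phaseKernel hΦ).comp h1
  have e : (fun x => phaseKernel Φ (z x) (y x)) =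
    Function.uncurry (phaseKernel Φ) ∘ fun x => (z x, y x) := rfl
  rw [e]
  exact h2

lemma measurable_phaseKernel_mul_phaseKernel {Φ : EuclideanSpace ℝ (Fin m) → ℝ}
    (hΦ : Measurable Φ) :
    Measurable fun w : (EuclideanSpace ℝ (Fin m) × ℝ) ×
      (EuclideanSpace ℝ (Fin m) × EuclideanSpace ℝ (Fin m)) =>
      phaseKernel Φ w.1 w.2.1 * phaseKernel Φ w.1 w.2.2 := by
  have h1 : Measurable fun w : (EuclideanSpace ℝ (Fin m) × ℝ) ×
      (EuclideanSpace ℝ (Fin m) × EuclideanSpace ℝ (Fin m)) => phaseKernel Φ w.1 w.2.1 :=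
    measurable_phaseKernel_apply hΦ measurable_fst measurable_snd.fst
  have h2 : Measurable fun w : (EuclideanSpace ℝ (Fin m) × ℝ) ×
      (EuclideanSpace ℝ (Fin m) × EuclideanSpace ℝ (Fin m)) => phaseKernel Φ w.1 w.2.2 :=
    measurable_phaseKernel_apply hΦ measurable_fst measurable_snd.snd
  exact h1.mul h2

lemma integrable_trilinearIntegrand {Φ : EuclideanSpace ℝ (Fin m) → ℝ} (hΦ : Measurable Φ)
    {f g : EuclideanSpace ℝ (Fin m) → ℂ} (hf : IntegrableOn f (unitCube m))
    (hg : IntegrableOn g (unitCube m)) {h : EuclideanSpace ℝ (Fin m) × ℝ → ℂ}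
    (hh : Integrable h) : Integrable (trilinearIntegrand Φ f g h) (trilinearMeasure m) := by
  have h0 : Integrable (fun w : EuclideanSpace ℝ (Fin m) × EuclideanSpace ℝ (Fin m) =>
      f w.1 * g w.2) ((volume.restrict (unitCube m)).prod (volume.restrict (unitCube m))) :=
    Integrable.mul_prod hf hg
  have h1 := Integrable.mul_prod hh h0
  have h2 := h1.bdd_mul (c := 1) (measurable_phaseKernel_mul_phaseKernel hΦ).aestronglyMeasurable
    (Filter.Eventually.of_forall fun w => by
      rw [norm_mul, norm_phaseKernel, norm_phaseKernel, one_mul])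
  exact h2

lemma integral_trilinearIntegrand {Φ : EuclideanSpace ℝ (Fin m) → ℝ} (hΦ : Measurable Φ)
    {f g : EuclideanSpace ℝ (Fin m) → ℂ} (hf : IntegrableOn f (unitCube m))
    (hg : IntegrableOn g (unitCube m)) {h : EuclideanSpace ℝ (Fin m) × ℝ → ℂ}
    (hh : Integrable h) :
    ∫ w, trilinearIntegrand Φ f g h w ∂(trilinearMeasure m) =
      ∫ z, adjointRestriction Φ f z * adjointRestriction Φ g z * h z := by
  rw [trilinearMeasure, integral_prod _ (integrable_trilinearIntegrand hΦ hf hg hh)]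
  congr 1
  ext z
  rw [adjointRestriction_eq, adjointRestriction_eq, ← integral_prod_mul, ← integral_mul_const]
  congr 1
  ext w
  simp only [trilinearIntegrand]
  ring

lemma ae_fst_ne_snd (hm : 0 < m) :
    ∀ᵐ w ∂((volume : Measure (EuclideanSpace ℝ (Fin m))).restrict (unitCube m)).prod
      (volume.restrict (unitCube m)), w.1 ≠ w.2 := by
  have hd : MeasurableSet {w : EuclideanSpace ℝ (Fin m) × EuclideanSpace ℝ (Fin m) | w.1 = w.2} :=
    measurableSet_eq_fun measurable_fst measurable_snd
  rw [ae_iff]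
  simp only [ne_eq, not_not]
  rw [Measure.measure_prod_null hd]
  refine Filter.Eventually.of_forall fun y => ?_
  refine measure_mono_null ?_ (Measure.absolutelyContinuous_of_le Measure.restrict_le_self
    (volume_hyperplane ⟨0, hm⟩ (y ⟨0, hm⟩)))
  rintro y' (hy' : y = y')
  rw [Set.mem_ofPred_eq, hy']

/-- Triples whose frequencies lie in the cubes of a Whitney pair of scale `j` and in the sets `G i`
and `G i'`, and whose position lies in `H i₃`. -/
def whitneyCell (G : ℤ → Set (EuclideanSpace ℝ (Fin m)))
    (H : ℤ → Set (EuclideanSpace ℝ (Fin m) × ℝ))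
    (t : ℕ × ℤ × ℤ × ℤ × ((Fin m → ℤ) × (Fin m → ℤ))) :
    Set ((EuclideanSpace ℝ (Fin m) × ℝ) ×
      (EuclideanSpace ℝ (Fin m) × EuclideanSpace ℝ (Fin m))) :=
  {w | t.2.2.2.2 ∈ whitneyPairs m t.1 ∧ dyadicIndex (t.1 + 1) w.2.1 = t.2.2.2.2.1 ∧
    dyadicIndex (t.1 + 1) w.2.2 = t.2.2.2.2.2 ∧ w.2.1 ∈ G t.2.1 ∧ w.2.2 ∈ G t.2.2.1 ∧
    w.1 ∈ H t.2.2.2.1}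

lemma measurableSet_whitneyCell {G : ℤ → Set (EuclideanSpace ℝ (Fin m))}
    {H : ℤ → Set (EuclideanSpace ℝ (Fin m) × ℝ)} (hG : ∀ i, MeasurableSet (G i))
    (hH : ∀ i, MeasurableSet (H i)) (t : ℕ × ℤ × ℤ × ℤ × ((Fin m → ℤ) × (Fin m → ℤ))) :
    MeasurableSet (whitneyCell G H t) := by
  refine (MeasurableSet.const _).inter (MeasurableSet.inter ?_ (MeasurableSet.inter ?_
    (MeasurableSet.inter ?_ (MeasurableSet.inter ?_ ?_))))
  · exact (measurable_dyadicIndex _).comp measurable_snd.fst (measurableSet_singleton _)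
  · exact (measurable_dyadicIndex _).comp measurable_snd.snd (measurableSet_singleton _)
  · exact measurable_snd.fst (hG _)
  · exact measurable_snd.snd (hG _)
  · exact measurable_fst (hH _)

lemma pairwise_disjoint_whitneyCell {G : ℤ → Set (EuclideanSpace ℝ (Fin m))}
    {H : ℤ → Set (EuclideanSpace ℝ (Fin m) × ℝ)} (hG : Pairwise (Function.onFun Disjoint G))
    (hH : Pairwise (Function.onFun Disjoint H)) :
    Pairwise (Function.onFun Disjoint (whitneyCell G H)) := by
  rintro ⟨j, i, i', i₃, k, k'⟩ ⟨j₁, l, l', l₃, n, n'⟩ hne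
  refine Set.disjoint_left.2 fun w hw hw' => hne ?_
  obtain ⟨h1, h2, h3, h4, h5, h6⟩ := hw
  obtain ⟨g1, g2, g3, g4, g5, g6⟩ := hw'
  simp only at h1 h2 h3 h4 h5 h6 g1 g2 g3 g4 g5 g6
  have hj : j = j₁ := by
    rw [← h2, ← h3] at h1
    rw [← g2, ← g3] at g1
    exact eq_of_mem_whitneyPairs h1 g1
  subst hj
  have e1 : i = l := by
    by_contra hc
    exact Set.disjoint_left.1 (hG hc) h4 g4
  have e2 : i' = l' := by
    by_contra hc
    exact Set.disjoint_left.1 (hG hc) h5 g5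
  have e3 : i₃ = l₃ := by
    by_contra hc
    exact Set.disjoint_left.1 (hH hc) h6 g6
  rw [e1, e2, e3, ← h2, ← h3, ← g2, ← g3]

/-- On each cell the integrand is again that of a trilinear form, with `f` and `h` cut down to the
cubes and the atoms. -/
lemma indicator_whitneyCell_trilinearIntegrand (Φ : EuclideanSpace ℝ (Fin m) → ℝ)
    (f : EuclideanSpace ℝ (Fin m) → ℂ) (h : EuclideanSpace ℝ (Fin m) × ℝ → ℂ)
    (G : ℤ → Set (EuclideanSpace ℝ (Fin m))) (H : ℤ → Set (EuclideanSpace ℝ (Fin m) × ℝ))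
    {j : ℕ} {p : (Fin m → ℤ) × (Fin m → ℤ)} (hp : p ∈ whitneyPairs m j) (i i' i₃ : ℤ) :
    (whitneyCell G H (j, i, i', i₃, p)).indicator (trilinearIntegrand Φ f f h) =
      trilinearIntegrand Φ (dyadicPart (j + 1) p.1 ((G i).indicator f))
        (dyadicPart (j + 1) p.2 ((G i').indicator f)) ((H i₃).indicator h) := by
  classical
  ext w
  simp only [trilinearIntegrand, dyadicPart, Set.indicator_apply, whitneyCell, Set.mem_ofPred_eq, hp,
    true_and, Set.mem_preimage, Set.mem_singleton_iff]
  by_cases h1 : dyadicIndex (j + 1) w.2.1 = p.1 <;> by_cases h2 : dyadicIndex (j + 1) w.2.2 = p.2 <;>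
    by_cases h3 : w.2.1 ∈ G i <;> by_cases h4 : w.2.2 ∈ G i' <;> by_cases h5 : w.1 ∈ H i₃ <;>
    simp [h1, h2, h3, h4, h5]

/-- The trilinear form is dominated by the sum of its pieces over all Whitney pairs. -/
lemma enorm_integral_le_tsum_whitney (hm : 0 < m) {Φ : EuclideanSpace ℝ (Fin m) → ℝ}
    (hΦ : Measurable Φ) {f : EuclideanSpace ℝ (Fin m) → ℂ} (hf : IntegrableOn f (unitCube m))
    (hfQ : ∀ y, f y ≠ 0 → ∀ i, |y i| < 1) {h : EuclideanSpace ℝ (Fin m) × ℝ → ℂ}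
    (hh : Integrable h)
    {G : ℤ → Set (EuclideanSpace ℝ (Fin m))} {H : ℤ → Set (EuclideanSpace ℝ (Fin m) × ℝ)}
    (hG : ∀ i, MeasurableSet (G i)) (hH : ∀ i, MeasurableSet (H i))
    (hGd : Pairwise (Function.onFun Disjoint G)) (hHd : Pairwise (Function.onFun Disjoint H))
    (hGc : ∀ᵐ y, f y ≠ 0 → ∃ i, y ∈ G i) (hHc : ∀ᵐ z, h z ≠ 0 → ∃ i, z ∈ H i) :
    ‖∫ z, adjointRestriction Φ f z * adjointRestriction Φ f z * h z‖ₑ ≤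
      ∑' (j : ℕ) (i : ℤ) (i' : ℤ) (i₃ : ℤ), ∑ p ∈ whitneyPairs m j,
        ‖∫ z, adjointRestriction Φ (dyadicPart (j + 1) p.1 ((G i).indicator f)) z *
          adjointRestriction Φ (dyadicPart (j + 1) p.2 ((G i').indicator f)) z *
            (H i₃).indicator h z‖ₑ := by
  have hT := integrable_trilinearIntegrand hΦ hf hf hh
  have hae : ∀ᵐ w ∂(trilinearMeasure m), w ∉ ⋃ t, whitneyCell G H t →
      trilinearIntegrand Φ f f h w = 0 := by
    have a1 : ∀ᵐ w ∂(trilinearMeasure m), h w.1 ≠ 0 → ∃ i, w.1 ∈ H i :=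
      Measure.quasiMeasurePreserving_fst.ae hHc
    have hGc' := ae_restrict_of_ae (s := unitCube m) hGc
    have a2 : ∀ᵐ w ∂(trilinearMeasure m), f w.2.1 ≠ 0 → ∃ i, w.2.1 ∈ G i :=
      Measure.quasiMeasurePreserving_snd.ae (Measure.quasiMeasurePreserving_fst.ae hGc')
    have a3 : ∀ᵐ w ∂(trilinearMeasure m), f w.2.2 ≠ 0 → ∃ i, w.2.2 ∈ G i :=
      Measure.quasiMeasurePreserving_snd.ae (Measure.quasiMeasurePreserving_snd.ae hGc')
    have a4 : ∀ᵐ w ∂(trilinearMeasure m), w.2.1 ≠ w.2.2 :=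
      Measure.quasiMeasurePreserving_snd.ae (ae_fst_ne_snd hm)
    filter_upwards [a1, a2, a3, a4] with w b1 b2 b3 b4 hw
    by_contra hne
    simp only [trilinearIntegrand, mul_eq_zero, not_or] at hne
    obtain ⟨i₃, hi₃⟩ := b1 hne.2.1
    obtain ⟨i, hi⟩ := b2 hne.2.2.1
    obtain ⟨i', hi'⟩ := b3 hne.2.2.2
    obtain ⟨j, hj⟩ := exists_mem_whitneyPairs (hfQ _ hne.2.2.1) (hfQ _ hne.2.2.2) b4
    exact hw (Set.mem_iUnion.2 ⟨(j, i, i', i₃, _), hj, rfl, rfl, hi, hi', hi₃⟩)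
  rw [← integral_trilinearIntegrand hΦ hf hf hh,
    ← setIntegral_eq_integral_of_ae_compl_eq_zero hae,
    integral_iUnion (measurableSet_whitneyCell hG hH) (pairwise_disjoint_whitneyCell hGd hHd)
      hT.integrableOn]
  refine enorm_tsum_le_tsum_enorm.trans ?_
  rw [ENNReal.tsum_prod']
  refine ENNReal.tsum_le_tsum fun j => ?_
  rw [ENNReal.tsum_prod']
  refine ENNReal.tsum_le_tsum fun i => ?_
  rw [ENNReal.tsum_prod']
  refine ENNReal.tsum_le_tsum fun i' => ?_
  rw [ENNReal.tsum_prod']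
  refine ENNReal.tsum_le_tsum fun i₃ => ?_
  rw [tsum_eq_sum (s := whitneyPairs m j)]
  · refine Finset.sum_le_sum fun p hp => le_of_eq ?_
    have hdy : ∀ (k : Fin m → ℤ) (l : ℤ),
        IntegrableOn (dyadicPart (j + 1) k ((G l).indicator f)) (unitCube m) := fun k l =>
      Integrable.indicator (Integrable.indicator hf (hG l))
        (measurableSet_dyadicIndex_preimage (j + 1) k)
    rw [← integral_indicator (measurableSet_whitneyCell hG hH _),
      indicator_whitneyCell_trilinearIntegrand Φ f h G H hp,
      integral_trilinearIntegrand hΦ (hdy _ _) (hdy _ _) (hh.indicator (hH _))]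
  · intro p hp
    have : whitneyCell G H (j, i, i', i₃, p) = ∅ :=
      Set.eq_empty_of_forall_notMem fun w hw => hp hw.1
    rw [this]
    simp

end

/-! ### The global trilinear estimate -/

lemma tsum_two_rpow_mul_lt_top {c : ℝ} (hc : c < 0) :
    ∑' j : ℤ, (if 1 ≤ j then (2 : ℝ≥0∞) ^ (c * j) else 0) < ⊤ := by
  refine lt_of_le_of_lt (ENNReal.tsum_le_tsum fun j => ?_)
    (tsum_two_rpow_neg_mul_abs_lt_top (a := -c) (by linarith))
  split_ifs with h
  · have : (0 : ℝ) ≤ j := by exact_mod_cast (by omega : (0 : ℤ) ≤ j)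
    rw [abs_of_nonneg this]
    exact two_rpow_le_two_rpow (by linarith)
  · exact bot_le

/-- Atoms of height `l i` on sets of measure at most `2 ^ (-M i)` which carry the `L^p` norm of a
function, in the normalisation in which single scale estimates are expressed. -/
lemma tsum_atoms_rpow_le {X : Type*} [MeasurableSpace X] {μ : Measure X} {f : X → ℂ} {l : ℤ → ℝ}
    {M a : ℝ} (ha : 0 < a)
    (h : ∑' i : ℤ, (2 : ℝ≥0∞) ^ (-(M * i)) * ENNReal.ofReal (l i) ^ a⁻¹ ≤
      2 ^ (M + 1) * ∫⁻ x, ENNReal.ofReal ‖f x‖ ^ a⁻¹ ∂μ) :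
    (∑' i : ℤ, ((2 : ℝ≥0∞) ^ (-(M * a * i)) * ENNReal.ofReal (l i)) ^ a⁻¹) ^ (1 / a⁻¹) ≤
      2 ^ ((M + 1) * a) * eLpNorm f (ENNReal.ofReal a⁻¹) μ := by
  have ha' : 0 < a⁻¹ := inv_pos.2 ha
  rw [eLpNorm_eq_lintegral_rpow_enorm_toReal (by simpa using ha) (by simp),
    ENNReal.toReal_ofReal ha'.le, one_div, inv_inv, ENNReal.rpow_mul,
    ← ENNReal.mul_rpow_of_nonneg _ _ ha.le]
  refine ENNReal.rpow_le_rpow ?_ ha.le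
  simp_rw [ofReal_norm] at h
  refine le_trans (le_of_eq (tsum_congr fun i => ?_)) h
  rw [ENNReal.mul_rpow_of_nonneg _ _ ha'.le, ← ENNReal.rpow_mul]
  congr 2
  field_simp

section

variable {m : ℕ}

/-- The bound for the trilinear form, with a constant that depends on the phase only through the
constant of its Whitney estimates. Here `θ` is the loss from summing over the Whitney pairs of one
scale, and `(m + 2) b - 2 m (1 - a) + m θ` is the power of the scale which remains after all atoms
have been normalised. -/
lemma exists_trilinear_bound (hm : 0 < m) {a b α β θ : ℝ} (C : ℝ≥0) (hα : 0 < α) (hαa : α < a)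
    (ha1 : a + α ≤ 1) (hβ : 0 < β) (hβb : β < b) (hb1 : b + β < 1) (hθ : 0 ≤ θ) (hθ1 : θ ≤ 1)
    (hθS : max b (1 - b) + β - 2 * (a - α) ≤ θ)
    (hδ : (b ≤ 2 * a ∧ (m + 2) * b - 2 * m * (1 - a) + m * θ ≤ 0) ∨
      (m + 2) * b - 2 * m * (1 - a) + m * θ < 0) :
    ∃ K : ℝ≥0∞, K ≠ ⊤ ∧ ∀ Φ : EuclideanSpace ℝ (Fin m) → ℝ, Measurable Φ →
      WhitneyEstimate Φ (a + α) (b + β) C → WhitneyEstimate Φ (a + α) (b - β) C →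
      ∀ (f : EuclideanSpace ℝ (Fin m) → ℂ) (B : ℝ), Measurable f → (∀ y, ‖f y‖ ≤ B) →
        (∀ y, f y ≠ 0 → ∀ i, |y i| < 1) →
      ∀ (h : EuclideanSpace ℝ (Fin m) × ℝ → ℂ) (B' : ℝ), Measurable h → (∀ z, ‖h z‖ ≤ B') →
        volume {z | h z ≠ 0} < ⊤ →
      ‖∫ z, adjointRestriction Φ f z * adjointRestriction Φ f z * h z‖ₑ ≤
        K * eLpNorm f (ENNReal.ofReal a⁻¹) ^ 2 * eLpNorm h (ENNReal.ofReal (1 - b)⁻¹) := by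
  have ha : 0 < a := hα.trans hαa
  have hb : 0 < b := hβ.trans hβb
  have hb' : 0 < 1 - b := by linarith
  have hm' : (1 : ℝ) ≤ m := by exact_mod_cast hm
  have hqq : b⁻¹.HolderConjugate (1 - b)⁻¹ := by
    rw [Real.holderConjugate_iff]
    refine ⟨(one_lt_inv₀ hb).2 (by linarith), by rw [inv_inv, inv_inv]; ring⟩
  set δ : ℝ := (m + 2) * b - 2 * m * (1 - a) + m * θ with hδdef
  set w₁ : ℤ → ℝ≥0∞ := fun k => 2 ^ (-(m * α * |(k : ℝ)|)) with hw₁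
  set w₂ : ℤ → ℝ≥0∞ := fun k => 2 ^ (-((m + 2) * β * |(k : ℝ)|)) with hw₂
  -- The scales of the Whitney cubes are positive, whereas those of the atoms range over `ℤ`.
  set ϑ : ℤ → ℝ≥0∞ := fun j => if 1 ≤ j then (2 : ℝ≥0∞) ^ (δ * j) else 0 with hϑ
  obtain ⟨T, hT⟩ := exists_tsum_scales_le (p := a⁻¹) ((one_le_inv₀ ha).2 (by linarith)) hqq w₁ w₂
    (tsum_two_rpow_neg_mul_abs_lt_top (by positivity))
    (tsum_two_rpow_neg_mul_abs_lt_top (by positivity)) ϑ (by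
      rcases hδ with ⟨h1, h2⟩ | h2
      · refine Or.inl ⟨?_, fun j => ?_⟩
        · rw [inv_le_comm₀ ha (by positivity), mul_inv, inv_inv]
          linarith
        · simp only [hϑ]
          split_ifs with h
          · have : (0 : ℝ) ≤ j := by exact_mod_cast (by omega : (0 : ℤ) ≤ j)
            simpa using two_rpow_le_two_rpow (show δ * j ≤ 0 from mul_nonpos_of_nonpos_of_nonneg h2 this)
          · exact zero_le_one
      · refine Or.inr (lt_of_le_of_lt (ENNReal.tsum_le_tsum fun j => ?_)
          (tsum_two_rpow_mul_lt_top (c := δ * b⁻¹) (mul_neg_of_neg_of_pos h2 (inv_pos.2 hb))))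
        simp only [hϑ]
        split_ifs with h
        · rw [← ENNReal.rpow_mul]
          exact two_rpow_le_two_rpow (le_of_eq (by ring))
        · rw [ENNReal.zero_rpow_of_pos (inv_pos.2 hb)])
  refine ⟨scaleConst m C * (T * (2 ^ ((m + 1) * a)) ^ 2 * 2 ^ ((m + 2 + 1) * (1 - b))), ?_, ?_⟩
  · refine ENNReal.mul_ne_top (scaleConst_ne_top m C) (ENNReal.mul_ne_top (ENNReal.mul_ne_top
      ENNReal.coe_ne_top (ENNReal.pow_ne_top (two_rpow_ne_top _))) (two_rpow_ne_top _))
  intro Φ hΦ hW hW' f B hf hfB hfQ h B' hh hhB' hhfin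
  have hfi : IntegrableOn f (unitCube m) := integrableOn_unitCube_of_bounded hf hfB
  have hffin : volume {y | 0 < ‖f y‖} < ⊤ := by
    refine lt_of_le_of_lt (measure_mono fun y hy => ?_)
      (isCompact_cube (0 : EuclideanSpace ℝ (Fin m)) 1).measure_lt_top
    intro i
    simpa using (hfQ y (norm_pos_iff.1 hy) i).le
  have hhi : Integrable h := by
    have h1 : IntegrableOn h {z | h z ≠ 0} := Measure.integrableOn_of_bounded hhfin.ne
      hh.aestronglyMeasurable (Filter.Eventually.of_forall hhB')
    exact (integrableOn_iff_integrable_of_support_subset fun z hz => hz).1 h1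
  obtain ⟨l, G, hl0, hGm, hGd, hGv, hGl, hGc, hGs⟩ := exists_atomic_decomposition (μ := volume)
    (f := fun y => ‖f y‖) hf.norm (fun _ => norm_nonneg _) hfB hffin (inv_pos.2 ha) hm'
  obtain ⟨l₃, H, hl0₃, hHm, hHd, hHv, hHl, hHc, hHs⟩ := exists_atomic_decomposition (μ := volume)
    (f := fun z => ‖h z‖) hh.norm (fun _ => norm_nonneg _) hhB'
    (by simpa only [norm_pos_iff] using hhfin) (inv_pos.2 hb') (M := m + 2) (by linarith)
  -- The index of the atoms of `h` is reversed, so that the atom with index `i` lies on a set of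
  -- measure at most `2 ^ ((m + 2) i)`: this is the scale of a space-time region dual to a cap.
  have hdecomp := enorm_integral_le_tsum_whitney hm hΦ hfi hfQ hhi hGm (fun i => hHm (-i)) hGd
    (fun i i' hne => hHd (fun hc => hne (neg_injective hc)))
    (by simpa only [norm_pos_iff] using hGc)
    (by
      filter_upwards [hHc] with z hz hne
      obtain ⟨i, hi⟩ := hz (norm_pos_iff.2 hne)
      exact ⟨-i, by simpa using hi⟩)
  set A : ℤ → ℝ≥0∞ := fun i => 2 ^ (-(m * a * i)) * ENNReal.ofReal (l i) with hA
  set A₃ : ℤ → ℝ≥0∞ := fun i => 2 ^ ((m + 2) * (1 - b) * i) * ENNReal.ofReal (l₃ (-i)) with hA₃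
  have hfl : ∀ (i : ℤ) (y : EuclideanSpace ℝ (Fin m)), ‖(G i).indicator f y‖ₑ ≤
      (G i).indicator (fun _ => ENNReal.ofReal (l i)) y := fun i y => by
    by_cases hy : y ∈ G i
    · simpa [hy, ofReal_norm] using ENNReal.ofReal_le_ofReal (hGl i y hy)
    · simp [hy]
  have hhl : ∀ (i : ℤ) (z : EuclideanSpace ℝ (Fin m) × ℝ), ‖(H (-i)).indicator h z‖ₑ ≤
      (H (-i)).indicator (fun _ => ENNReal.ofReal (l₃ (-i))) z := fun i z => by
    by_cases hz : z ∈ H (-i)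
    · simpa [hz, ofReal_norm] using ENNReal.ofReal_le_ofReal (hHl (-i) z hz)
    · simp [hz]
  have hscale : ∀ (j : ℕ) (i i' i₃ : ℤ), ∑ p ∈ whitneyPairs m j,
      ‖∫ z, adjointRestriction Φ (dyadicPart (j + 1) p.1 ((G i).indicator f)) z *
        adjointRestriction Φ (dyadicPart (j + 1) p.2 ((G i').indicator f)) z *
          (H (-i₃)).indicator h z‖ₑ ≤
      scaleConst m C * (ϑ (j + 1 : ℤ) * (w₁ (i - (j + 1)) * A i) * (w₁ (i' - (j + 1)) * A i') *
        (w₂ (i₃ - (j + 1)) * A₃ i₃)) := fun j i i' i₃ => by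
    have hϑj : ϑ (j + 1 : ℤ) = 2 ^ (δ * (j + 1)) := by
      simp only [hϑ]
      rw [if_pos (by omega)]
      push_cast
      rfl
    rw [hϑj]
    exact sum_enorm_integral_le_of_whitneyEstimate hΦ hW hW' hα hαa ha1 hβ hβb hb1 hθ hθ1 hθS j
      (hf.indicator (hGm i)) (hf.indicator (hGm i'))
      (fun y => (norm_indicator_le_norm_self _ _).trans (hfB y))
      (fun y => (norm_indicator_le_norm_self _ _).trans (hfB y)) (hGm i) (hGm i') (hfl i) (hfl i')
      (hGv i) (hGv i') (hh.indicator (hHm (-i₃))) ENNReal.ofReal_ne_top (hHm (-i₃))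
      ((hHv (-i₃)).trans (two_rpow_le_two_rpow (le_of_eq (by push_cast; ring)))) (hhl i₃)
  have hsum : ∀ (c : ℝ≥0∞) (X Y Z : ℤ → ℝ≥0∞), ∑' (i : ℤ) (i' : ℤ) (i₃ : ℤ),
      scaleConst m C * (c * X i * Y i' * Z i₃) =
        scaleConst m C * (c * (∑' i, X i) * (∑' i, Y i) * ∑' i, Z i) := fun c X Y Z => by
    simp_rw [ENNReal.tsum_mul_left, ENNReal.tsum_mul_right, ENNReal.tsum_mul_left,
      ENNReal.tsum_mul_right, ENNReal.tsum_mul_left]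
  set Λ : ℤ → ℝ≥0∞ := fun j => ϑ j * (∑' i, w₁ (i - j) * A i) * (∑' i, w₁ (i - j) * A i) *
    ∑' i, w₂ (i - j) * A₃ i with hΛ
  have hnorm₁ : (∑' i, A i ^ a⁻¹) ^ (1 / a⁻¹) ≤
      2 ^ ((m + 1) * a) * eLpNorm f (ENNReal.ofReal a⁻¹) := tsum_atoms_rpow_le ha hGs
  have hnorm₃ : (∑' i, A₃ i ^ (1 - b)⁻¹) ^ (1 / (1 - b)⁻¹) ≤
      2 ^ ((m + 2 + 1) * (1 - b)) * eLpNorm h (ENNReal.ofReal (1 - b)⁻¹) := by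
    refine le_trans (le_of_eq ?_) (tsum_atoms_rpow_le hb' hHs)
    congr 1
    rw [← (Equiv.neg ℤ).tsum_eq]
    refine tsum_congr fun i => ?_
    simp only [hA₃, Equiv.neg_apply, neg_neg]
    push_cast
    ring_nf
  calc ‖∫ z, adjointRestriction Φ f z * adjointRestriction Φ f z * h z‖ₑ ≤ _ := hdecomp
    _ ≤ ∑' (j : ℕ) (i : ℤ) (i' : ℤ) (i₃ : ℤ), scaleConst m C * (ϑ (j + 1 : ℤ) *
          (w₁ (i - (j + 1)) * A i) * (w₁ (i' - (j + 1)) * A i') * (w₂ (i₃ - (j + 1)) * A₃ i₃)) :=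
        ENNReal.tsum_le_tsum fun j => ENNReal.tsum_le_tsum fun i => ENNReal.tsum_le_tsum fun i' =>
          ENNReal.tsum_le_tsum fun i₃ => hscale j i i' i₃
    _ = ∑' j : ℕ, scaleConst m C * Λ (j + 1 : ℤ) := tsum_congr fun j => hsum _ _ _ _
    _ = scaleConst m C * ∑' j : ℕ, Λ (j + 1 : ℤ) := ENNReal.tsum_mul_left
    _ ≤ scaleConst m C * ∑' j : ℤ, Λ j := by
        refine mul_le_mul' le_rfl ?_
        exact ENNReal.tsum_comp_le_tsum_of_injective
          (f := fun j : ℕ => (j + 1 : ℤ)) (fun x y hxy => by simpa using hxy) Λ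
    _ ≤ scaleConst m C * (T * (2 ^ ((m + 1) * a) * eLpNorm f (ENNReal.ofReal a⁻¹)) ^ 2 *
          (2 ^ ((m + 2 + 1) * (1 - b)) * eLpNorm h (ENNReal.ofReal (1 - b)⁻¹))) := by
        refine mul_le_mul' le_rfl ((hT A A₃).trans ?_)
        exact mul_le_mul' (mul_le_mul' le_rfl (pow_le_pow_left' hnorm₁ 2)) hnorm₃
    _ = _ := by ring

end

/-! ### Duality -/

lemma ENNReal.le_rpow_of_le_mul_rpow {I B : ℝ≥0∞} {q q' : ℝ} (hqq : q.HolderConjugate q')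
    (hI : I ≠ ⊤) (h : I ≤ B * I ^ (1 / q')) : I ≤ B ^ q := by
  rcases eq_or_ne I 0 with rfl | hI0
  · exact bot_le
  have hq := hqq.pos
  have h1 : 1 / q = 1 + -(1 / q') := by
    have := hqq.inv_add_inv_eq_one
    rw [one_div, one_div]
    linarith
  have h2 : I ^ (1 / q) ≤ B := by
    rw [h1, ENNReal.rpow_add _ _ hI0 hI, ENNReal.rpow_one, ENNReal.rpow_neg]
    refine (mul_le_mul' h le_rfl).trans (le_of_eq ?_)
    rw [mul_assoc, ENNReal.mul_inv_cancel, mul_one]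
    · simp [ENNReal.rpow_eq_zero_iff, hI0, hI]
    · simp [ENNReal.rpow_eq_top_iff, hI0, hI]
  calc I = (I ^ (1 / q)) ^ q := by
        rw [← ENNReal.rpow_mul, one_div_mul_cancel hq.ne', ENNReal.rpow_one]
    _ ≤ B ^ q := ENNReal.rpow_le_rpow h2 hq.le

/-- The `L^q` norm of a bounded function is found by testing against bounded functions whose
support has finite measure. -/
lemma eLpNorm_le_of_forall_enorm_integral_mul_le {X : Type*} [MeasurableSpace X] {μ : Measure X}
    [SigmaFinite μ] {F : X → ℂ} (hF : Measurable F) {K : ℝ} (hK : ∀ x, ‖F x‖ ≤ K) {q q' : ℝ}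
    (hqq : q.HolderConjugate q') {B : ℝ≥0∞}
    (h : ∀ (h : X → ℂ) (B' : ℝ), Measurable h → (∀ x, ‖h x‖ ≤ B') → μ {x | h x ≠ 0} < ⊤ →
      ‖∫ x, F x * h x ∂μ‖ₑ ≤ B * eLpNorm h (ENNReal.ofReal q') μ) :
    eLpNorm F (ENNReal.ofReal q) μ ≤ B := by
  have hq := hqq.pos
  have hq' := hqq.symm.pos
  have hq1 : 0 < q - 1 := by linarith [hqq.lt]
  have hset : ∀ S : Set X, MeasurableSet S → μ S < ⊤ → ∫⁻ x in S, ‖F x‖ₑ ^ q ∂μ ≤ B ^ q := by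
    intro S hS hSt
    set k : X → ℂ := S.indicator fun x => starRingEnd ℂ (F x) * ((‖F x‖ ^ (q - 2) : ℝ) : ℂ) with hk
    have hkm : Measurable k := by
      refine Measurable.indicator ?_ hS
      exact (Complex.continuous_conj.measurable.comp hF).mul
        (Complex.measurable_ofReal.comp (hF.norm.pow_const _))
    have hknorm : ∀ x ∈ S, ‖k x‖ = ‖F x‖ ^ (q - 1) := fun x hx => by
      rw [hk, Set.indicator_of_mem hx, norm_mul, RCLike.norm_conj, Complex.norm_real,
        Real.norm_of_nonneg (by positivity)]
      rcases eq_or_ne (F x) 0 with h0 | h0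
      · simp [h0, Real.zero_rpow hq1.ne']
      · have hpos := norm_pos_iff.2 h0
        nth_rewrite 1 [← Real.rpow_one ‖F x‖]
        rw [← Real.rpow_add hpos]
        congr 1
        ring
    have hk0 : ∀ x ∉ S, k x = 0 := fun x hx => Set.indicator_of_notMem hx _
    have hFk : ∀ x, F x * k x = ((S.indicator (fun x => ‖F x‖ ^ q) x : ℝ) : ℂ) := fun x => by
      by_cases hx : x ∈ S
      · rw [hk, Set.indicator_of_mem hx, Set.indicator_of_mem hx, ← mul_assoc, Complex.mul_conj,
          Complex.normSq_eq_norm_sq, ← Complex.ofReal_mul]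
        congr 1
        rcases eq_or_ne (F x) 0 with h0 | h0
        · simp [h0, Real.zero_rpow hq.ne']
        · have hpos := norm_pos_iff.2 h0
          rw [← Real.rpow_natCast, ← Real.rpow_add hpos]
          congr 1
          push_cast
          ring
      · simp [hk0 x hx, hx]
    have hlint : ∀ r : ℝ, 0 ≤ r → ∀ x, ENNReal.ofReal (‖F x‖ ^ r) = ‖F x‖ₑ ^ r := fun r hr x => by
      rw [← ENNReal.ofReal_rpow_of_nonneg (norm_nonneg _) hr, ofReal_norm]
    set I := ∫⁻ x in S, ‖F x‖ₑ ^ q ∂μ with hI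
    have hIt : I ≠ ⊤ := by
      have h1 : I ≤ ∫⁻ _ in S, ENNReal.ofReal K ^ q ∂μ := lintegral_mono fun x =>
        ENNReal.rpow_le_rpow (by rw [← ofReal_norm]; exact ENNReal.ofReal_le_ofReal (hK x)) hq.le
      refine (h1.trans_lt ?_).ne
      rw [setLIntegral_const]
      exact ENNReal.mul_lt_top (ENNReal.rpow_lt_top_of_nonneg hq.le ENNReal.ofReal_ne_top) hSt
    have hint : ‖∫ x, F x * k x ∂μ‖ₑ = I := by
      have h0 : (fun x => F x * k x) =
          fun x => ((S.indicator (fun x => ‖F x‖ ^ q) x : ℝ) : ℂ) := funext hFk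
      rw [h0, integral_complex_ofReal, ← ofReal_norm, Complex.norm_real,
        integral_indicator hS, Real.norm_of_nonneg (integral_nonneg fun x => by positivity),
        integral_eq_lintegral_of_nonneg_ae (Filter.Eventually.of_forall fun x => by positivity)
          (hF.norm.pow_const q).aestronglyMeasurable]
      simp_rw [hlint q hq.le]
      exact ENNReal.ofReal_toReal hIt
    have heL : eLpNorm k (ENNReal.ofReal q') μ = I ^ (1 / q') := by
      rw [eLpNorm_eq_lintegral_rpow_enorm_toReal (by simpa using hq') (by simp),
        ENNReal.toReal_ofReal hq'.le, hI, ← lintegral_indicator hS]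
      congr 1
      refine lintegral_congr fun x => ?_
      by_cases hx : x ∈ S
      · rw [Set.indicator_of_mem hx, ← ofReal_norm, hknorm x hx, hlint _ hq1.le,
          ← ENNReal.rpow_mul]
        congr 1
        exact hqq.sub_one_mul_conj
      · simp [hx, hk0 x hx, hq']
    refine ENNReal.le_rpow_of_le_mul_rpow hqq hIt ?_
    rw [← hint, ← heL] at *
    refine h k (max (K ^ (q - 1)) 0) hkm (fun x => ?_) (lt_of_le_of_lt (measure_mono fun x hx => ?_) hSt)
    · by_cases hx : x ∈ S
      · rw [hknorm x hx]
        exact le_max_of_le_left (Real.rpow_le_rpow (norm_nonneg _) (hK x) hq1.le)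
      · rw [hk0 x hx, norm_zero]
        exact le_max_right _ _
    · by_contra hxS
      exact hx (hk0 x hxS)
  rw [eLpNorm_eq_lintegral_rpow_enorm_toReal (by simpa using hq) (by simp),
    ENNReal.toReal_ofReal hq.le]
  have hall : ∫⁻ x, ‖F x‖ₑ ^ q ∂μ ≤ B ^ q := by
    rw [← setLIntegral_univ, ← iUnion_spanningSets μ,
      setLIntegral_iUnion_of_directed _ (monotone_spanningSets μ).directed_le]
    exact iSup_le fun i => hset _ (measurableSet_spanningSets μ i) (measure_spanningSets_lt_top μ i)
  calc (∫⁻ x, ‖F x‖ₑ ^ q ∂μ) ^ (1 / q) ≤ (B ^ q) ^ (1 / q) :=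
        ENNReal.rpow_le_rpow hall (by positivity)
    _ = B := by rw [← ENNReal.rpow_mul, mul_one_div_cancel hq.ne', ENNReal.rpow_one]

lemma eLpNorm_mul_self {X : Type*} [MeasurableSpace X] {μ : Measure X} (F : X → ℂ) {q : ℝ}
    (hq : 0 < q) : eLpNorm (fun x => F x * F x) (ENNReal.ofReal q) μ =
      eLpNorm F (ENNReal.ofReal (2 * q)) μ ^ 2 := by
  have h2q : 0 < 2 * q := by positivity
  rw [eLpNorm_eq_lintegral_rpow_enorm_toReal (ENNReal.ofReal_pos.2 hq).ne' ENNReal.ofReal_ne_top,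
    eLpNorm_eq_lintegral_rpow_enorm_toReal (ENNReal.ofReal_pos.2 h2q).ne' ENNReal.ofReal_ne_top,
    ENNReal.toReal_ofReal hq.le, ENNReal.toReal_ofReal h2q.le, ← ENNReal.rpow_natCast,
    ← ENNReal.rpow_mul]
  have h1 : ∀ x, ‖F x * F x‖ₑ ^ q = ‖F x‖ₑ ^ (2 * q) := fun x => by
    rw [enorm_mul, ← pow_two, ← ENNReal.rpow_natCast, ← ENNReal.rpow_mul]
    norm_num
  simp_rw [h1]
  congr 1
  push_cast
  field_simp

lemma eLpNorm_mul_le_of_two_mul {X : Type*} [MeasurableSpace X] {μ : Measure X} {F G : X → ℂ}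
    {q : ℝ} (hq : 0 < q) (hF : AEStronglyMeasurable F μ) (hG : AEStronglyMeasurable G μ) :
    eLpNorm (fun x => F x * G x) (ENNReal.ofReal q) μ ≤
      eLpNorm F (ENNReal.ofReal (2 * q)) μ * eLpNorm G (ENNReal.ofReal (2 * q)) μ := by
  have hexp : ENNReal.HolderTriple (ENNReal.ofReal (2 * q)) (ENNReal.ofReal (2 * q))
      (ENNReal.ofReal q) := by
    refine ⟨?_⟩
    rw [← ENNReal.ofReal_inv_of_pos (by positivity), ← ENNReal.ofReal_inv_of_pos hq,
      ← ENNReal.ofReal_add (by positivity) (by positivity)]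
    congr 1
    field_simp
    norm_num
  have h := eLpNorm_smul_le_mul_eLpNorm (p := ENNReal.ofReal (2 * q)) (q := ENNReal.ofReal (2 * q))
    (r := ENNReal.ofReal q) hG hF
  have e : F • G = fun x => F x * G x := rfl
  rwa [e] at h

/-! ### Perturbing the exponents -/

/-- The open conditions on the exponents leave room for the perturbation which the bilinear
hypothesis permits. If `2 a > max b (1 - b)`, no loss `θ` occurs; otherwise the loss is compensated
by the strict inequality `(m + 1) b < m`. -/
lemma exists_exponent_perturbation {m : ℕ} (hm : 0 < m) {a b : ℝ} (ha : 0 < a) (ha1 : a < 1)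
    (hb : 0 < b) (hb1 : b < 1) (hbm : (m + 1) * b < m) (hab : (m + 2) * b ≤ 2 * m * (1 - a))
    {U : Set (ℝ × ℝ)} (hU : U ∈ 𝓝 (a, b)) :
    ∃ α β θ : ℝ, 0 < α ∧ α < a ∧ a + α ≤ 1 ∧ 0 < β ∧ β < b ∧ b + β < 1 ∧ 0 ≤ θ ∧ θ ≤ 1 ∧
      max b (1 - b) + β - 2 * (a - α) ≤ θ ∧
      ((b ≤ 2 * a ∧ (m + 2) * b - 2 * m * (1 - a) + m * θ ≤ 0) ∨
        (m + 2) * b - 2 * m * (1 - a) + m * θ < 0) ∧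
      (a + α, b + β) ∈ U ∧ (a + α, b - β) ∈ U := by
  have hm' : (1 : ℝ) ≤ m := by exact_mod_cast hm
  have hlt : ∀ c : ℝ, 0 < c → ∀ᶠ t in 𝓝[>] (0 : ℝ), t < c := fun c hc =>
    (eventually_lt_nhds hc).filter_mono nhdsWithin_le_nhds
  have hU1 : ∀ᶠ t in 𝓝[>] (0 : ℝ), (a + t, b + t) ∈ U := by
    have hc : Filter.Tendsto (fun t : ℝ => (a + t, b + t)) (𝓝 0) (𝓝 (a, b)) := by
      have : Continuous fun t : ℝ => (a + t, b + t) := by fun_prop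
      simpa using this.tendsto 0
    exact (hc.eventually hU).filter_mono nhdsWithin_le_nhds
  have hU2 : ∀ᶠ t in 𝓝[>] (0 : ℝ), (a + t, b - t) ∈ U := by
    have hc : Filter.Tendsto (fun t : ℝ => (a + t, b - t)) (𝓝 0) (𝓝 (a, b)) := by
      have : Continuous fun t : ℝ => (a + t, b - t) := by fun_prop
      simpa using this.tendsto 0
    exact (hc.eventually hU).filter_mono nhdsWithin_le_nhds
  have hmax1 : max b (1 - b) < 1 := max_lt hb1 (by linarith)
  have hbmax := le_max_left b (1 - b)
  rcases lt_or_ge (max b (1 - b)) (2 * a) with h2a | h2a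
  · obtain ⟨t, h1, h2, h3, h4, h5, h6, h7, h8⟩ := (hU1.and (hU2.and ((hlt a ha).and
      ((hlt (1 - a) (by linarith)).and ((hlt b hb).and ((hlt (1 - b) (by linarith)).and
        ((hlt ((2 * a - max b (1 - b)) / 3) (by linarith)).and self_mem_nhdsWithin))))))).exists
    have ht : 0 < t := h8
    exact ⟨t, t, 0, ht, h3, by linarith, ht, h5, by linarith, le_rfl, zero_le_one, by linarith,
      Or.inl ⟨by linarith, by linarith⟩, h1, h2⟩
  -- With `θ` close to `max b (1 - b) - 2 a`, the remaining power is close to `hneg`, which does not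
  -- depend on `a`.
  · have hneg : (m + 2) * b - 2 * m + m * max b (1 - b) < 0 := by
      rcases le_total b (1 - b) with hle | hle
      · rw [max_eq_right hle]
        have : 2 * b < m := by
          rcases hm'.eq_or_lt with h1 | h1
          · rw [← h1] at hbm ⊢; linarith
          · have : (2 : ℝ) ≤ m := by exact_mod_cast (by exact_mod_cast h1 : 1 < m)
            linarith
        nlinarith
      · rw [max_eq_left hle]
        nlinarith
    set X : ℝ := -((m + 2) * b - 2 * m + m * max b (1 - b)) with hX
    have hX0 : 0 < X := by linarith
    obtain ⟨t, h1, h2, h3, h4, h5, h6, h7, h8, h9⟩ := (hU1.and (hU2.and ((hlt a ha).and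
      ((hlt (1 - a) (by linarith)).and ((hlt b hb).and ((hlt (1 - b) (by linarith)).and
        ((hlt (X / (3 * m)) (by positivity)).and
          ((hlt ((1 - max b (1 - b)) / 3) (by linarith)).and self_mem_nhdsWithin)))))))).exists
    have ht : 0 < t := h9
    rw [lt_div_iff₀ (by positivity)] at h7
    refine ⟨t, t, max b (1 - b) + t - 2 * (a - t), ht, h3, by linarith, ht, h5, by linarith,
      by linarith, by linarith, le_rfl, Or.inr ?_, h1, h2⟩
    have : (m + 2) * b - 2 * m * (1 - a) + m * (max b (1 - b) + t - 2 * (a - t)) =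
        -X + t * (3 * m) := by rw [hX]; ring
    rw [this]
    linarith

/-! ### The equivalence of linear and bilinear estimates -/

/-- Hölder's inequality. The separation of the cubes plays no role. -/
lemma LinearRestrictionEstimate.bilinear {n N : ℕ} {A ε p q : ℝ} (hq : 0 < q)
    (h : LinearRestrictionEstimate n A N ε (ENNReal.ofReal p) (ENNReal.ofReal (2 * q))) :
    BilinearRestrictionEstimate n A N ε (ENNReal.ofReal p) (ENNReal.ofReal p)
      (ENNReal.ofReal q) := by
  obtain ⟨C, hC⟩ := h
  refine fun κ _ => ⟨C * C, fun Φ hΦ c₁ c₂ r₁ r₂ hsep f g hf hg => ?_⟩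
  have hf' : IsTestFunctionOn (unitCube (n - 1)) f :=
    ⟨hf.contDiff, hf.support_subset.trans hsep.subset_left⟩
  have hg' : IsTestFunctionOn (unitCube (n - 1)) g :=
    ⟨hg.contDiff, hg.support_subset.trans hsep.subset_right⟩
  -- The phase is only known to be regular on `Q`; its cutoff to `Q` is globally measurable.
  have heq : Set.EqOn Φ ((unitCube (n - 1)).indicator Φ) (unitCube (n - 1)) := fun y hy =>
    (Set.indicator_of_mem hy Φ).symm
  have hmeas : ∀ e : EuclideanSpace ℝ (Fin (n - 1)) → ℂ, IsTestFunctionOn (unitCube (n - 1)) e →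
      AEStronglyMeasurable (adjointRestriction Φ e) volume := fun e he => by
    rw [adjointRestriction_congr heq]
    exact (continuous_adjointRestriction hΦ.measurable_indicator
      (he.contDiff.continuous.continuousOn.integrableOn_compact
        (isCompact_cube 0 1))).aestronglyMeasurable
  calc eLpNorm (fun z => adjointRestriction Φ f z * adjointRestriction Φ g z) (ENNReal.ofReal q)
        volume
      ≤ eLpNorm (adjointRestriction Φ f) (ENNReal.ofReal (2 * q)) volume *
          eLpNorm (adjointRestriction Φ g) (ENNReal.ofReal (2 * q)) volume :=
        eLpNorm_mul_le_of_two_mul hq (hmeas f hf') (hmeas g hg')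
    _ ≤ (C * eLpNorm f (ENNReal.ofReal p) volume) * (C * eLpNorm g (ENNReal.ofReal p) volume) :=
        mul_le_mul' (hC Φ hΦ f hf') (hC Φ hΦ g hg')
    _ = _ := by push_cast; ring

lemma ae_mem_openCube {m : ℕ} :
    ∀ᵐ y ∂(volume : Measure (EuclideanSpace ℝ (Fin m))), y ∈ unitCube m → ∀ i, |y i| < 1 := by
  have h : ∀ i : Fin m, ∀ᵐ y ∂(volume : Measure (EuclideanSpace ℝ (Fin m))), y i ≠ 1 ∧ y i ≠ -1 :=
    fun i => by
      have h1 := volume_hyperplane (m := m) i 1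
      have h2 := volume_hyperplane (m := m) i (-1)
      exact (measure_eq_zero_iff_ae_notMem.1 h1).and (measure_eq_zero_iff_ae_notMem.1 h2)
  filter_upwards [ae_all_iff.2 h] with y hy hyQ i
  have h1 : |y i| ≤ 1 := by simpa using hyQ i
  refine lt_of_le_of_ne h1 fun hc => ?_
  rcases eq_or_eq_neg_of_abs_eq hc with h2 | h2
  · exact (hy i).1 h2
  · exact (hy i).2 h2

/-- Bilinear estimates in a neighbourhood of `(a, b) = (1 / p, 1 / q)` give the linear estimate. Only
the two exponents `(a + α, b ± β)` of the neighbourhood are used. -/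
lemma linearRestrictionEstimate_of_bilinear {n N : ℕ} (hn : 2 ≤ n) (hN : 2 ≤ N) {A A' ε a b : ℝ}
    (hε : ε ≤ 1) (hAA : A ≤ A') (hA' : 2 * (1 + ((n - 1 : ℕ) : ℝ) ^ 2) ^ 2 ≤ A')
    (ha : 0 < a) (ha1 : a < 1) (hb : 0 < b) (hb1 : b < 1)
    (hbm : (((n - 1 : ℕ) : ℝ) + 1) * b < (n - 1 : ℕ))
    (hab : (((n - 1 : ℕ) : ℝ) + 2) * b ≤ 2 * (n - 1 : ℕ) * (1 - a))
    {U : Set (ℝ × ℝ)} (hU : U ∈ 𝓝 (a, b))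
    (h : ∀ a' b' : ℝ, 0 < a' → 0 < b' → (a', b') ∈ U → BilinearRestrictionEstimate n A' N ε
      (ENNReal.ofReal a'⁻¹) (ENNReal.ofReal a'⁻¹) (ENNReal.ofReal b'⁻¹)) :
    LinearRestrictionEstimate n A N ε (ENNReal.ofReal a⁻¹) (ENNReal.ofReal (2 * b⁻¹)) := by
  have hm : 0 < n - 1 := by omega
  obtain ⟨α, β, θ, hα, hαa, haα, hβ, hβb, hbβ, hθ, hθ1, hθS, hδ, hU1, hU2⟩ :=
    exists_exponent_perturbation hm ha ha1 hb hb1 hbm hab hU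
  obtain ⟨C₁, hC₁⟩ := (h _ _ (by linarith) (by linarith) hU1).exists_whitneyEstimate hN hε hAA hA'
    (by linarith) haα (by linarith)
  obtain ⟨C₂, hC₂⟩ := (h _ _ (by linarith) (by linarith) hU2).exists_whitneyEstimate hN hε hAA hA'
    (by linarith) haα (by linarith)
  obtain ⟨K, hKt, hK⟩ := exists_trilinear_bound hm (max C₁ C₂) hα hαa haα hβ hβb hbβ hθ hθ1 hθS hδ
  have hqq : b⁻¹.HolderConjugate (1 - b)⁻¹ := by
    rw [Real.holderConjugate_iff]
    refine ⟨(one_lt_inv₀ hb).2 hb1, by rw [inv_inv, inv_inv]; ring⟩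
  refine ⟨(K ^ (1 / 2 : ℝ)).toNNReal, fun Φ hΦ f hf => ?_⟩
  rw [ENNReal.coe_toNNReal (ENNReal.rpow_ne_top_of_nonneg (by norm_num) hKt)]
  set Ψ := (unitCube (n - 1)).indicator Φ with hΨ
  have heq : Set.EqOn Φ Ψ (unitCube (n - 1)) := fun y hy => (Set.indicator_of_mem hy Φ).symm
  have hΨm : Measurable Ψ := hΦ.measurable_indicator
  have hΨe : IsEllipticPhase A N ε Ψ := hΦ.congr heq
  -- Removing the boundary of `Q` makes the half-open dyadic cubes cover the support.
  set O : Set (EuclideanSpace ℝ (Fin (n - 1))) := {y | ∀ i, |y i| < 1} with hO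
  have hOm : MeasurableSet O := by
    rw [hO, Set.ofPred_forall]
    refine MeasurableSet.iInter fun i => measurableSet_lt ?_ measurable_const
    fun_prop
  set f₀ := O.indicator f with hf₀
  have hfc := hf.contDiff.continuous
  obtain ⟨B, hB⟩ : ∃ B : ℝ, ∀ y, ‖f y‖ ≤ B := by
    obtain ⟨B, hB⟩ := (isCompact_cube (0 : EuclideanSpace ℝ (Fin (n - 1))) 1).exists_bound_of_continuousOn
      hfc.continuousOn
    refine ⟨max B 0, fun y => ?_⟩
    by_cases hy : y ∈ unitCube (n - 1)
    · exact le_max_of_le_left (hB y hy)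
    · have : f y = 0 := by
        by_contra hne
        exact hy (hf.support_subset hne)
      simp [this]
  have hf₀m : Measurable f₀ := hfc.measurable.indicator hOm
  have hf₀B : ∀ y, ‖f₀ y‖ ≤ B := fun y => (norm_indicator_le_norm_self _ _).trans (hB y)
  have hres : adjointRestriction Φ f = adjointRestriction Ψ f₀ := by
    rw [adjointRestriction_congr heq]
    ext z
    rw [adjointRestriction_eq, adjointRestriction_eq]
    refine setIntegral_congr_ae (isClosed_cube 0 1).measurableSet ?_
    filter_upwards [ae_mem_openCube] with y hy hyQ
    have hyO : y ∈ O := hy hyQ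
    rw [hf₀, Set.indicator_of_mem hyO]
  have hf₀i := integrableOn_unitCube_of_bounded hf₀m hf₀B
  have hsq : eLpNorm (fun z => adjointRestriction Ψ f₀ z * adjointRestriction Ψ f₀ z)
      (ENNReal.ofReal b⁻¹) volume ≤ K * eLpNorm f₀ (ENNReal.ofReal a⁻¹) volume ^ 2 := by
    have hc := continuous_adjointRestriction hΨm hf₀i
    refine eLpNorm_le_of_forall_enorm_integral_mul_le (hc.mul hc).measurable
      (K := (∫ y in unitCube (n - 1), ‖f₀ y‖) * ∫ y in unitCube (n - 1), ‖f₀ y‖) (fun z => ?_) hqq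
      fun k B' hk hkB hkfin => ?_
    · rw [Pi.mul_apply, norm_mul]
      exact mul_le_mul (norm_adjointRestriction_le _ _ _) (norm_adjointRestriction_le _ _ _)
        (norm_nonneg _) (integral_nonneg fun _ => norm_nonneg _)
    · exact hK Ψ hΨm ((hC₁ Ψ hΨm hΨe).mono (le_max_left _ _))
        ((hC₂ Ψ hΨm hΨe).mono (le_max_right _ _)) f₀ B hf₀m hf₀B
        (fun y hy => Set.mem_of_indicator_ne_zero hy) k B' hk hkB hkfin
  rw [eLpNorm_mul_self _ (inv_pos.2 hb)] at hsq
  rw [hres]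
  calc eLpNorm (adjointRestriction Ψ f₀) (ENNReal.ofReal (2 * b⁻¹)) volume
      = (eLpNorm (adjointRestriction Ψ f₀) (ENNReal.ofReal (2 * b⁻¹)) volume ^ 2) ^ (1 / 2 : ℝ) := by
        rw [← ENNReal.rpow_natCast, ← ENNReal.rpow_mul]
        norm_num
    _ ≤ (K * eLpNorm f₀ (ENNReal.ofReal a⁻¹) volume ^ 2) ^ (1 / 2 : ℝ) :=
        ENNReal.rpow_le_rpow hsq (by norm_num)
    _ = K ^ (1 / 2 : ℝ) * eLpNorm f₀ (ENNReal.ofReal a⁻¹) volume := by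
        rw [ENNReal.mul_rpow_of_nonneg _ _ (by norm_num), ← ENNReal.rpow_natCast,
          ← ENNReal.rpow_mul]
        norm_num
    _ ≤ K ^ (1 / 2 : ℝ) * eLpNorm f (ENNReal.ofReal a⁻¹) volume :=
        mul_le_mul' le_rfl (eLpNorm_indicator_le f)

theorem mainTheorem4 (n : ℕ) (hn : 2 ≤ n) :
    ∃ (N₀ : ℕ) (ε₁ A₀ : ℝ), 0 < ε₁ ∧ 0 < A₀ ∧
      ∀ N : ℕ, N₀ ≤ N → ∀ ε : ℝ, 0 < ε → ε ≤ ε₁ → ∀ A : ℝ, 0 < A →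
      ∀ p q : ℝ, 1 < p → 1 < q →
        2 * (n : ℝ) / ((n : ℝ) - 1) < 2 * q →
        Real.conjExponent p ≤ ((n : ℝ) - 1) / ((n : ℝ) + 1) * (2 * q) →
        (LinearRestrictionEstimate n A N ε (ENNReal.ofReal p) (ENNReal.ofReal (2 * q)) →
          BilinearRestrictionEstimate n A N ε
            (ENNReal.ofReal p) (ENNReal.ofReal p) (ENNReal.ofReal q)) ∧
        ((∃ U ∈ 𝓝 ((1 / p, 1 / q) : ℝ × ℝ), ∀ p₁ q₁ : ℝ, 0 < p₁ → 0 < q₁ →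
            (1 / p₁, 1 / q₁) ∈ U →
            BilinearRestrictionEstimate n (max A A₀) N ε
              (ENNReal.ofReal p₁) (ENNReal.ofReal p₁) (ENNReal.ofReal q₁)) →
          LinearRestrictionEstimate n A N ε (ENNReal.ofReal p) (ENNReal.ofReal (2 * q))) := by
  -- `N₀ = 2` and `ε₁ = 1` suffice for the Hessian to exist with entries at most `2`; `A₀` bounds the
  -- derivatives of order at most two of a function on `Q` with such a Hessian which vanishes to first
  -- order at the origin.
  refine ⟨2, 1, 2 * (1 + ((n - 1 : ℕ) : ℝ) ^ 2) ^ 2, one_pos, by positivity,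
    fun N hN ε _ hε A _ p q hp hq hq2 hpq => ⟨fun h => h.bilinear (by linarith), ?_⟩⟩
  rintro ⟨U, hU, h⟩
  have hn1 : ((n - 1 : ℕ) : ℝ) = n - 1 := by
    rw [Nat.cast_sub (by omega)]; simp
  have hn2 : (2 : ℝ) ≤ n := by exact_mod_cast hn
  have hp0 : 0 < p := by linarith
  have hq0 : 0 < q := by linarith
  have hp1 : 0 < p - 1 := by linarith
  have hnm : 0 < (n : ℝ) - 1 := by linarith
  have key := linearRestrictionEstimate_of_bilinear (a := p⁻¹) (b := q⁻¹) (U := U)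
    hn hN hε (le_max_left A _) (le_max_right A _) (inv_pos.2 hp0) (inv_lt_one_of_one_lt₀ hp)
    (inv_pos.2 hq0) (inv_lt_one_of_one_lt₀ hq) ?_ ?_ (by simpa only [one_div] using hU)
    (fun a' b' ha' hb' hmem => h _ _ (inv_pos.2 ha') (inv_pos.2 hb')
      (by simpa only [one_div, inv_inv] using hmem))
  · simpa only [inv_inv] using key
  · rw [hn1, ← div_eq_mul_inv, div_lt_iff₀ hq0]
    rw [div_lt_iff₀ hnm] at hq2
    linarith
  · rw [Real.conjExponent, div_le_iff₀ hp1] at hpq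
    rw [hn1]
    have h1 : (1 - p⁻¹) = (p - 1) / p := by field_simp
    rw [h1, ← div_eq_mul_inv, ← mul_div_assoc, div_le_div_iff₀ hq0 hp0]
    have h2 : ((n : ℝ) - 1) / (n + 1) * (2 * q) * (p - 1) * (n + 1) =
        2 * (n - 1) * (p - 1) * q := by
      field_simp
    have h3 := mul_le_mul_of_nonneg_right hpq (show (0 : ℝ) ≤ n + 1 by linarith)
    rw [h2] at h3
    linarith
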